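/- **Setting.** Let $u_1=(0,0)$, $u_2=(1,0)$, $u_3=\frac12(1,\sqrt3)$ and $\psi_i(x)=\frac12(x-u_i)+u_i$ for $i\in\{1,2,3\}$; for a word $w=w_1\cdots w_n\in\{1,2,3\}^n$ put $\psi_w=\psi_{w_1}\circ\cdots\circ\psi_{w_n}$. The Sierpiński graph $G_0$ is the complete graph on $\{u_1,u_2,u_3\}$, and $VG_{n+1}=\bigcup_i\psi_i(VG_n)$, $EG_{n+1}=\bigcup_i\psi_i(EG_n)$. Let $K=\overline{\bigcup_n VG_n}$ be the Sierpiński gasket; the sets $\psi_w(K)$, $w\in\{1,2,3\}^n$, are its $n$-parts. *Trace.* For a spanning forest $f$ of $G_1$ each of whose components contains a corner $u_i$, define $\mathrm{Tr} f\subseteq EG_0$ as follows: if $f$ is a spanning tree and $i$ is the unique index such that for each $j\neq i$ the path in $f$ from $u_i$ to $u_j$ uses only edges of $\psi_i(G_0)\cup\psi_j(G_0)$, then $\mathrm{Tr} f$ consists of the two edges at $u_i$; if $f$ has two components, one of which contains $u_i$ and the other one the other two corners, then $\mathrm{Tr} f$ is the edge opposite to $u_i$; if $f$ has three components, each containing one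 corner, then $\mathrm{Tr} f=\emptyset$. For a spanning tree $f$ of $G_{n+1}$ put $\mathrm{Tr} f=\bigcup_{w\in\{1,2,3\}^n}\psi_w(\mathrm{Tr}\,\psi_w^{-1}(f\cap\psi_w(G_1)))$. Let $\mathcal T_\infty$ be the projective limit of the sets $\mathcal T_n$ of spanning trees of $G_n$ with respect to $\mathrm{Tr}$, i.e. the set of sequences $(T_n)_{n\ge0}$ with $T_n\in\mathcal T_n$ and $\mathrm{Tr}\,T_{n+1}=T_n$, with the product $\sigma$-algebra. *Curves.* Let $C$ be the set of continuous curves $\gamma\colon[0,\infty]\to K$ with $\gamma(0)=u_1$, $\gamma(\infty)=u_2$, and $\mathsf h(\gamma)=\inf\{t:\gamma(s)=u_2\text{ for all }s\ge t\}$. An *$n$-itinerary* of $\gamma$ consists of an integer $m\ge1$, times $0=t_0<\dots<t_m=\mathsf h(\gamma)$ and words $w_1,\dots,w_m\in\{1,2,3\}^n$ such that $\gamma([t_{j-1},t_j])\subseteq\psi_{w_j}(K)$ and $\gamma([t_{j-1},t_j])\cap\psi_{w_j}(K\setminus VG_0)\ne\emptyset$ for $1\le j\le m$, and $t_j=\inf\{s>t_{j-1}:\gamma(s)\notin\psi_{w_j}(K)\}$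 for $1\le j<m$. If $\gamma$ has a unique $n$-itinerary, write $\Delta_n(\gamma)=m$, $\mathsf t_{j,n}(\gamma)=t_j$, $W_n(\gamma)=(w_1,\dots,w_m)$ and $\mathsf s_{j,n}(\gamma)=t_j-t_{j-1}$. For a walk $x=(x_0,\dots,x_r)$ let $\mathrm{LI}(x)$ be the curve with value $(k+1-t)x_k+(t-k)x_{k+1}$ for $k\le t<k+1\le r$ and value $x_r$ for $t\ge r$, and put $\mathrm{LI}(x,\lambda)(t)=\mathrm{LI}(x)(\lambda t)$. Let $\bar\alpha=\frac43+\frac1{15}\sqrt{205}$, and for $T=(T_n)_{n\ge0}\in\mathcal T_\infty$ let $X_n=\mathrm{LI}(u_1T_nu_2,\bar\alpha^n)$, where $u_1T_nu_2$ is the self-avoiding walk from $u_1$ to $u_2$ in $T_n$. **Theorem.** There is exactly one probability measure $\mathbb P$ on $\mathcal T_\infty$ such that, for every $n$, $T_n$ is uniformly distributed on $\mathcal T_n$ (recall that the path $u_1T_nu_2$ in a uniform spanning tree is distributed as the loop-erased random walk on $G_n$ from $u_1$ to $u_2$). For all $T\in\mathcal T_\infty$ and $m\ge n\ge0$, $X_m\in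 C$ and $X_m$ has a unique $n$-itinerary. Let $\Omega'\subseteq\mathcal T_\infty$ be the event that for all $n\ge0$ and $1\le j\le\Delta_n(X_n)$ the limit $\mathsf S_{j,n}=\lim_{m\to\infty}\mathsf s_{j,n}(X_m)$ exists and belongs to $(0,\infty)$. Then $\Omega'$ occurs $\mathbb P$-almost surely. On $\Omega'$, put $\mathsf T_{j,n}=\sum_{1\le k\le j}\mathsf S_{k,n}$ for $0\le j\le\Delta_n(X_n)$. Then $\mathsf T_{j,n}=\lim_{m\to\infty}\mathsf t_{j,n}(X_m)<\infty$, and on $\Omega'$ the curves $X_n$ converge, uniformly on $[0,\infty]$, to a limit curve $X\in C$ with the following properties for all $n\ge0$: 1. $X(\mathsf T_{j,n})=X_n(\mathsf t_{j,n}(X_n))\in VG_n$ for $0\le j\le\Delta_n(X_n)$. 2. If $W_n(X_n)=(w_1,\dots,w_{\Delta_n(X_n)})$, then for all $0\le i<j\le\Delta_n(X_n)$: $X(\mathsf T_{i,n})\ne X(\mathsf T_{j,n})$; $X(\mathsf T_{j-1,n}),X(\mathsf T_{j,n})\in\psi_{w_j}(VG_0)$; $X([\mathsf T_{j-1,n},\mathsf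 T_{j,n}])\subseteq\psi_{w_j}(K)$; and $X([\mathsf T_{j-1,n},\mathsf T_{j,n}])\cap\psi_{w_j}(K\setminus VG_0)\ne\emptyset$. 3. $X$ has a unique $n$-itinerary, $\Delta_n(X)=\Delta_n(X_n)$ and $W_n(X)=W_n(X_n)$. -/

import Mathlib

open Set Filter Topology MeasureTheory
open scoped ENNReal

noncomputable section

namespace Sierpinski

/-! ### The Sierpinski graphs and the Sierpinski gasket

The letters `1, 2, 3` are represented by the elements `0, 1, 2` of `Fin 3`. -/

/-- The Euclidean plane. -/
abbrev Plane : Type := EuclideanSpace ℝ (Fin 2)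

/-- The corners `(0,0)`, `(1,0)`, `(1/2, √3/2)` of the basic triangle. -/
def u : Fin 3 → Plane := ![!₂[0, 0], !₂[1, 0], !₂[1 / 2, √3 / 2]]

/-- The three similitudes of ratio `1/2` fixing the corners. -/
def ψ (i : Fin 3) (x : Plane) : Plane := (1 / 2 : ℝ) • (x - u i) + u i

/-- `ψw (w₁ ⋯ wₙ) = ψ w₁ ∘ ⋯ ∘ ψ wₙ`. -/
def ψw : List (Fin 3) → Plane → Plane
  | [] => id
  | i :: w => ψ i ∘ ψw w

/-- The vertex set of the `n`-th Sierpinski graph. -/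
def VG : ℕ → Set Plane
  | 0 => range u
  | n + 1 => ⋃ i, ψ i '' VG n

/-- The edge set of the `n`-th Sierpinski graph. -/
def EG : ℕ → Set (Sym2 Plane)
  | 0 => {e | ∃ i j, i ≠ j ∧ e = s(u i, u j)}
  | n + 1 => ⋃ i, Sym2.map (ψ i) '' EG n

/-- The Sierpinski gasket: the closure of the union of the vertex sets `VG n`. It is non-empty,
compact and equal to the union of its images under `ψ 0`, `ψ 1`, `ψ 2` (see below). -/
def gasket : Set Plane := closure (⋃ n, VG n)

theorem psi_corner (i : Fin 3) : ψ i (u i) = u i := by simp [ψ]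

theorem corner_mem : ∀ (n : ℕ) (i : Fin 3), u i ∈ VG n
  | 0, i => ⟨i, rfl⟩
  | n + 1, i => mem_iUnion.2 ⟨i, u i, corner_mem n i, psi_corner i⟩

theorem continuous_psi (i : Fin 3) : Continuous (ψ i) := by
  unfold ψ; fun_prop

theorem gasket_nonempty : gasket.Nonempty :=
  ⟨u 0, subset_closure (mem_iUnion.2 ⟨0, corner_mem 0 0⟩)⟩

theorem VG_bounded : ∃ R : ℝ, ∀ n, VG n ⊆ Metric.closedBall 0 R := by
  refine ⟨∑ i, ‖u i‖, fun n => ?_⟩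
  have hu : ∀ i, ‖u i‖ ≤ ∑ i, ‖u i‖ := fun i =>
    Finset.single_le_sum (f := fun i => ‖u i‖) (fun j _ => norm_nonneg _) (Finset.mem_univ i)
  induction n with
  | zero => rintro _ ⟨i, rfl⟩; simpa using hu i
  | succ n ih =>
    intro x hx
    obtain ⟨i, y, hy, rfl⟩ := mem_iUnion.1 hx
    have h1 : ‖y‖ ≤ ∑ i, ‖u i‖ := by simpa using ih hy
    have h2 : ψ i y = (1 / 2 : ℝ) • y + (1 / 2 : ℝ) • u i := by
      unfold ψ; module
    rw [mem_closedBall_zero_iff, h2]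
    refine (norm_add_le _ _).trans ?_
    rw [norm_smul, norm_smul]
    norm_num
    linarith [hu i]

theorem gasket_isCompact : IsCompact gasket := by
  obtain ⟨R, hR⟩ := VG_bounded
  exact (isCompact_closedBall (0 : Plane) R).closure_of_subset (iUnion_subset hR)

theorem VG_subset_succ : ∀ n, VG n ⊆ VG (n + 1)
  | 0 => by rintro _ ⟨i, rfl⟩; exact corner_mem 1 i
  | n + 1 => iUnion_mono fun i => image_mono (VG_subset_succ n)

/-- The gasket satisfies the defining equation of the self-similar set. -/
theorem gasket_self_similar : gasket = ⋃ i, ψ i '' gasket := by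
  have h : (⋃ n, VG n) = ⋃ i, ψ i '' (⋃ n, VG n) := by
    apply Subset.antisymm
    · refine iUnion_subset fun n x hx => ?_
      obtain ⟨i, y, hy, rfl⟩ := mem_iUnion.1 (VG_subset_succ n hx)
      exact mem_iUnion.2 ⟨i, y, mem_iUnion.2 ⟨n, hy⟩, rfl⟩
    · refine iUnion_subset fun i => ?_
      rintro _ ⟨y, hy, rfl⟩
      obtain ⟨n, hn⟩ := mem_iUnion.1 hy
      exact mem_iUnion.2 ⟨n + 1, mem_iUnion.2 ⟨i, y, hn, rfl⟩⟩
  have hc : ∀ i, closure (ψ i '' (⋃ n, VG n)) = ψ i '' gasket := fun i =>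
    Subset.antisymm
      (closure_minimal (image_mono subset_closure)
        (gasket_isCompact.image (continuous_psi i)).isClosed)
      (image_closure_subset_closure_image (continuous_psi i))
  conv_lhs => rw [gasket, h, closure_iUnion_of_finite]
  simp only [hc]

/-! ### Spanning trees, spanning forests and the trace -/

/-- The spanning subgraph of the `n`-th Sierpinski graph with edge set `F`. Spanning subgraphs are
represented by their edge sets. -/
def spanGraph (n : ℕ) (F : Set (Sym2 Plane)) : SimpleGraph (VG n) where
  Adj x y := x ≠ y ∧ s((x : Plane), (y : Plane)) ∈ F
  symm := ⟨fun _ _ h => ⟨h.1.symm, Sym2.eq_swap ▸ h.2⟩⟩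
  loopless := ⟨fun _ h => h.1 rfl⟩

/-- The corner `u i` as a vertex of the `n`-th Sierpinski graph. -/
def corner (n : ℕ) (i : Fin 3) : VG n := ⟨u i, corner_mem n i⟩

/-- The (edge sets of the) spanning trees of the `n`-th Sierpinski graph. -/
def spanningTrees (n : ℕ) : Set (Set (Sym2 Plane)) :=
  {F | F ⊆ EG n ∧ (spanGraph n F).IsTree}

/-- The spanning trees of the graph of level `n + 1` for which the self-avoiding walks from `u i`
to the other corners `u j` stay in the parts with addresses `i` and `j`. -/
def treesOfType (n : ℕ) (i : Fin 3) : Set (Set (Sym2 Plane)) :=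
  {F | F ∈ spanningTrees (n + 1) ∧
    ∀ j, j ≠ i → ∀ p : (spanGraph (n + 1) F).Walk (corner (n + 1) i) (corner (n + 1) j),
      p.IsPath → ∀ e ∈ p.edges,
        Sym2.map Subtype.val e ∈ Sym2.map (ψ i) '' EG n ∪ Sym2.map (ψ j) '' EG n}

/-- The spanning forests of the `n`-th Sierpinski graph with two components, one of which contains
`u i` and the other one the other two corners. -/
def twoForests (n : ℕ) (i : Fin 3) : Set (Set (Sym2 Plane)) :=
  {F | F ⊆ EG n ∧ (spanGraph n F).IsAcyclic ∧
    Nat.card (spanGraph n F).ConnectedComponent = 2 ∧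
    (∀ j, j ≠ i → ¬ (spanGraph n F).Reachable (corner n i) (corner n j)) ∧
    ∀ j k, j ≠ i → k ≠ i → (spanGraph n F).Reachable (corner n j) (corner n k)}

/-- The restriction of a subgraph to the part with address `w`, rescaled to a subgraph of the
Sierpinski graph of level `k`. -/
def restrict (w : List (Fin 3)) (k : ℕ) (F : Set (Sym2 Plane)) : Set (Sym2 Plane) :=
  {e | e ∈ EG k ∧ Sym2.map (ψw w) e ∈ F}

/-- The trace of a forest of level `1`: a tree of type `i` becomes the path with middle vertex
`u i`, a forest that only separates `u i` becomes the edge opposite to `u i`, and a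
forest that separates all three corners becomes the forest without edges. -/
def traceOne (F : Set (Sym2 Plane)) : Set (Sym2 Plane) :=
  {e | e ∈ EG 0 ∧ ((∃ i, F ∈ treesOfType 0 i ∧ u i ∈ e) ∨ ∃ i, F ∈ twoForests 1 i ∧ u i ∉ e)}

/-- The trace of a forest of level `n + 1`, a forest of level `n`: the forest in each
part of level `n` is replaced by its trace. -/
def trace (n : ℕ) (F : Set (Sym2 Plane)) : Set (Sym2 Plane) :=
  ⋃ w ∈ {w : List (Fin 3) | w.length = n}, Sym2.map (ψw w) '' traceOne (restrict w 1 F)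

/-- The projective limit of the sets of spanning trees with respect to the trace. -/
def TreeLimit : Type :=
  {T : ℕ → Set (Sym2 Plane) // ∀ n, T n ∈ spanningTrees n ∧ trace n (T (n + 1)) = T n}

/-- The product σ-algebra (there are only finitely many spanning trees of each level). -/
instance : MeasurableSpace TreeLimit :=
  MeasurableSpace.generateFrom {A | ∃ n F, A = {T : TreeLimit | T.1 n = F}}

/-- `P` is the law of the projective limit of uniform spanning trees: for each `n`, the tree of
level `n` is uniformly distributed on the spanning trees of the `n`-th Sierpinski graph. -/
def IsUniformTreeLaw (P : Measure TreeLimit) : Prop :=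
  IsProbabilityMeasure P ∧
    ∀ n, ∀ F ∈ spanningTrees n, P {T | T.1 n = F} = ((spanningTrees n).ncard : ℝ≥0∞)⁻¹

/-! ### Curves -/

/-- The continuous curves `[0,∞] → K` from the first to the second corner. -/
def Curves : Set (ℝ≥0∞ → Plane) :=
  {γ | Continuous γ ∧ (∀ t, γ t ∈ gasket) ∧ γ 0 = u 0 ∧ γ ∞ = u 1}

/-- The time from which on the curve stays in the second corner. -/
def hit (γ : ℝ≥0∞ → Plane) : ℝ≥0∞ := sInf {t | ∀ s, t ≤ s → γ s = u 1}

/-- `γ` walks along the `n`-parts with addresses `ws = (w₁, …, w_m)`, in this order, and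
`ts = (t₀, …, t_m)` where `0 = t₀ < ⋯ < t_m = hit γ` and `t_j` is, for `1 ≤ j < m`, the exit time
of `γ` from the part `w_j` after time `t_{j-1}`. (Lists are indexed from `0`, so
`w_{j+1} = ws.getD j []`.) -/
structure IsItinerary (n : ℕ) (γ : ℝ≥0∞ → Plane) (ts : List ℝ≥0∞) (ws : List (List (Fin 3))) :
    Prop where
  one_le : 1 ≤ ws.length
  length_eq : ts.length = ws.length + 1
  word_length : ∀ w ∈ ws, w.length = n
  start : ts.getD 0 0 = 0
  increasing : ∀ j < ws.length, ts.getD j 0 < ts.getD (j + 1) 0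
  final : ts.getD ws.length 0 = hit γ
  inside : ∀ j < ws.length,
    γ '' Icc (ts.getD j 0) (ts.getD (j + 1) 0) ⊆ ψw (ws.getD j []) '' gasket
  meets : ∀ j < ws.length,
    (γ '' Icc (ts.getD j 0) (ts.getD (j + 1) 0) ∩ ψw (ws.getD j []) '' (gasket \ VG 0)).Nonempty
  exit : ∀ j, j + 1 < ws.length →
    ts.getD (j + 1) 0 = sInf {s | ts.getD j 0 < s ∧ γ s ∉ ψw (ws.getD j []) '' gasket}

/-- `γ` passes through finitely many `n`-parts, and the sequences of parts and of exit times are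
determined by `γ`. -/
def HasItinerary (n : ℕ) (γ : ℝ≥0∞ → Plane) : Prop :=
  ∃! I : List ℝ≥0∞ × List (List (Fin 3)), IsItinerary n γ I.1 I.2

open Classical in
/-- The pair of the sequence of times `t₀, …, t_m` and the sequence of parts `w₁, …, w_m`
(two empty sequences if there is no such pair). -/
def itinerary (n : ℕ) (γ : ℝ≥0∞ → Plane) : List ℝ≥0∞ × List (List (Fin 3)) :=
  if h : ∃ I : List ℝ≥0∞ × List (List (Fin 3)), IsItinerary n γ I.1 I.2 then h.choose else ([], [])

/-- The sequence `W_n(γ) = (w₁, …, w_m)` of (the addresses of) the traversed `n`-parts. -/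
def W (n : ℕ) (γ : ℝ≥0∞ → Plane) : List (List (Fin 3)) := (itinerary n γ).2

/-- The number `Δ_n(γ) = m` of traversed `n`-parts. -/
def Δ (n : ℕ) (γ : ℝ≥0∞ → Plane) : ℕ := (W n γ).length

/-- The exit time `t_{j,n}(γ)` from the `j`-th traversed `n`-part, for `0 ≤ j ≤ Δ_n(γ)`. -/
def exitTime (j n : ℕ) (γ : ℝ≥0∞ → Plane) : ℝ≥0∞ := (itinerary n γ).1.getD j 0

/-- The time `s_{j,n}(γ)` spent in the `j`-th traversed `n`-part, for `1 ≤ j ≤ Δ_n(γ)`. -/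
def sojourn (j n : ℕ) (γ : ℝ≥0∞ → Plane) : ℝ≥0∞ := exitTime j n γ - exitTime (j - 1) n γ

/-- Linear interpolation, with constant extension, of a walk `(x 0, …, x r)`. -/
def LI (x : ℕ → Plane) (r : ℕ) (t : ℝ≥0∞) : Plane :=
  if t < r then
    ((⌊t.toReal⌋₊ : ℝ) + 1 - t.toReal) • x ⌊t.toReal⌋₊ +
      (t.toReal - (⌊t.toReal⌋₊ : ℝ)) • x (⌊t.toReal⌋₊ + 1)
  else x r

/-- Linear interpolation with rescaled time. -/
def LIscaled (x : ℕ → Plane) (r : ℕ) (c : ℝ) (t : ℝ≥0∞) : Plane := LI x r (ENNReal.ofReal c * t)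

/-- The unique self-avoiding walk between two vertices in a spanning tree. -/
def treeWalk {n : ℕ} {F : Set (Sym2 Plane)} (hF : F ∈ spanningTrees n) (x y : VG n) :
    (spanGraph n F).Walk x y :=
  (hF.2.existsUnique_path x y).choose

/-- The scaling factor `4/3 + √205/15`. -/
def α : ℝ := 4 / 3 + √205 / 15

/-- The curve `X_n`: the interpolated walk from the first to the second corner in the tree of
level `n`, with time rescaled by `α ^ n`. -/
def X (n : ℕ) (T : TreeLimit) : ℝ≥0∞ → Plane :=
  let p := treeWalk (T.2 n).1 (corner n 0) (corner n 1)
  LIscaled (fun k => (p.getVert k : Plane)) p.length (α ^ n)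

/-- The event that, for all `n`, the times spent by `X_m` in the `n`-parts that are
traversed by `X_n` converge, as `m → ∞`, to positive and finite limits. -/
def Ω' : Set TreeLimit :=
  {T | ∀ n j, 1 ≤ j → j ≤ Δ n (X n T) →
    ∃ S : ℝ≥0∞, 0 < S ∧ S < ∞ ∧ Tendsto (fun m => sojourn j n (X m T)) atTop (𝓝 S)}

/-- The limit `S_{j,n}` of the times spent in the `j`-th traversed `n`-part. -/
def limitSojourn (j n : ℕ) (T : TreeLimit) : ℝ≥0∞ :=
  limUnder atTop fun m => sojourn j n (X m T)

/-- The time `T_{j,n} = S_{1,n} + ⋯ + S_{j,n}`. -/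
def limitTime (j n : ℕ) (T : TreeLimit) : ℝ≥0∞ :=
  ∑ k ∈ Finset.Icc 1 j, limitSojourn k n T

end Sierpinski

end

/-! The trace acts cell by cell. In a cell of level `n` a spanning tree of level `n + 1` induces a
forest on nine edges which is good: it is acyclic and each component contains a corner of the cell.
Conversely, `mem_spanningTrees_succ` shows that a subgraph of level `n + 1` is a spanning tree as
soon as all local forests are good and its trace is a spanning tree. The reason is that the trace
preserves connectivity between vertices of level `n`, and that it removes `3 * 3 ^ n` edges, exactly
the number of vertices that disappear. Lifting a tree therefore means choosing, independently in
each cell, a good forest with prescribed trace. A prescribed trace with `e` edges has `50 * (3/5)^e`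
good forests above it, so the number of lifts depends only on the total number of edges, which is
the same for all spanning trees of one level (`card_lifts_eq`). Independent uniform choices thus
give uniform trees on all levels, and given the tree of one level the local forests of the next are
independent and uniform. The facts about a single cell are verified by kernel evaluation over the
512 subgraphs of the graph of level one.

The path from `u 0` to `u 1` is described by passages through cells, refined from level to level by
the local forests (`support_treeWalk`). No cell is entered twice, and the cells of level `n`
traversed by the path are the same in all later trees. The time which `X m` spends in one of them is
the number of edges in the refinement of a fixed passage, divided by `α ^ m`. These numbers evolve
like a branching process with three types of passages. Its mean matrix has rank two, so two weights
suffice; they evolve by the matrix `(1, 2; 2/5, 5/3)` with leading eigenvalue `α`. Since the choices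
are conditionally independent and every passage has at least two subpassages, Chebyshev's inequality
and the Borel–Cantelli lemma bound the deviations by `(3/4)^d` times the number of passages, for all
large `d` (`ae_eventually_deviation_le`). The perturbed linear recursion then gives positive limits
(`exists_limit_of_recursion`), so `Ω'` has full measure.

The rest is deterministic. On `Ω'` the exit times of each level converge to strictly increasing
limits. At a fixed time all late curves are therefore within one cell diameter of a common point
(`exists_close`), whence uniform convergence. The limit visits the same cells and points
(`traverses_limit`), and `Traverses.exists_itinerary` with `IsItinerary.unique` extracts its
itinerary. -/

noncomputable section

namespace Sierpinski

section

/-! ### Barycentric coordinates -/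

/-- The barycentric coordinates with respect to the corners. -/
def bary (k : Fin 3) (x : Plane) : ℝ :=
  ![1 - x 0 - x 1 / √3, x 0 - x 1 / √3, 2 * (x 1 / √3)] k

theorem bary_corner (k i : Fin 3) : bary k (u i) = if i = k then 1 else 0 := by
  have h : √3 / 2 / √3 = 1 / 2 := by field_simp
  have h' : √3 / (2 * √3) = 1 / 2 := by field_simp
  fin_cases k <;> fin_cases i <;> simp [bary, u, h]
  norm_num [h']

theorem bary_psi (k i : Fin 3) (x : Plane) :
    bary k (ψ i x) = (bary k x + if i = k then 1 else 0) / 2 := by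
  rw [← bary_corner]
  fin_cases k <;> simp [bary, ψ] <;> ring

theorem bary_ext {x y : Plane} (h : ∀ k, bary k x = bary k y) : x = y := by
  have h1 := h 1
  have h2 := h 2
  have h3 : √3 ≠ 0 := by positivity
  simp only [bary, Matrix.cons_val] at h1 h2
  have h4 : x 1 / √3 = y 1 / √3 := by linarith
  have h5 : x 1 = y 1 := by field_simp at h4; exact h4
  ext i
  fin_cases i
  · simp only [Fin.zero_eta]; linarith
  · simpa using h5

theorem bary_sum (x : Plane) : ∑ k, bary k x = 1 := by
  simp [Fin.sum_univ_three, bary]; ring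

theorem continuous_bary (k : Fin 3) : Continuous (bary k) := by
  fin_cases k
  · exact (by fun_prop : Continuous fun x : Plane => 1 - x 0 - x 1 / √3)
  · exact (by fun_prop : Continuous fun x : Plane => x 0 - x 1 / √3)
  · exact (by fun_prop : Continuous fun x : Plane => 2 * (x 1 / √3))

theorem bary_nonneg {x : Plane} (hx : x ∈ gasket) (k : Fin 3) : 0 ≤ bary k x := by
  have hV : ∀ n, ∀ x ∈ VG n, ∀ k, 0 ≤ bary k x := by
    intro n
    induction n with
    | zero => rintro _ ⟨i, rfl⟩ k; rw [bary_corner]; split_ifs <;> norm_num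
    | succ n ih =>
      intro x hx k
      obtain ⟨i, y, hy, rfl⟩ := mem_iUnion.1 hx
      rw [bary_psi]
      have := ih y hy k
      split_ifs <;> linarith
  have : gasket ⊆ {x | 0 ≤ bary k x} :=
    closure_minimal (iUnion_subset fun n x hx => hV n x hx k)
      (isClosed_le continuous_const (continuous_bary k))
  exact this hx

theorem corner_injective : Function.Injective u := by
  intro i j h
  by_contra hij
  have := congrArg (bary i) h
  rw [bary_corner, bary_corner, if_pos rfl, if_neg (Ne.symm hij)] at this
  norm_num at this

theorem psi_injective (i : Fin 3) : Function.Injective (ψ i) := by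
  intro x y h
  refine bary_ext fun k => ?_
  have := congrArg (bary k) h
  rw [bary_psi, bary_psi] at this
  linarith

theorem psi_corner_comm (i j : Fin 3) : ψ i (u j) = ψ j (u i) := by
  refine bary_ext fun k => ?_
  rw [bary_psi, bary_psi, bary_corner, bary_corner]
  ring

theorem corner_mem_gasket (i : Fin 3) : u i ∈ gasket :=
  subset_closure (mem_iUnion.2 ⟨0, i, rfl⟩)

theorem psi_mem_gasket {x : Plane} (hx : x ∈ gasket) (i : Fin 3) : ψ i x ∈ gasket := by
  rw [gasket_self_similar]
  exact mem_iUnion.2 ⟨i, x, hx, rfl⟩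

/-! ### Addresses and cells -/

/-- The part of the gasket with address `w`. -/
abbrev cell (w : List (Fin 3)) : Set Plane := ψw w '' gasket

@[simp] theorem psiw_nil (x : Plane) : ψw [] x = x := rfl

@[simp] theorem psiw_cons (i : Fin 3) (w : List (Fin 3)) (x : Plane) :
    ψw (i :: w) x = ψ i (ψw w x) := rfl

theorem psiw_append (v w : List (Fin 3)) (x : Plane) : ψw (v ++ w) x = ψw v (ψw w x) := by
  induction v with
  | nil => rfl
  | cons i v ih => simp [ih]

theorem psiw_injective (w : List (Fin 3)) : Function.Injective (ψw w) := by
  induction w with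
  | nil => exact fun _ _ h => h
  | cons i w ih => exact (psi_injective i).comp ih

theorem psiw_mem_gasket {x : Plane} (hx : x ∈ gasket) (w : List (Fin 3)) : ψw w x ∈ gasket := by
  induction w with
  | nil => exact hx
  | cons i w ih => exact psi_mem_gasket ih i

theorem cell_subset_gasket (w : List (Fin 3)) : cell w ⊆ gasket := by
  rintro _ ⟨x, hx, rfl⟩
  exact psiw_mem_gasket hx w

theorem continuous_psiw (w : List (Fin 3)) : Continuous (ψw w) := by
  induction w with
  | nil => exact continuous_id
  | cons i w ih => exact (continuous_psi i).comp ih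

theorem isClosed_cell (w : List (Fin 3)) : IsClosed (cell w) :=
  (gasket_isCompact.image (continuous_psiw w)).isClosed

theorem dist_psi (i : Fin 3) (x y : Plane) : dist (ψ i x) (ψ i y) = 1 / 2 * dist x y := by
  rw [dist_eq_norm, dist_eq_norm, show ψ i x - ψ i y = (1 / 2 : ℝ) • (x - y) by unfold ψ; module,
    norm_smul]
  norm_num

theorem dist_psiw (w : List (Fin 3)) (x y : Plane) :
    dist (ψw w x) (ψw w y) = (1 / 2) ^ w.length * dist x y := by
  induction w with
  | nil => simp
  | cons i w ih => rw [psiw_cons, psiw_cons, dist_psi, ih, List.length_cons]; ring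

theorem dist_le_of_mem_cell {w : List (Fin 3)} {x y : Plane} (hx : x ∈ cell w) (hy : y ∈ cell w) :
    dist x y ≤ (1 / 2) ^ w.length * Metric.diam gasket := by
  obtain ⟨x, hx, rfl⟩ := hx
  obtain ⟨y, hy, rfl⟩ := hy
  rw [dist_psiw]
  gcongr
  exact Metric.dist_le_diam_of_mem gasket_isCompact.isBounded hx hy

/-- The corners of the part with address `w`. -/
def pt (w : List (Fin 3)) (i : Fin 3) : Plane := ψw w (u i)

theorem pt_mem_cell (w : List (Fin 3)) (i : Fin 3) : pt w i ∈ cell w :=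
  ⟨u i, corner_mem_gasket i, rfl⟩

theorem pt_injective (w : List (Fin 3)) : Function.Injective (pt w) :=
  (psiw_injective w).comp corner_injective

theorem psiw_mem_VG {n : ℕ} {x : Plane} (hx : x ∈ VG n) (w : List (Fin 3)) :
    ψw w x ∈ VG (w.length + n) := by
  induction w with
  | nil => simpa using hx
  | cons i w ih =>
    rw [List.length_cons, Nat.add_right_comm]
    exact mem_iUnion.2 ⟨i, _, ih, rfl⟩

theorem pt_mem_VG (w : List (Fin 3)) (i : Fin 3) : pt w i ∈ VG w.length :=
  psiw_mem_VG (n := 0) ⟨i, rfl⟩ w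

theorem exists_pt_of_mem_VG {n : ℕ} {x : Plane} (hx : x ∈ VG n) :
    ∃ w : List (Fin 3), w.length = n ∧ ∃ i, x = pt w i := by
  induction n generalizing x with
  | zero =>
    obtain ⟨i, rfl⟩ := hx
    exact ⟨[], rfl, i, rfl⟩
  | succ n ih =>
    obtain ⟨i, y, hy, rfl⟩ := mem_iUnion.1 hx
    obtain ⟨w, rfl, j, rfl⟩ := ih hy
    exact ⟨i :: w, rfl, j, rfl⟩

/-- Comparing the `j`-th barycentric coordinates gives `bary j x = bary j y + 1`. On the gasket the
coordinates are nonnegative with sum one, so `x` must be the corner `u j`; the argument for `y` is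
symmetric. -/
theorem eq_of_mem_psi_psi {i j : Fin 3} (hij : i ≠ j) {x y : Plane} (hx : x ∈ gasket)
    (hy : y ∈ gasket) (h : ψ i x = ψ j y) : x = u j ∧ y = u i := by
  have hs := bary_sum x
  have ht := bary_sum y
  have hb : ∀ k, bary k x + (if i = k then 1 else 0) = bary k y + if j = k then 1 else 0 := by
    intro k
    have := congrArg (bary k) h
    rw [bary_psi, bary_psi] at this
    linarith
  have hx' := fun k => bary_nonneg hx k
  have hy' := fun k => bary_nonneg hy k
  rw [Fin.sum_univ_three] at hs ht
  have h0 := hb 0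
  have h1 := hb 1
  have h2 := hb 2
  have a0 := hx' 0
  have a1 := hx' 1
  have a2 := hx' 2
  have b0 := hy' 0
  have b1 := hy' 1
  have b2 := hy' 2
  constructor <;> refine bary_ext fun k => ?_ <;> rw [bary_corner] <;>
    fin_cases i <;> fin_cases j <;> simp at h0 h1 h2 hij <;>
    fin_cases k <;> simp <;> linarith

/-- For `i ≠ j` the `j`-th coordinate of a point of `ψ i '' gasket` is at most one half. -/
theorem eq_of_corner_mem_psi {i j : Fin 3} {x : Plane} (hx : x ∈ gasket) (h : u j = ψ i x) :
    i = j := by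
  by_contra hij
  have h1 := congrArg (bary j) h
  rw [bary_corner, bary_psi, if_pos rfl, if_neg hij] at h1
  have h2 := bary_sum x
  rw [Fin.sum_univ_three] at h2
  have a0 := bary_nonneg hx 0
  have a1 := bary_nonneg hx 1
  have a2 := bary_nonneg hx 2
  fin_cases j <;> simp at h1 <;> linarith

theorem eq_replicate_of_corner_mem_cell {j : Fin 3} {w : List (Fin 3)} (h : u j ∈ cell w) :
    w = List.replicate w.length j := by
  induction w with
  | nil => rfl
  | cons i w ih =>
    obtain ⟨x, hx, hxj⟩ := h
    obtain rfl := eq_of_corner_mem_psi (psiw_mem_gasket hx w) hxj.symm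
    rw [List.length_cons, List.replicate_succ, ← ih]
    refine ⟨x, hx, psi_injective i ?_⟩
    rw [psi_corner]; exact hxj

theorem pt_replicate (n : ℕ) (j : Fin 3) : pt (List.replicate n j) j = u j := by
  induction n with
  | zero => rfl
  | succ n ih =>
    rw [List.replicate_succ]
    exact (congrArg (ψ j) ih).trans (psi_corner j)

/-- After removing the common prefix, the only shared point is `ψ i (u j)` with `i ≠ j` the first
differing letters. Only the cell with constant address contains the corner `u j`, and it has `u j`
as a corner. -/
theorem exists_pt_of_mem_cell_inter {v w : List (Fin 3)} (hl : v.length = w.length) (hvw : v ≠ w)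
    {x : Plane} (hv : x ∈ cell v) (hw : x ∈ cell w) : ∃ i, x = pt v i := by
  induction v generalizing w x with
  | nil => exact absurd (List.eq_nil_of_length_eq_zero hl.symm).symm hvw
  | cons i v ih =>
    obtain _ | ⟨j, w⟩ := w
    · simp at hl
    obtain ⟨y, hy, rfl⟩ := hv
    obtain ⟨z, hz, hzy⟩ := hw
    rw [psiw_cons, psiw_cons] at hzy
    by_cases hij : i = j
    · subst hij
      have hzy := psi_injective i hzy
      obtain ⟨k, hk⟩ := ih (w := w) (by simpa using hl) (by simpa using hvw) ⟨y, hy, rfl⟩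
        ⟨z, hz, hzy⟩
      exact ⟨k, congrArg (ψ i) hk⟩
    · obtain ⟨h1, h2⟩ := eq_of_mem_psi_psi hij (psiw_mem_gasket hy v) (psiw_mem_gasket hz w)
        hzy.symm
      refine ⟨j, congrArg (ψ i) ?_⟩
      have h3 := eq_replicate_of_corner_mem_cell (h1 ▸ (⟨y, hy, rfl⟩ : ψw v y ∈ cell v))
      rw [h1, h3]
      exact (pt_replicate _ j).symm

theorem eq_of_mem_cell_inter {v w : List (Fin 3)} (hl : v.length = w.length) (hvw : v ≠ w)
    {x y : Plane} (hv : x ∈ cell v) (hw : x ∈ cell w) (hv' : y ∈ cell v) (hw' : y ∈ cell w) :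
    x = y := by
  induction v generalizing w x y with
  | nil => exact absurd (List.eq_nil_of_length_eq_zero hl.symm).symm hvw
  | cons i v ih =>
    obtain _ | ⟨j, w⟩ := w
    · simp at hl
    obtain ⟨x, hx, rfl⟩ := hv
    obtain ⟨x', hx', hxx⟩ := hw
    obtain ⟨y, hy, rfl⟩ := hv'
    obtain ⟨y', hy', hyy⟩ := hw'
    rw [psiw_cons, psiw_cons] at *
    by_cases hij : i = j
    · subst hij
      have hxx := psi_injective i hxx
      have hyy := psi_injective i hyy
      exact congrArg (ψ i) (ih (w := w) (by simpa using hl) (by simpa using hvw) ⟨x, hx, rfl⟩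
        ⟨x', hx', hxx⟩ ⟨y, hy, rfl⟩ ⟨y', hy', hyy⟩)
    · rw [(eq_of_mem_psi_psi hij (psiw_mem_gasket hx v) (psiw_mem_gasket hx' w) hxx.symm).1,
        (eq_of_mem_psi_psi hij (psiw_mem_gasket hy v) (psiw_mem_gasket hy' w) hyy.symm).1]

/-- A point lies in at most two cells of the same level. -/
theorem eq_of_mem_three_cells {v w w' : List (Fin 3)} (hl : v.length = w.length)
    (hl' : v.length = w'.length) (hvw : v ≠ w) (hvw' : v ≠ w') {x : Plane} (hv : x ∈ cell v)
    (hw : x ∈ cell w) (hw' : x ∈ cell w') : w = w' := by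
  induction v generalizing w w' x with
  | nil => exact absurd (List.eq_nil_of_length_eq_zero hl.symm).symm hvw
  | cons i v ih =>
    obtain _ | ⟨j, w⟩ := w
    · simp at hl
    obtain _ | ⟨j', w'⟩ := w'
    · simp at hl'
    obtain ⟨x, hx, rfl⟩ := hv
    obtain ⟨y, hy, hyx⟩ := hw
    obtain ⟨z, hz, hzx⟩ := hw'
    rw [psiw_cons, psiw_cons] at *
    -- Sharing a point with a cell whose address begins with another letter `j` forces the remaining
    -- address to be constantly `j`. Two cells with the same first letter and this property
    -- coincide, which settles the mixed cases below.
    have key : ∀ {i j : Fin 3} {v w : List (Fin 3)} {x y : Plane}, i ≠ j → x ∈ gasket →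
        y ∈ gasket → ψ j (ψw w y) = ψ i (ψw v x) →
        v = List.replicate v.length j ∧ ψw v x = u j := by
      intro i j v w x y hij hx hy h
      have h1 := (eq_of_mem_psi_psi hij (psiw_mem_gasket hx v) (psiw_mem_gasket hy w) h.symm).1
      exact ⟨eq_replicate_of_corner_mem_cell (h1 ▸ ⟨x, hx, rfl⟩), h1⟩
    simp only [List.length_cons, Nat.add_right_cancel_iff] at hl hl'
    by_cases hij : i = j
    · subst hij
      by_cases hij' : i = j'
      · subst hij'
        rw [ih (w := w) (w' := w') hl hl' (by simpa using hvw) (by simpa using hvw')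
          ⟨x, hx, rfl⟩ ⟨y, hy, psi_injective i hyx⟩ ⟨z, hz, psi_injective i hzx⟩]
      · exfalso
        have h1 := (key hij' hx hz hzx).1
        have h2 := (key hij' hy hz (hzx.trans hyx.symm)).1
        exact hvw (by rw [h1, h2, hl])
    · by_cases hij' : i = j'
      · subst hij'
        exfalso
        have h1 := (key hij hx hy hyx).1
        have h2 := (key hij hz hy (hyx.trans hzx.symm)).1
        exact hvw' (by rw [h1, h2, hl'])
      · have hjj : j = j' := corner_injective ((key hij hx hy hyx).2.symm.trans (key hij' hx hz hzx).2)
        subst hjj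
        have h1 := (key (Ne.symm hij) hy hx hyx.symm).1
        have h2 := (key (Ne.symm hij) hz hx hzx.symm).1
        rw [h1, h2, ← hl, ← hl']

theorem psi_add_smul (i : Fin 3) (x y : Plane) (s t : ℝ) (h : s + t = 1) :
    ψ i (s • x + t • y) = s • ψ i x + t • ψ i y := by
  obtain rfl : t = 1 - s := by linarith
  unfold ψ; module

theorem psiw_add_smul (w : List (Fin 3)) (x y : Plane) (s t : ℝ) (h : s + t = 1) :
    ψw w (s • x + t • y) = s • ψw w x + t • ψw w y := by
  induction w with
  | nil => rfl
  | cons i w ih => rw [psiw_cons, ih, psi_add_smul _ _ _ _ _ h]; rfl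

/-- Each half of a side is the image of the whole side under `ψ i` or `ψ j`, and these maps halve
the distance to the gasket. Iterating, the distance is at most a multiple of `2 ^ (-n)` for all `n`,
hence zero. This is what keeps the interpolated walks in the gasket. -/
theorem segment_corner_subset_gasket (i j : Fin 3) : segment ℝ (u i) (u j) ⊆ gasket := by
  have key : ∀ n : ℕ, ∀ t : ℝ, 0 ≤ t → t ≤ 1 →
      Metric.infDist ((1 - t) • u i + t • u j) gasket ≤ (1 / 2) ^ n * dist (u i) (u j) := by
    intro n
    induction n with
    | zero =>
      intro t h0 h1
      refine (Metric.infDist_le_dist_of_mem (corner_mem_gasket i)).trans ?_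
      rw [dist_eq_norm, show (1 - t) • u i + t • u j - u i = t • (u j - u i) by module, norm_smul,
        dist_eq_norm, norm_sub_rev (u i), Real.norm_of_nonneg h0, pow_zero]
      gcongr
    | succ n ih =>
      have hhalf : ∀ (k : Fin 3) (y : Plane),
          Metric.infDist (ψ k y) gasket ≤ 1 / 2 * Metric.infDist y gasket := by
        intro k y
        obtain ⟨z, hz, hyz⟩ := gasket_isCompact.exists_infDist_eq_dist gasket_nonempty y
        rw [hyz, ← dist_psi]
        exact Metric.infDist_le_dist_of_mem (psi_mem_gasket hz k)
      intro t h0 h1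
      rcases le_total t (1 / 2) with ht | ht
      · have : (1 - t) • u i + t • u j = ψ i ((1 - 2 * t) • u i + (2 * t) • u j) := by
          unfold ψ; module
        rw [this]
        have := ih (2 * t) (by linarith) (by linarith)
        have := hhalf i ((1 - 2 * t) • u i + (2 * t) • u j)
        rw [pow_succ]; linarith
      · have : (1 - t) • u i + t • u j = ψ j ((1 - (2 * t - 1)) • u i + (2 * t - 1) • u j) := by
          unfold ψ; module
        rw [this]
        have := ih (2 * t - 1) (by linarith) (by linarith)
        have := hhalf j ((1 - (2 * t - 1)) • u i + (2 * t - 1) • u j)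
        rw [pow_succ]; linarith
  rintro _ ⟨s, t, hs, ht, hst, rfl⟩
  obtain rfl : s = 1 - t := by linarith
  have hlim : Tendsto (fun n : ℕ => (1 / 2 : ℝ) ^ n * dist (u i) (u j)) atTop (𝓝 0) := by
    simpa using (tendsto_pow_atTop_nhds_zero_of_lt_one (by norm_num : (0 : ℝ) ≤ 1 / 2)
      (by norm_num)).mul_const (dist (u i) (u j))
  have h0 := ge_of_tendsto' hlim fun n => key n t ht (by linarith)
  rw [gasket_isCompact.isClosed.mem_iff_infDist_zero gasket_nonempty]
  exact le_antisymm h0 Metric.infDist_nonneg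

theorem segment_pt_subset_cell (w : List (Fin 3)) (i j : Fin 3) :
    segment ℝ (pt w i) (pt w j) ⊆ cell w := by
  rintro _ ⟨s, t, hs, ht, hst, rfl⟩
  exact ⟨_, segment_corner_subset_gasket i j ⟨s, t, hs, ht, hst, rfl⟩, psiw_add_smul _ _ _ _ _ hst⟩

end

section

/-! ### A finite model of the subgraphs of the graph of level one

The edge of the triangle opposite to the corner `k` has the label `k`. A subgraph of level `0` is
given by the labels of its edges, and a subgraph of level `1` by its restrictions to the
three cells. The vertices of level one are the corners `0, 1, 2` and, for each `k`, the
midpoint `3 + k` of the side opposite to `k`. -/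

/-- The subgraphs of the graph of level zero. -/
abbrev Bits₀ : Type := Fin 3 → Bool

/-- The subgraphs of the graph of level one. -/
abbrev Bits : Type := Fin 3 → Bits₀

/-- The element different from `i` and `j`, if `i ≠ j`. -/
def third (i j : Fin 3) : Fin 3 := -(i + j)

/-- The corner `c` of the cell `b`. -/
def vtx (b c : Fin 3) : Fin 6 := ![![0, 5, 4], ![5, 1, 3], ![4, 3, 2]] b c

/-- The corner `i`. -/
def crn (i : Fin 3) : Fin 6 := vtx i i

/-- Identification of the labels of `p` and `q`. -/
def merge (l : Fin 6 → ℕ) (p q : Fin 6) : Fin 6 → ℕ := fun x =>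
  bif (l x).beq (l q) then l p else l x

/-- The labels of the edges of level one. -/
def edges₁ : List (Fin 3 × Fin 3) :=
  [(0, 0), (0, 1), (0, 2), (1, 0), (1, 1), (1, 2), (2, 0), (2, 1), (2, 2)]

/-- Identification of the labels of the end points of the edge `e`, if it belongs to `σ`. -/
def mergeEdge (σ : Bits) (l : Fin 6 → ℕ) (e : Fin 3 × Fin 3) : Fin 6 → ℕ :=
  bif σ e.1 e.2 then merge l (vtx e.1 (e.2 + 1)) (vtx e.1 (e.2 + 2)) else l

/-- A labelling of the vertices which separates the components of a subgraph. -/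
def lab (σ : Bits) : Fin 6 → ℕ :=
  edges₁.foldl (mergeEdge σ) Fin.val

/-- The connectivity relation of a subgraph of level one. -/
def reach (σ : Bits) (x y : Fin 6) : Bool := (lab σ x).beq (lab σ y)

/-- The connectivity relation of a subgraph of level zero. -/
def cconn (β : Bits₀) (i j : Fin 3) : Bool := i == j || β (third i j) || (β i && β j)

/-- The number of edges of a subgraph of level zero. -/
def size₀ (β : Bits₀) : ℕ := (β 0).toNat + (β 1).toNat + (β 2).toNat

/-- The number of edges of a subgraph of level one. -/
def size (σ : Bits) : ℕ := size₀ (σ 0) + size₀ (σ 1) + size₀ (σ 2)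

/-- Every vertex is connected to a corner. -/
def anchored (σ : Bits) : Bool := (List.finRange 6).all fun x => (List.finRange 3).any fun c =>
  reach σ x (crn c)

/-- Deletion of an edge. -/
def del (σ : Bits) (b k : Fin 3) : Bits := fun b' k' => σ b' k' && !(b' == b && k' == k)

/-- The subgraph has no cycles. -/
def acyclic (σ : Bits) : Bool := edges₁.all fun e =>
  !(σ e.1 e.2) || !(reach (del σ e.1 e.2) (vtx e.1 (e.2 + 1)) (vtx e.1 (e.2 + 2)))

/-- The spanning forests each of whose components contains a corner. -/
def good (σ : Bits) : Bool := anchored σ && acyclic σ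

/-- All corners are connected. -/
def joined (σ : Bits) : Bool := reach σ (crn 0) (crn 1) && reach σ (crn 0) (crn 2)

/-- The restriction to the cells `i` and `j`. -/
def mask (σ : Bits) (i j : Fin 3) : Bits := fun b k => σ b k && (b == i || b == j)

/-- The corner `i` is connected to the other corners `j` within the cells `i` and `j`. -/
def hasType (σ : Bits) (i : Fin 3) : Bool := (List.finRange 3).all fun j =>
  j == i || reach (mask σ i j) (crn i) (crn j)

/-- The trace of a forest. -/
def tau (σ : Bits) : Bits₀ := fun k =>
  (joined σ && (List.finRange 3).any fun i => i != k && hasType σ i) ||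
    (!joined σ && reach σ (crn (k + 1)) (crn (k + 2)))

/-- The path from `i` to `j` does not visit the third cell. -/
def direct (σ : Bits) (i j : Fin 3) : Bool := cconn (σ i) i j && cconn (σ j) i j

/-- The cells traversed by the path from the corner `i` to the corner `j`, with the corners of
these cells at which the path enters and leaves. -/
def route (σ : Bits) (i j : Fin 3) : List (Fin 3 × Fin 3 × Fin 3) :=
  if direct σ i j then [(i, i, j), (j, i, j)]
  else [(i, i, third i j), (third i j, i, j), (j, third i j, j)]

/-- The number of steps of the path from `i` to `j`. -/
def steps (β : Bits₀) (i j : Fin 3) : ℕ := if β (third i j) then 1 else 2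

/-- Thirty times the expected number of traversed subcells minus the expected number of those
traversed in two steps. -/
def weightA (β : Bits₀) (i j : Fin 3) : ℕ :=
  if β (third i j) then (if size₀ β = 2 then 15 else 30) else 30

/-- Thirty times the expected number of subcells traversed in two steps. -/
def weightB (β : Bits₀) (i j : Fin 3) : ℕ :=
  if β (third i j) then (if size₀ β = 2 then 15 else 12) else 20

/-- The sum of a weight over the subcells traversed by the path from `i` to `j`. -/
def routeSum (f : Bits₀ → Fin 3 → Fin 3 → ℕ) (σ : Bits) (i j : Fin 3) : ℕ :=
  ((route σ i j).map fun p => f (σ p.1) p.2.1 p.2.2).sum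

/-- The subgraph whose edges are given by the binary digits of a number. -/
def bitsOf (n : ℕ) : Bits := fun b k => n.testBit (3 * b + k)

/-! ### Enumeration of the subgraphs of level one -/

theorem exists_bitsOf (σ : Bits) : ∃ n < 512, bitsOf n = σ := by
  have key : ∀ a b c d e f g h i : Bool, ∃ n < 512, n.testBit 0 = a ∧ n.testBit 1 = b ∧
      n.testBit 2 = c ∧ n.testBit 3 = d ∧ n.testBit 4 = e ∧ n.testBit 5 = f ∧ n.testBit 6 = g ∧
      n.testBit 7 = h ∧ n.testBit 8 = i := by
    intro a b c d e f g h i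
    refine ⟨a.toNat + 2 * (b.toNat + 2 * (c.toNat + 2 * (d.toNat + 2 * (e.toNat + 2 * (f.toNat +
      2 * (g.toNat + 2 * (h.toNat + 2 * i.toNat))))))), ?_⟩
    revert a b c d e f g h i
    decide +kernel
  obtain ⟨n, hn, h0, h1, h2, h3, h4, h5, h6, h7, h8⟩ := key (σ 0 0) (σ 0 1) (σ 0 2) (σ 1 0)
    (σ 1 1) (σ 1 2) (σ 2 0) (σ 2 1) (σ 2 2)
  refine ⟨n, hn, funext fun b => funext fun k => ?_⟩
  fin_cases b <;> fin_cases k <;> assumption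

/-- The properties of good forests that are checked by enumeration. -/
def checks (σ : Bits) : Bool := !good σ ||
  (size σ == 3 + size₀ (tau σ) && !(tau σ 0 && tau σ 1 && tau σ 2) &&
    (List.finRange 3).all fun i => (List.finRange 3).all fun j =>
      reach σ (crn i) (crn j) == cconn (tau σ) i j &&
      (i == j || !cconn (tau σ) i j || (route σ i j).all fun p => cconn (σ p.1) p.2.1 p.2.2))

set_option maxRecDepth 100000 in
theorem checks_bitsOf : ∀ n < 512, checks (bitsOf n) = true := by decide +kernel

/-- `β` is the trace of the good forest `σ`. -/
def traceTo (β : Bits₀) (σ : Bits) : Bool :=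
  good σ && tau σ 0 == β 0 && tau σ 1 == β 1 && tau σ 2 == β 2

/-- The good forests with trace `β`. -/
def fiber (β : Bits₀) : Finset Bits := Finset.univ.filter fun σ => traceTo β σ

/-- The sum of `f` over the good forests with trace `β`. -/
def fiberSum (f : Bits → ℕ) (β : Bits₀) : ℕ :=
  ((List.range 512).map fun n => bif traceTo β (bitsOf n) then f (bitsOf n) else 0).sum

set_option maxRecDepth 100000 in
-- The three values are `50 * (3/5)^e` for `e = 0, 1, 2` edges. This geometric dependence makes
-- products over cells depend only on the total number of edges.
theorem fiberSum_cons : ∀ a b c : Bool, (a && b && c) = false →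
    fiberSum (fun _ => 1) ![a, b, c] = bif size₀ ![a, b, c] == 0 then 50 else
      bif size₀ ![a, b, c] == 1 then 30 else 18 := by
  decide +kernel

set_option maxRecDepth 100000 in
-- There are three types of passages: along an edge with a second edge present, along an isolated
-- edge, and along two edges. The mean numbers of subpassages of these types are `(1, 1/2, 1/2)`,
-- `(4/5, 1, 2/5)` and `(4/3, 1, 2/3)`. This matrix is singular of rank two; the two weights span
-- its image, which also contains the means of the number of steps. Working with the weights
-- replaces three types by a two-dimensional recursion, and the factors 15 and 30 keep everything in
-- the natural numbers.
theorem fiberSum_weight_cons : ∀ a b c : Bool, (a && b && c) = false →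
    ∀ i j, i ≠ j → cconn ![a, b, c] i j →
      fiberSum (fun σ => routeSum weightA σ i j) ![a, b, c] = fiberSum (fun _ => 1) ![a, b, c] *
        (weightA ![a, b, c] i j + 2 * weightB ![a, b, c] i j) ∧
      15 * fiberSum (fun σ => routeSum weightB σ i j) ![a, b, c] =
        fiberSum (fun _ => 1) ![a, b, c] *
          (6 * weightA ![a, b, c] i j + 25 * weightB ![a, b, c] i j) ∧
      30 * fiberSum (fun σ => routeSum steps σ i j) ![a, b, c] =
        fiberSum (fun _ => 1) ![a, b, c] *
          (weightA ![a, b, c] i j + 4 * weightB ![a, b, c] i j) := by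
  decide +kernel

theorem eq_cons (β : Bits₀) : β = ![β 0, β 1, β 2] := by
  funext k; fin_cases k <;> rfl

theorem univ_eq_image_bitsOf : (Finset.univ : Finset Bits) = (Finset.range 512).image bitsOf := by
  symm
  rw [Finset.eq_univ_iff_forall]
  intro σ
  obtain ⟨n, hn, rfl⟩ := exists_bitsOf σ
  exact Finset.mem_image_of_mem _ (Finset.mem_range.2 hn)

theorem bitsOf_injOn : Set.InjOn bitsOf (Finset.range 512) := by
  rw [← Finset.card_image_iff, ← univ_eq_image_bitsOf]
  simp

theorem sum_fiber (f : Bits → ℕ) (β : Bits₀) : ∑ σ ∈ fiber β, f σ = fiberSum f β := by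
  rw [fiber, Finset.sum_filter, univ_eq_image_bitsOf, Finset.sum_image bitsOf_injOn]
  have : ∀ m, ∑ n ∈ Finset.range m, (if traceTo β (bitsOf n) = true then f (bitsOf n) else 0) =
      ((List.range m).map fun n => bif traceTo β (bitsOf n) then f (bitsOf n) else 0).sum := by
    intro m
    induction m with
    | zero => rfl
    | succ m ih =>
      rw [Finset.sum_range_succ, List.range_succ, List.map_append, List.sum_append, ih]
      simp [Bool.cond_eq_ite]
  exact this 512

theorem card_fiber_eq_fiberSum (β : Bits₀) : (fiber β).card = fiberSum (fun _ => 1) β := by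
  rw [← sum_fiber]; simp

theorem mem_fiber {β : Bits₀} {σ : Bits} : σ ∈ fiber β ↔ good σ = true ∧ tau σ = β := by
  simp only [fiber, Finset.mem_filter, Finset.mem_univ, true_and, traceTo, Bool.and_eq_true,
    beq_iff_eq, and_assoc, and_congr_right_iff]
  refine fun _ => ⟨fun h => funext fun k => ?_, fun h => by simp [h]⟩
  fin_cases k
  exacts [h.1, h.2.1, h.2.2]

/-- The subgraph of level zero is not the full triangle. -/
def Proper (β : Bits₀) : Prop := (β 0 && β 1 && β 2) = false

theorem card_fiber {β : Bits₀} (hβ : Proper β) :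
    (fiber β).card = if size₀ β = 0 then 50 else if size₀ β = 1 then 30 else 18 := by
  have := fiberSum_cons _ _ _ hβ
  rw [← eq_cons] at this
  rw [card_fiber_eq_fiberSum, this]
  simp [Bool.cond_eq_ite]

theorem sum_fiber_weight {β : Bits₀} (hβ : Proper β) {i j : Fin 3} (hij : i ≠ j)
    (h : cconn β i j) :
    ∑ σ ∈ fiber β, routeSum weightA σ i j =
      (fiber β).card * (weightA β i j + 2 * weightB β i j) ∧
    15 * ∑ σ ∈ fiber β, routeSum weightB σ i j =
      (fiber β).card * (6 * weightA β i j + 25 * weightB β i j) ∧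
    30 * ∑ σ ∈ fiber β, routeSum steps σ i j =
      (fiber β).card * (weightA β i j + 4 * weightB β i j) := by
  have := fiberSum_weight_cons _ _ _ hβ i j hij
  rw [← eq_cons] at this
  rw [sum_fiber, sum_fiber, sum_fiber, card_fiber_eq_fiberSum]
  exact this h

theorem checks_eq_true (σ : Bits) : checks σ = true := by
  obtain ⟨n, hn, rfl⟩ := exists_bitsOf σ
  exact checks_bitsOf n hn

/-- The edge count serves to recognize trees by counting, the second clause excludes full triangles,
the third compares connectivity before and after the trace, and the last one allows passages to be
refined. -/
theorem good_spec {σ : Bits} (h : good σ) : size σ = 3 + size₀ (tau σ) ∧ Proper (tau σ) ∧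
    ∀ i j, reach σ (crn i) (crn j) = cconn (tau σ) i j ∧ (i ≠ j → cconn (tau σ) i j →
      ∀ p ∈ route σ i j, cconn (σ p.1) p.2.1 p.2.2) := by
  have := checks_eq_true σ
  simp only [checks, h, Bool.not_true, Bool.false_or, Bool.and_eq_true, beq_iff_eq,
    List.all_eq_true, List.mem_finRange, true_implies, Bool.not_eq_true', Bool.or_eq_true] at this
  refine ⟨this.1.1, this.1.2, fun i j => ⟨(this.2 i j).1, fun hij hc p hp => ?_⟩⟩
  rcases (this.2 i j).2 with (h | h) | h
  · exact absurd h hij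
  · simp [h] at hc
  · exact h p hp

/-! ### Correctness of the connectivity labelling -/

theorem mergeEdge_of_true {σ : Bits} {e : Fin 3 × Fin 3} (h : σ e.1 e.2) (l : Fin 6 → ℕ)
    (x : Fin 6) : mergeEdge σ l e x =
      if l x = l (vtx e.1 (e.2 + 2)) then l (vtx e.1 (e.2 + 1)) else l x := by
  simp [mergeEdge, h, merge, Bool.cond_eq_ite]

theorem mergeEdge_of_false {σ : Bits} {e : Fin 3 × Fin 3} (h : σ e.1 e.2 = false)
    (l : Fin 6 → ℕ) : mergeEdge σ l e = l := by
  simp [mergeEdge, h]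

/-- Processing the edge identifies the labels of its end points, and no later step separates equal
labels. -/
theorem lab_eq_of_edge {σ : Bits} {b k : Fin 3} (h : σ b k) :
    lab σ (vtx b (k + 1)) = lab σ (vtx b (k + 2)) := by
  have hmono : ∀ (E : List (Fin 3 × Fin 3)) (l : Fin 6 → ℕ) (x y : Fin 6), l x = l y →
      E.foldl (mergeEdge σ) l x =
      E.foldl (mergeEdge σ) l y := by
    intro E
    induction E with
    | nil => exact fun l x y h => h
    | cons e E ih =>
      intro l x y hxy
      refine ih _ _ _ ?_
      cases he : σ e.1 e.2
      · rwa [mergeEdge_of_false he]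
      · rw [mergeEdge_of_true he, mergeEdge_of_true he, hxy]
  have key : ∀ (E : List (Fin 3 × Fin 3)) (l : Fin 6 → ℕ), (b, k) ∈ E →
      E.foldl (mergeEdge σ) l (vtx b (k + 1)) =
      E.foldl (mergeEdge σ) l (vtx b (k + 2)) := by
    intro E
    induction E with
    | nil => exact fun l h => absurd h List.not_mem_nil
    | cons e E ih =>
      intro l he
      rcases List.mem_cons.1 he with rfl | he
      · refine hmono E _ _ _ ?_
        rw [mergeEdge_of_true (e := (b, k)) h, mergeEdge_of_true (e := (b, k)) h]
        simp
      · exact ih _ he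
  have hmem : ∀ b k : Fin 3, (b, k) ∈ edges₁ := by decide
  exact key edges₁ _ (hmem b k)

/-- Invariant of the fold: vertices with equal labels are related. Initially all labels are
distinct, and a merge only joins two classes that are connected by an edge of `σ`. -/
theorem reach_induction {σ : Bits} {R : Fin 6 → Fin 6 → Prop} (hR : Equivalence R)
    (h : ∀ b k, σ b k → R (vtx b (k + 1)) (vtx b (k + 2))) {x y : Fin 6} (hxy : reach σ x y) :
    R x y := by
  have key : ∀ (E : List (Fin 3 × Fin 3)) (l : Fin 6 → ℕ), (∀ x y, l x = l y → R x y) → ∀ x y,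
      E.foldl (mergeEdge σ) l x =
      E.foldl (mergeEdge σ) l y → R x y := by
    intro E
    induction E with
    | nil => exact fun l hl x y h => hl x y h
    | cons e E ih =>
      intro l hl
      refine ih _ fun x y hxy => ?_
      cases he : σ e.1 e.2
      · rw [mergeEdge_of_false he] at hxy
        exact hl x y hxy
      · have hpq := h _ _ he
        rw [mergeEdge_of_true he, mergeEdge_of_true he] at hxy
        split_ifs at hxy with h1 h2 h2
        · exact hl _ _ (h1.trans h2.symm)
        · exact hR.trans (hR.trans (hl _ _ h1) (hR.symm hpq)) (hl _ _ hxy)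
        · exact hR.trans (hR.trans (hl _ _ hxy) hpq) (hl _ _ h2.symm)
        · exact hl _ _ hxy
  rw [reach, Nat.beq_eq] at hxy
  exact key edges₁ Fin.val (fun x y hxy => by rw [Fin.ext hxy]; exact hR.refl y) x y hxy

theorem reach_refl (σ : Bits) (x : Fin 6) : reach σ x x := by simp [reach]

theorem reach_symm {σ : Bits} {x y : Fin 6} (h : reach σ x y) : reach σ y x := by
  simp only [reach, Nat.beq_eq] at *; exact h.symm

theorem reach_trans {σ : Bits} {x y z : Fin 6} (h : reach σ x y) (h' : reach σ y z) :
    reach σ x z := by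
  simp only [reach, Nat.beq_eq] at *; exact h.trans h'

theorem reach_edge {σ : Bits} {b k : Fin 3} (h : σ b k) :
    reach σ (vtx b (k + 1)) (vtx b (k + 2)) := by
  simp only [reach, Nat.beq_eq]; exact lab_eq_of_edge h

theorem anchored_iff {σ : Bits} : anchored σ ↔ ∀ x, ∃ c, reach σ x (crn c) := by
  simp [anchored]

theorem acyclic_iff {σ : Bits} : acyclic σ ↔
    ∀ b k, σ b k → ¬ reach (del σ b k) (vtx b (k + 1)) (vtx b (k + 2)) := by
  have : ∀ b k : Fin 3, (b, k) ∈ edges₁ := by decide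
  simp only [acyclic, List.all_eq_true, Prod.forall, this, true_implies, Bool.or_eq_true,
    Bool.not_eq_true', Bool.not_eq_true]
  refine forall₂_congr fun b k => ?_
  cases σ b k <;> simp

theorem joined_iff {σ : Bits} : joined σ ↔ ∀ i j, reach σ (crn i) (crn j) := by
  simp only [joined, Bool.and_eq_true]
  refine ⟨fun h => ?_, fun h => ⟨h 0 1, h 0 2⟩⟩
  have : ∀ i, reach σ (crn 0) (crn i) := by
    intro i
    fin_cases i
    exacts [reach_refl _ _, h.1, h.2]
  exact fun i j => reach_trans (reach_symm (this i)) (this j)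

end

section

/-! ### Edges and connectivity -/

/-- The edge of the cell `w` opposite to its corner `k`. -/
def edge (w : List (Fin 3)) (k : Fin 3) : Sym2 Plane := s(pt w (k + 1), pt w (k + 2))

theorem pt_append (v w : List (Fin 3)) (i : Fin 3) : pt (v ++ w) i = ψw v (pt w i) :=
  psiw_append v w _

theorem map_edge (v w : List (Fin 3)) (k : Fin 3) :
    Sym2.map (ψw v) (edge w k) = edge (v ++ w) k := by
  simp [edge, pt_append]

theorem map_psi_edge (i : Fin 3) (w : List (Fin 3)) (k : Fin 3) :
    Sym2.map (ψ i) (edge w k) = edge (i :: w) k :=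
  rfl

theorem mk_pt_pt (w : List (Fin 3)) {i j : Fin 3} (hij : i ≠ j) :
    s(pt w i, pt w j) = edge w (third i j) := by
  have : (third i j + 1 = i ∧ third i j + 2 = j) ∨ (third i j + 1 = j ∧ third i j + 2 = i) := by
    revert i j; decide
  rcases this with ⟨h1, h2⟩ | ⟨h1, h2⟩
  · rw [edge, h1, h2]
  · rw [edge, h1, h2, Sym2.eq_swap]

theorem add_one_ne_add_two (k : Fin 3) : k + 1 ≠ k + 2 := by revert k; decide

theorem mem_EG {n : ℕ} {e : Sym2 Plane} :
    e ∈ EG n ↔ ∃ w : List (Fin 3), w.length = n ∧ ∃ k, e = edge w k := by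
  induction n generalizing e with
  | zero =>
    constructor
    · rintro ⟨i, j, hij, rfl⟩
      exact ⟨[], rfl, third i j, mk_pt_pt [] hij⟩
    · rintro ⟨w, hw, k, rfl⟩
      obtain rfl := List.eq_nil_of_length_eq_zero hw
      exact ⟨k + 1, k + 2, add_one_ne_add_two k, rfl⟩
  | succ n ih =>
    constructor
    · intro h
      obtain ⟨i, e, he, rfl⟩ := mem_iUnion.1 h
      obtain ⟨w, hw, k, rfl⟩ := ih.1 he
      exact ⟨i :: w, by simp [hw], k, map_psi_edge i w k⟩
    · rintro ⟨_ | ⟨i, w⟩, hw, k, rfl⟩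
      · simp at hw
      · exact mem_iUnion.2 ⟨i, edge w k, ih.2 ⟨w, by simpa using hw, k, rfl⟩, map_psi_edge i w k⟩

theorem edge_mem_EG (w : List (Fin 3)) (k : Fin 3) : edge w k ∈ EG w.length :=
  mem_EG.2 ⟨w, rfl, k, rfl⟩

theorem edge_mem_EG_of_length {n : ℕ} {w : List (Fin 3)} (hw : w.length = n) (k : Fin 3) :
    edge w k ∈ EG n :=
  mem_EG.2 ⟨w, hw, k, rfl⟩

/-- Different cells of the same level share at most one point, whereas an edge has two end points in
its cell. -/
theorem edge_inj {v w : List (Fin 3)} (hl : v.length = w.length) {k l : Fin 3}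
    (h : edge v k = edge w l) : v = w ∧ k = l := by
  have hvw : v = w := by
    by_contra hvw
    have hmem : ∀ x ∈ edge w l, x ∈ cell w := by
      intro x hx
      rcases Sym2.mem_iff.1 hx with rfl | rfl <;> exact pt_mem_cell _ _
    have h1 := hmem (pt v (k + 1)) (h ▸ Sym2.mem_mk_left _ _)
    have h2 := hmem (pt v (k + 2)) (h ▸ Sym2.mem_mk_right _ _)
    exact add_one_ne_add_two k (pt_injective v
      (eq_of_mem_cell_inter hl hvw (pt_mem_cell _ _) h1 (pt_mem_cell _ _) h2))
  subst hvw
  refine ⟨rfl, ?_⟩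
  rcases Sym2.eq_iff.1 h with ⟨h1, _⟩ | ⟨h1, h2⟩
  · exact add_right_cancel (pt_injective v h1)
  · have h1 := pt_injective v h1
    have h2 := pt_injective v h2
    have key : ∀ k l : Fin 3, k + 1 = l + 2 → k + 2 = l + 1 → k = l := by decide
    exact key k l h1 h2

theorem corner_mem_edge_nil {i k : Fin 3} : u i ∈ edge [] k ↔ i ≠ k := by
  have h : ∀ j, u i = pt [] j ↔ i = j := fun j => ⟨fun h => corner_injective h, fun h => h ▸ rfl⟩
  rw [edge, Sym2.mem_iff, h, h]
  clear h
  revert i k; decide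

theorem mem_VG_and_ne_of_mem_EG {n : ℕ} {x y : Plane} (h : s(x, y) ∈ EG n) :
    x ∈ VG n ∧ y ∈ VG n ∧ x ≠ y := by
  obtain ⟨w, rfl, k, hk⟩ := mem_EG.1 h
  rcases Sym2.eq_iff.1 hk with ⟨rfl, rfl⟩ | ⟨rfl, rfl⟩
  · exact ⟨pt_mem_VG _ _, pt_mem_VG _ _, fun h => add_one_ne_add_two k (pt_injective w h)⟩
  · exact ⟨pt_mem_VG _ _, pt_mem_VG _ _, fun h => add_one_ne_add_two k (pt_injective w h.symm)⟩

/-- The points `x` and `y` are connected by edges of `F`. -/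
def Conn (F : Set (Sym2 Plane)) : Plane → Plane → Prop :=
  Relation.ReflTransGen fun x y => s(x, y) ∈ F

theorem Conn.refl {F : Set (Sym2 Plane)} (x : Plane) : Conn F x x := Relation.ReflTransGen.refl

theorem Conn.of_mem {F : Set (Sym2 Plane)} {x y : Plane} (h : s(x, y) ∈ F) : Conn F x y :=
  Relation.ReflTransGen.single h

theorem Conn.trans {F : Set (Sym2 Plane)} {x y z : Plane} (h : Conn F x y) (h' : Conn F y z) :
    Conn F x z :=
  Relation.ReflTransGen.trans h h'

theorem Conn.symm {F : Set (Sym2 Plane)} {x y : Plane} (h : Conn F x y) : Conn F y x := by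
  induction h with
  | refl => exact Conn.refl _
  | tail _ h ih => exact (Conn.of_mem (by rwa [Sym2.eq_swap])).trans ih

theorem Conn.mono {F F' : Set (Sym2 Plane)} (hF : F ⊆ F') {x y : Plane} (h : Conn F x y) :
    Conn F' x y := by
  induction h with
  | refl => exact Conn.refl _
  | tail _ h ih => exact ih.trans (Conn.of_mem (hF h))

/-- `Conn` lives on the plane and does not mention a level, so that a tree and its trace can be
compared without changing the vertex type. -/
theorem reachable_spanGraph {n : ℕ} {F : Set (Sym2 Plane)} (hF : F ⊆ EG n) {x y : VG n} :
    (spanGraph n F).Reachable x y ↔ Conn F x y := by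
  rw [SimpleGraph.reachable_iff_reflTransGen]
  constructor
  · intro h
    induction h with
    | refl => exact Conn.refl _
    | tail _ h ih => exact ih.trans (Conn.of_mem h.2)
  · intro h
    have key : ∀ q, Conn F x q → ∃ hq : q ∈ VG n,
        Relation.ReflTransGen (spanGraph n F).Adj x ⟨q, hq⟩ := by
      intro q hq
      induction hq with
      | refl => exact ⟨x.2, Relation.ReflTransGen.refl⟩
      | tail _ hqr ih =>
        obtain ⟨hq, h⟩ := ih
        have := mem_VG_and_ne_of_mem_EG (hF hqr)
        exact ⟨this.2.1, h.tail ⟨fun h => this.2.2 (congrArg Subtype.val h), hqr⟩⟩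
    exact (key y h).2

theorem preconnected_spanGraph {n : ℕ} {F : Set (Sym2 Plane)} (hF : F ⊆ EG n) :
    (spanGraph n F).Connected ↔ ∀ x ∈ VG n, ∀ y ∈ VG n, Conn F x y := by
  constructor
  · exact fun h x hx y hy => (reachable_spanGraph hF).1 (h.preconnected ⟨x, hx⟩ ⟨y, hy⟩)
  · intro h
    have : Nonempty (VG n) := ⟨corner n 0⟩
    exact ⟨fun x y => (reachable_spanGraph hF).2 (h x x.2 y y.2)⟩

/-- A graph is acyclic if and only if every edge is a bridge; this expresses acyclicity through
connectivity alone. -/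
theorem isAcyclic_spanGraph {n : ℕ} {F : Set (Sym2 Plane)} (hF : F ⊆ EG n) :
    (spanGraph n F).IsAcyclic ↔ ∀ x y, s(x, y) ∈ F → ¬ Conn (F \ {s(x, y)}) x y := by
  have hdel : ∀ v w : VG n, (spanGraph n F).deleteEdges {s(v, w)} =
      spanGraph n (F \ {s((v : Plane), (w : Plane))}) := by
    intro v w
    ext a b
    simp only [SimpleGraph.deleteEdges_adj, spanGraph, mem_singleton_iff, Set.mem_sdiff, and_assoc]
    refine and_congr_right fun _ => and_congr_right fun _ => not_congr ?_
    rw [Sym2.eq_iff, Sym2.eq_iff]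
    simp only [Subtype.ext_iff]
  rw [SimpleGraph.isAcyclic_iff_forall_adj_isBridge]
  simp only [SimpleGraph.isBridge_iff, hdel, reachable_spanGraph (sdiff_subset.trans hF)]
  constructor
  · intro h x y hxy
    have := mem_VG_and_ne_of_mem_EG (hF hxy)
    exact @h ⟨x, this.1⟩ ⟨y, this.2.1⟩ ⟨fun h => this.2.2 (congrArg Subtype.val h), hxy⟩
  · exact fun h v w hvw => h _ _ hvw.2

/-- By uniqueness of paths in a tree, a path of `F ∩ S` must be the path of `F`. This turns the
condition in `treesOfType` into a connectivity question that the finite model can answer. -/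
theorem forall_path_iff_conn {n : ℕ} {F : Set (Sym2 Plane)} (hF : F ∈ spanningTrees n)
    (S : Set (Sym2 Plane)) (x y : VG n) :
    (∀ p : (spanGraph n F).Walk x y, p.IsPath → ∀ e ∈ p.edges, Sym2.map Subtype.val e ∈ S) ↔
      Conn (F ∩ S) x y := by
  have hsub : F ∩ S ⊆ EG n := inter_subset_left.trans hF.1
  rw [← reachable_spanGraph hsub]
  constructor
  · intro h
    obtain ⟨p, hp, -⟩ := hF.2.existsUnique_path x y
    refine ⟨p.transfer _ fun e he => ?_⟩
    have h1 := h p hp e he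
    have h2 := p.edges_subset_edgeSet he
    induction e with
    | _ a b => exact ⟨h2.1, h2.2, h1⟩
  · intro h p hp e he
    have hle : spanGraph n (F ∩ S) ≤ spanGraph n F := fun a b hab => ⟨hab.1, hab.2.1⟩
    obtain ⟨q, hq⟩ := h.exists_isPath
    have hpq := (hF.2.existsUnique_path x y).unique hp (hq.mapLe hle)
    rw [hpq, SimpleGraph.Walk.edges_mapLe_eq_edges] at he
    have h2 := q.edges_subset_edgeSet he
    induction e with
    | _ a b => exact h2.2.2

/-! ### Vertices of level one and the model of a subgraph -/

/-- The vertices of level one in the cell `w`. -/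
def vpt (w : List (Fin 3)) (x : Fin 6) : Plane :=
  ![pt w 0, pt w 1, pt w 2, pt (w ++ [1]) 2, pt (w ++ [2]) 0, pt (w ++ [0]) 1] x

theorem vpt_vtx (w : List (Fin 3)) (b c : Fin 3) : vpt w (vtx b c) = pt (w ++ [b]) c := by
  have h1 : ∀ b, pt w b = pt (w ++ [b]) b := fun b => by
    rw [pt_append]; exact congrArg (ψw w) (psi_corner b).symm
  have h2 : ∀ b c, pt (w ++ [b]) c = pt (w ++ [c]) b := fun b c => by
    rw [pt_append, pt_append]; exact congrArg (ψw w) (psi_corner_comm b c)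
  fin_cases b <;> fin_cases c <;> simp [vpt, vtx]
  exacts [h1 0, h2 2 0, h2 0 1, h1 1, h2 1 2, h1 2]

theorem vpt_crn (w : List (Fin 3)) (i : Fin 3) : vpt w (crn i) = pt w i := by
  rw [crn, vpt_vtx, pt_append]
  exact congrArg (ψw w) (psi_corner i)

theorem exists_vtx (x : Fin 6) : ∃ b c, x = vtx b c := by revert x; decide

theorem vpt_injective (w : List (Fin 3)) : Function.Injective (vpt w) := by
  intro x y h
  obtain ⟨b, c, rfl⟩ := exists_vtx x
  obtain ⟨b', c', rfl⟩ := exists_vtx y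
  rw [vpt_vtx, vpt_vtx, pt_append, pt_append] at h
  have h := psiw_injective w h
  by_cases hb : b = b'
  · subst hb
    rw [pt_injective _ h]
  · obtain ⟨h1, h2⟩ := eq_of_mem_psi_psi hb (corner_mem_gasket c) (corner_mem_gasket c') h
    obtain rfl := corner_injective h1
    obtain rfl := corner_injective h2
    have key : ∀ c c' : Fin 3, vtx c' c = vtx c c' := by decide
    exact key c c'

theorem vpt_mem_cell (w : List (Fin 3)) (x : Fin 6) : vpt w x ∈ cell w := by
  obtain ⟨b, c, rfl⟩ := exists_vtx x
  rw [vpt_vtx, pt_append]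
  exact ⟨_, psi_mem_gasket (corner_mem_gasket c) b, rfl⟩

theorem vpt_mem_VG (w : List (Fin 3)) (x : Fin 6) : vpt w x ∈ VG (w.length + 1) := by
  obtain ⟨b, c, rfl⟩ := exists_vtx x
  rw [vpt_vtx]
  simpa using pt_mem_VG (w ++ [b]) c

theorem exists_append_singleton {n : ℕ} {w : List (Fin 3)} (h : w.length = n + 1) :
    ∃ v b, w = v ++ [b] ∧ v.length = n := by
  rcases List.eq_nil_or_concat w with rfl | ⟨v, b, rfl⟩
  · simp at h
  · exact ⟨v, b, List.concat_eq_append .., by simpa using h⟩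

theorem exists_vpt_of_mem_VG {n : ℕ} {x : Plane} (hx : x ∈ VG (n + 1)) :
    ∃ w : List (Fin 3), w.length = n ∧ ∃ v, x = vpt w v := by
  obtain ⟨w, hw, i, rfl⟩ := exists_pt_of_mem_VG hx
  obtain ⟨v, b, rfl, hv⟩ := exists_append_singleton hw
  exact ⟨v, hv, vtx b i, (vpt_vtx v b i).symm⟩

theorem exists_crn_of_vpt_eq_pt {w : List (Fin 3)} {x : Fin 6} {i : Fin 3} (h : vpt w x = pt w i) :
    x = crn i :=
  vpt_injective w (h.trans (vpt_crn w i).symm)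

/-- Cells of the same level communicate only through their corners. The local-to-global arguments
about trees rest on this. -/
theorem exists_crn_of_mem_cell {v w : List (Fin 3)} (hl : w.length = v.length) (hwv : w ≠ v)
    {x : Fin 6} (h : vpt w x ∈ cell v) : ∃ i, x = crn i := by
  obtain ⟨i, hi⟩ := exists_pt_of_mem_cell_inter hl hwv (vpt_mem_cell w x) h
  exact ⟨i, exists_crn_of_vpt_eq_pt hi⟩

theorem exists_crn_of_mem_VG {w : List (Fin 3)} {x : Fin 6} (h : vpt w x ∈ VG w.length) :
    ∃ i, x = crn i := by
  obtain ⟨v, hv, i, hi⟩ := exists_pt_of_mem_VG h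
  by_cases hwv : w = v
  · subst hwv
    exact ⟨i, exists_crn_of_vpt_eq_pt hi⟩
  · exact exists_crn_of_mem_cell hv.symm hwv (hi ▸ pt_mem_cell v i)

open Classical in
/-- The edges of `F` in the cell `w`. -/
def bits (F : Set (Sym2 Plane)) (w : List (Fin 3)) : Bits₀ := fun k => decide (edge w k ∈ F)

/-- The edges of `F` in the subcells of `w`. -/
def bits₁ (F : Set (Sym2 Plane)) (w : List (Fin 3)) : Bits := fun b => bits F (w ++ [b])

theorem bits_iff {F : Set (Sym2 Plane)} {w : List (Fin 3)} {k : Fin 3} :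
    bits F w k ↔ edge w k ∈ F := by simp [bits]

theorem bits₁_iff {F : Set (Sym2 Plane)} {w : List (Fin 3)} {b k : Fin 3} :
    bits₁ F w b k ↔ edge (w ++ [b]) k ∈ F := bits_iff

/-- The edges of `F` which belong to subcells of `w`. -/
def inCell (F : Set (Sym2 Plane)) (w : List (Fin 3)) : Set (Sym2 Plane) :=
  {e ∈ F | ∃ b k, e = edge (w ++ [b]) k}

theorem edge_append_singleton (w : List (Fin 3)) (b k : Fin 3) :
    edge (w ++ [b]) k = s(vpt w (vtx b (k + 1)), vpt w (vtx b (k + 2))) := by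
  rw [vpt_vtx, vpt_vtx, edge]

/-- A path along edges of subcells of `w` stays among the six vertices `vpt w`, so it can be
followed in the model. -/
theorem reach_bits₁ (F : Set (Sym2 Plane)) (w : List (Fin 3)) (x y : Fin 6) :
    reach (bits₁ F w) x y ↔ Conn (inCell F w) (vpt w x) (vpt w y) := by
  constructor
  · intro h
    refine reach_induction (R := fun x y => Conn (inCell F w) (vpt w x) (vpt w y))
      ⟨fun _ => Conn.refl _, Conn.symm, Conn.trans⟩ (fun b k hbk => Conn.of_mem ?_) h
    rw [← edge_append_singleton]
    exact ⟨bits₁_iff.1 hbk, b, k, rfl⟩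
  · intro h
    have key : ∀ q, Conn (inCell F w) (vpt w x) q →
        ∃ y, q = vpt w y ∧ reach (bits₁ F w) x y := by
      intro q hq
      induction hq with
      | refl => exact ⟨x, rfl, reach_refl _ _⟩
      | tail _ hqr ih =>
        obtain ⟨y, rfl, hy⟩ := ih
        obtain ⟨hF, b, k, hbk⟩ := hqr
        have hbit : bits₁ F w b k := bits₁_iff.2 (hbk ▸ hF)
        rw [edge_append_singleton] at hbk
        rcases Sym2.eq_iff.1 hbk with ⟨h1, rfl⟩ | ⟨h1, rfl⟩
        · refine ⟨_, rfl, reach_trans hy ?_⟩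
          rw [vpt_injective w h1]; exact reach_edge hbit
        · refine ⟨_, rfl, reach_trans hy ?_⟩
          rw [vpt_injective w h1]; exact reach_symm (reach_edge hbit)
    obtain ⟨y', hy', hr⟩ := key _ h
    rwa [vpt_injective w hy']

theorem conn_of_reach {F : Set (Sym2 Plane)} {w : List (Fin 3)} {x y : Fin 6}
    (h : reach (bits₁ F w) x y) : Conn F (vpt w x) (vpt w y) :=
  ((reach_bits₁ F w x y).1 h).mono (sep_subset _ _)

theorem bits₁_sdiff_edge (F : Set (Sym2 Plane)) (w : List (Fin 3)) (b k : Fin 3) :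
    bits₁ (F \ {edge (w ++ [b]) k}) w = del (bits₁ F w) b k := by
  funext b' k'
  rw [Bool.eq_iff_iff, bits₁_iff]
  simp only [del, Bool.and_eq_true, bits₁_iff, Set.mem_sdiff, mem_singleton_iff, Bool.not_eq_true',
    Bool.and_eq_false_iff, beq_eq_false_iff_ne]
  refine and_congr_right fun _ => ⟨fun h => ?_, fun h h' => ?_⟩
  · by_contra! hc
    obtain ⟨rfl, rfl⟩ := hc
    exact h rfl
  · obtain ⟨h1, rfl⟩ := edge_inj (by simp) h'
    have : b' = b := by simpa using h1
    simp [this] at h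

theorem edge_mem_restrict {w v : List (Fin 3)} {m : ℕ} (hv : v.length = m)
    {F : Set (Sym2 Plane)} {k : Fin 3} : edge v k ∈ restrict w m F ↔ edge (w ++ v) k ∈ F := by
  simp only [restrict, mem_ofPred_eq, map_edge, edge_mem_EG_of_length hv, true_and]

theorem bits₁_restrict (w : List (Fin 3)) (F : Set (Sym2 Plane)) :
    bits₁ (restrict w 1 F) [] = bits₁ F w := by
  funext b k
  rw [Bool.eq_iff_iff, bits₁_iff, bits₁_iff, List.nil_append]
  exact edge_mem_restrict (v := [b]) rfl

/-! ### The trace of a forest of level one -/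

section LevelOne

variable {G : Set (Sym2 Plane)}

theorem inCell_nil (hG : G ⊆ EG 1) : inCell G [] = G := by
  refine Subset.antisymm (sep_subset _ _) fun e he => ⟨he, ?_⟩
  obtain ⟨w, hw, k, rfl⟩ := mem_EG.1 (hG he)
  obtain ⟨b, rfl⟩ := List.length_eq_one_iff.1 hw
  exact ⟨b, k, rfl⟩

theorem reach_nil (hG : G ⊆ EG 1) (x y : Fin 6) :
    reach (bits₁ G []) x y ↔ Conn G (vpt [] x) (vpt [] y) := by
  rw [reach_bits₁, inCell_nil hG]

theorem reach_nil_crn (hG : G ⊆ EG 1) (i j : Fin 3) :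
    reach (bits₁ G []) (crn i) (crn j) ↔ Conn G (u i) (u j) := by
  rw [reach_nil hG, vpt_crn, vpt_crn]; rfl

theorem isAcyclic_one (hG : G ⊆ EG 1) : (spanGraph 1 G).IsAcyclic ↔ acyclic (bits₁ G []) := by
  rw [isAcyclic_spanGraph hG, acyclic_iff]
  have hdel : ∀ b k, reach (del (bits₁ G []) b k) (vtx b (k + 1)) (vtx b (k + 2)) ↔
      Conn (G \ {edge [b] k}) (pt [b] (k + 1)) (pt [b] (k + 2)) := by
    intro b k
    rw [← bits₁_sdiff_edge, reach_nil (sdiff_subset.trans hG), vpt_vtx, vpt_vtx]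
    rfl
  simp only [hdel, bits₁_iff, List.nil_append]
  constructor
  · exact fun h b k hbk => h _ _ hbk
  · intro h x y hxy
    obtain ⟨w, hw, k, hk⟩ := mem_EG.1 (hG hxy)
    obtain ⟨b, rfl⟩ := List.length_eq_one_iff.1 hw
    have := h b k (hk ▸ hxy)
    rw [hk]
    rcases Sym2.eq_iff.1 hk with ⟨rfl, rfl⟩ | ⟨rfl, rfl⟩
    · exact this
    · exact fun hc => this hc.symm

theorem mem_spanningTrees_one (hG : G ⊆ EG 1) (hg : good (bits₁ G [])) :
    G ∈ spanningTrees 1 ↔ joined (bits₁ G []) := by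
  rw [good, Bool.and_eq_true, anchored_iff] at hg
  simp only [spanningTrees, mem_ofPred_eq, hG, true_and]
  constructor
  · intro h
    rw [joined_iff]
    intro i j
    rw [reach_nil_crn hG]
    exact (preconnected_spanGraph hG).1 h.connected _ (corner_mem 1 i) _ (corner_mem 1 j)
  · intro h
    rw [joined_iff] at h
    refine ⟨(preconnected_spanGraph hG).2 fun x hx y hy => ?_, (isAcyclic_one hG).2 hg.2⟩
    obtain ⟨w, hw, v, rfl⟩ := exists_vpt_of_mem_VG hx
    obtain rfl := List.eq_nil_of_length_eq_zero hw
    obtain ⟨w, hw, v', rfl⟩ := exists_vpt_of_mem_VG hy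
    obtain rfl := List.eq_nil_of_length_eq_zero hw
    obtain ⟨c, hc⟩ := hg.1 v
    obtain ⟨c', hc'⟩ := hg.1 v'
    exact (reach_nil hG _ _).1 (reach_trans hc (reach_trans (h c c') (reach_symm hc')))

theorem bits₁_inter_mask (i j : Fin 3) :
    bits₁ (G ∩ (Sym2.map (ψ i) '' EG 0 ∪ Sym2.map (ψ j) '' EG 0)) [] =
      mask (bits₁ G []) i j := by
  have h : ∀ b i k, edge [b] k ∈ Sym2.map (ψ i) '' EG 0 ↔ b = i := by
    intro b i k
    constructor
    · rintro ⟨e, he, h⟩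
      obtain ⟨w, hw, l, rfl⟩ := mem_EG.1 he
      obtain rfl := List.eq_nil_of_length_eq_zero hw
      rw [map_psi_edge] at h
      simpa using (edge_inj (v := [i]) (w := [b]) rfl h).1.symm
    · rintro rfl
      exact ⟨edge [] k, edge_mem_EG [] k, map_psi_edge b [] k⟩
  funext b k
  rw [Bool.eq_iff_iff, bits₁_iff]
  simp only [mask, Bool.and_eq_true, bits₁_iff, mem_inter_iff, List.nil_append, mem_union, h,
    Bool.or_eq_true, beq_iff_eq]

theorem reach_mask (hT : G ∈ spanningTrees 1) (i j : Fin 3) :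
    reach (mask (bits₁ G []) i j) (crn i) (crn j) ↔
      ∀ p : (spanGraph 1 G).Walk (corner 1 i) (corner 1 j), p.IsPath → ∀ e ∈ p.edges,
        Sym2.map Subtype.val e ∈ Sym2.map (ψ i) '' EG 0 ∪ Sym2.map (ψ j) '' EG 0 := by
  rw [← bits₁_inter_mask, reach_nil_crn (inter_subset_left.trans hT.1)]
  exact (forall_path_iff_conn hT _ (corner 1 i) (corner 1 j)).symm

theorem mem_treesOfType (hG : G ⊆ EG 1) (hg : good (bits₁ G [])) (i : Fin 3) :
    G ∈ treesOfType 0 i ↔ joined (bits₁ G []) ∧ hasType (bits₁ G []) i := by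
  rw [treesOfType, mem_ofPred_eq, ← mem_spanningTrees_one hG hg]
  refine and_congr_right fun hT => ?_
  simp only [hasType, List.all_eq_true, List.mem_finRange, true_implies, Bool.or_eq_true,
    beq_iff_eq]
  refine forall_congr' fun j => ?_
  rw [or_iff_not_imp_left]
  refine forall_congr' fun _ => ?_
  exact (reach_mask hT i j).symm

/-- In a good forest every vertex is joined to a corner, so the components are determined by the
partition of the corners. If two corners are joined but not all three, there are exactly two
components. -/
theorem mem_twoForests (hG : G ⊆ EG 1) (hg : good (bits₁ G [])) (i : Fin 3) :
    G ∈ twoForests 1 i ↔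
      ¬ joined (bits₁ G []) ∧ reach (bits₁ G []) (crn (i + 1)) (crn (i + 2)) := by
  have hg' := hg
  rw [good, Bool.and_eq_true, anchored_iff] at hg'
  have h1 : i + 1 ≠ i := by revert i; decide
  have h2 : i + 2 ≠ i := by revert i; decide
  have h3 : ∀ j, j ≠ i → j = i + 1 ∨ j = i + 2 := by revert i; decide
  simp only [twoForests, mem_ofPred_eq, hG, true_and, isAcyclic_one hG, hg'.2,
    reachable_spanGraph hG, corner, ← reach_nil_crn hG]
  constructor
  · rintro ⟨-, h, h'⟩
    refine ⟨fun hj => h _ h1 (joined_iff.1 hj _ _), h' _ _ h1 h2⟩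
  · rintro ⟨hj, hr⟩
    -- If `u i` were joined to one of the other two corners, which are joined to each other, then
    -- all corners would be joined.
    have hsep : ∀ j, j ≠ i → ¬ reach (bits₁ G []) (crn i) (crn j) := by
      intro j hji hij
      have hall : ∀ l, reach (bits₁ G []) (crn i) (crn l) := by
        intro l
        by_cases hl : l = i
        · subst hl; exact reach_refl _ _
        rcases h3 j hji with rfl | rfl <;> rcases h3 l hl with rfl | rfl
        exacts [hij, reach_trans hij hr, reach_trans hij (reach_symm hr), hij]
      exact hj (joined_iff.2 fun a b => reach_trans (reach_symm (hall a)) (hall b))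
    refine ⟨?_, hsep, fun j k hj hk => ?_⟩
    · rw [Nat.card_eq_two_iff]
      refine ⟨(spanGraph 1 G).connectedComponentMk (corner 1 i),
        (spanGraph 1 G).connectedComponentMk (corner 1 (i + 1)), ?_, ?_⟩
      · rw [Ne, SimpleGraph.ConnectedComponent.eq, reachable_spanGraph hG]
        exact fun h => hsep _ h1 ((reach_nil_crn hG _ _).2 h)
      · rw [eq_univ_iff_forall]
        refine SimpleGraph.ConnectedComponent.ind fun x => ?_
        obtain ⟨w, hw, v, hv⟩ := exists_vpt_of_mem_VG x.2
        obtain rfl := List.eq_nil_of_length_eq_zero hw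
        have hx : ∀ c, reach (bits₁ G []) v (crn c) →
            (spanGraph 1 G).Reachable x (corner 1 c) := by
          intro c hc
          rw [reachable_spanGraph hG, hv]
          have := (reach_nil hG _ _).1 hc
          rwa [vpt_crn] at this
        obtain ⟨c, hc⟩ := hg'.1 v
        rw [mem_insert_iff, mem_singleton_iff, SimpleGraph.ConnectedComponent.eq,
          SimpleGraph.ConnectedComponent.eq]
        by_cases hci : c = i
        · subst hci; exact Or.inl (hx _ hc)
        · right
          rcases h3 c hci with rfl | rfl
          · exact hx _ hc
          · exact hx _ (reach_trans hc (reach_symm hr))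
    · rcases h3 j hj with rfl | rfl <;> rcases h3 k hk with rfl | rfl
      exacts [reach_refl _ _, hr, reach_symm hr, reach_refl _ _]

theorem edge_mem_traceOne (hG : G ⊆ EG 1) (hg : good (bits₁ G [])) (k : Fin 3) :
    edge [] k ∈ traceOne G ↔ tau (bits₁ G []) k := by
  have h3 : edge [] k ∈ EG 0 := edge_mem_EG [] k
  simp only [traceOne, mem_ofPred_eq, h3, true_and, corner_mem_edge_nil, mem_treesOfType hG hg,
    mem_twoForests hG hg, tau, Bool.or_eq_true, Bool.and_eq_true, List.any_eq_true,
    List.mem_finRange, bne_iff_ne, Bool.not_eq_true', Bool.not_eq_true, not_not]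
  constructor
  · rintro (⟨i, ⟨hj, ht⟩, hik⟩ | ⟨i, h, rfl⟩)
    · exact Or.inl ⟨hj, i, hik, ht⟩
    · exact Or.inr h
  · rintro (⟨hj, i, hik, ht⟩ | h)
    · exact Or.inl ⟨i, ⟨hj, ht⟩, hik⟩
    · exact Or.inr ⟨k, h, rfl⟩

end LevelOne

theorem traceOne_subset (G : Set (Sym2 Plane)) : traceOne G ⊆ EG 0 := fun _ h => h.1

theorem trace_subset (n : ℕ) (F : Set (Sym2 Plane)) : trace n F ⊆ EG n := by
  intro e he
  simp only [trace, mem_iUnion] at he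
  obtain ⟨w, rfl, e, he, rfl⟩ := he
  obtain ⟨v, hv, k, rfl⟩ := mem_EG.1 (traceOne_subset _ he)
  obtain rfl := List.eq_nil_of_length_eq_zero hv
  rw [map_edge, List.append_nil]
  exact edge_mem_EG w k

theorem edge_mem_trace {n : ℕ} {w : List (Fin 3)} (hw : w.length = n) (F : Set (Sym2 Plane))
    (k : Fin 3) : edge w k ∈ trace n F ↔ edge [] k ∈ traceOne (restrict w 1 F) := by
  simp only [trace, mem_iUnion]
  constructor
  · rintro ⟨v, hv, e, he, h⟩
    obtain ⟨v', hv', l, rfl⟩ := mem_EG.1 (traceOne_subset _ he)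
    obtain rfl := List.eq_nil_of_length_eq_zero hv'
    rw [map_edge, List.append_nil] at h
    obtain ⟨rfl, rfl⟩ := edge_inj (hv.trans hw.symm) h
    exact he
  · intro h
    exact ⟨w, hw, edge [] k, h, by rw [map_edge, List.append_nil]⟩

/-- This identifies the geometric trace with its finite model, one cell at a time. -/
theorem bits_trace {n : ℕ} {w : List (Fin 3)} (hw : w.length = n) {F : Set (Sym2 Plane)}
    (hg : good (bits₁ F w)) : bits (trace n F) w = tau (bits₁ F w) := by
  funext k
  rw [Bool.eq_iff_iff, bits_iff, edge_mem_trace hw,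
    edge_mem_traceOne (fun e he => he.1) (by rwa [bits₁_restrict]), bits₁_restrict]

end

section

/-! ### The trace of a spanning tree -/

theorem finite_VG : ∀ n, (VG n).Finite
  | 0 => finite_range u
  | n + 1 => finite_iUnion fun i => (finite_VG n).image (ψ i)

theorem finite_EG (n : ℕ) : (EG n).Finite := by
  have : EG n ⊆ range fun p : List.Vector (Fin 3) n × Fin 3 => edge p.1.1 p.2 := by
    intro e he
    obtain ⟨w, hw, k, rfl⟩ := mem_EG.1 he
    exact ⟨(⟨w, hw⟩, k), rfl⟩
  exact (finite_range _).subset this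

theorem size₀_eq_sum (β : Bits₀) : size₀ β = ∑ k, (β k).toNat := by
  rw [Fin.sum_univ_three]; rfl

theorem size_eq_sum (σ : Bits) : size σ = ∑ b, size₀ (σ b) := by
  rw [Fin.sum_univ_three]; rfl

theorem ncard_eq_sum {ι : Type*} [Fintype ι] {F : Set (Sym2 Plane)} (f : ι → Sym2 Plane)
    (hf : Function.Injective f) (hF : F ⊆ range f) (β : ι → Bool) (hβ : ∀ i, β i ↔ f i ∈ F) :
    F.ncard = ∑ i, (β i).toNat := by
  classical
  have : F = f '' (Finset.univ.filter fun i => β i = true : Finset ι) := by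
    ext e
    simp only [Finset.coe_filter, Finset.mem_univ, true_and, mem_image, mem_ofPred_eq]
    constructor
    · intro he
      obtain ⟨i, rfl⟩ := hF he
      exact ⟨i, (hβ i).2 he, rfl⟩
    · rintro ⟨i, hi, rfl⟩
      exact (hβ i).1 hi
  rw [this, ncard_image_of_injective _ hf, ncard_coe_finset, Finset.card_filter]
  exact Finset.sum_congr rfl fun i _ => by cases β i <;> rfl

theorem ncard_eq_sum_size₀ {n : ℕ} {F : Set (Sym2 Plane)} (hF : F ⊆ EG n) :
    F.ncard = ∑ w : List.Vector (Fin 3) n, size₀ (bits F w.1) := by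
  rw [ncard_eq_sum (fun p : List.Vector (Fin 3) n × Fin 3 => edge p.1.1 p.2) _ _
    (fun p => bits F p.1.1 p.2) (fun p => bits_iff), Fintype.sum_prod_type]
  · simp only [size₀_eq_sum]
  · rintro ⟨v, k⟩ ⟨w, l⟩ h
    obtain ⟨h1, rfl⟩ := edge_inj (v.2.trans w.2.symm) h
    rw [Subtype.ext h1]
  · intro e he
    obtain ⟨w, hw, k, rfl⟩ := mem_EG.1 (hF he)
    exact ⟨(⟨w, hw⟩, k), rfl⟩

theorem ncard_eq_sum_size {n : ℕ} {F : Set (Sym2 Plane)} (hF : F ⊆ EG (n + 1)) :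
    F.ncard = ∑ w : List.Vector (Fin 3) n, size (bits₁ F w.1) := by
  rw [ncard_eq_sum (fun p : List.Vector (Fin 3) n × Fin 3 × Fin 3 => edge (p.1.1 ++ [p.2.1]) p.2.2)
    _ _ (fun p => bits₁ F p.1.1 p.2.1 p.2.2) (fun p => bits₁_iff), Fintype.sum_prod_type]
  · simp only [size_eq_sum, size₀_eq_sum, Fintype.sum_prod_type]
  · rintro ⟨v, b, k⟩ ⟨w, c, l⟩ h
    obtain ⟨h1, h2⟩ := edge_inj (by simp [v.2, w.2]) h
    obtain ⟨h3, h4⟩ := List.append_inj' h1 rfl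
    simp only [List.cons.injEq, and_true] at h4
    dsimp only at h2 h3
    rw [Subtype.ext h3, h4, h2]
  · intro e he
    obtain ⟨w, hw, k, rfl⟩ := mem_EG.1 (hF he)
    obtain ⟨v, b, rfl, hv⟩ := exists_append_singleton hw
    exact ⟨(⟨v, hv⟩, b, k), rfl⟩

theorem crn_or_mid (x : Fin 6) : (∃ i, x = crn i) ∨ ∃ k : Fin 3, x = k.natAdd 3 := by
  revert x; decide

theorem mid_ne_crn (k i : Fin 3) : (k.natAdd 3 : Fin 6) ≠ crn i := by revert k i; decide

/-- Each cell contributes its three midpoints as new vertices. A midpoint is not a corner of its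
cell, hence lies in no other cell of that level and is not an old vertex. -/
theorem ncard_VG_succ (n : ℕ) : (VG (n + 1)).ncard = (VG n).ncard + 3 * 3 ^ n := by
  set f : List.Vector (Fin 3) n × Fin 3 → Plane := fun p => vpt p.1.1 (p.2.natAdd 3) with hf
  have hcover : VG (n + 1) = VG n ∪ range f := by
    refine Subset.antisymm (fun x hx => ?_) (union_subset (VG_subset_succ n) ?_)
    · obtain ⟨w, rfl, v, rfl⟩ := exists_vpt_of_mem_VG hx
      rcases crn_or_mid v with ⟨i, rfl⟩ | ⟨k, rfl⟩
      · rw [vpt_crn]; exact Or.inl (pt_mem_VG w i)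
      · exact Or.inr ⟨(⟨w, rfl⟩, k), rfl⟩
    · rintro _ ⟨p, rfl⟩
      have := vpt_mem_VG p.1.1 (p.2.natAdd 3)
      rwa [p.1.2] at this
  have hdisj : Disjoint (VG n) (range f) := by
    rw [Set.disjoint_left]
    rintro _ h ⟨p, rfl⟩
    obtain ⟨i, hi⟩ := exists_crn_of_mem_VG (w := p.1.1) (by rw [p.1.2]; exact h)
    exact mid_ne_crn _ _ hi
  have hinj : Function.Injective f := by
    rintro ⟨v, k⟩ ⟨w, l⟩ h
    have h : vpt v.1 (k.natAdd 3) = vpt w.1 (l.natAdd 3) := h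
    have hvw : v = w := by
      by_contra hvw
      obtain ⟨i, hi⟩ := exists_crn_of_mem_cell (v.2.trans w.2.symm)
        (fun h => hvw (Subtype.ext h)) (h ▸ vpt_mem_cell w.1 _)
      exact mid_ne_crn _ _ hi
    subst hvw
    have := vpt_injective _ h
    rw [Fin.natAdd_inj] at this
    rw [this]
  rw [hcover, ncard_union_eq hdisj (finite_VG n) (finite_range f), ← image_univ,
    ncard_image_of_injective _ hinj, ncard_univ, Nat.card_eq_fintype_card, Fintype.card_prod,
    card_vector]
  simp [mul_comm]

/-- Replacing acyclicity by an edge count reduces the comparison of a tree with its trace to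
counting. -/
theorem isTree_spanGraph {n : ℕ} {F : Set (Sym2 Plane)} (hF : F ⊆ EG n) :
    (spanGraph n F).IsTree ↔
      (∀ x ∈ VG n, ∀ y ∈ VG n, Conn F x y) ∧ F.ncard + 1 = (VG n).ncard := by
  have : Finite (VG n) := (finite_VG n).to_subtype
  have hF' : F = Sym2.map Subtype.val '' (spanGraph n F).edgeSet := by
    ext e
    constructor
    · intro he
      induction e with
      | _ x y =>
        have h := mem_VG_and_ne_of_mem_EG (hF he)
        exact ⟨s(⟨x, h.1⟩, ⟨y, h.2.1⟩), ⟨fun h' => h.2.2 (congrArg Subtype.val h'), he⟩, rfl⟩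
    · rintro ⟨e, he, rfl⟩
      induction e with
      | _ x y => exact he.2
  have hcard : Nat.card (spanGraph n F).edgeSet = F.ncard := by
    conv_rhs => rw [hF']
    rw [ncard_image_of_injective _ (Sym2.map.injective Subtype.val_injective)]
    rfl
  rw [SimpleGraph.isTree_iff_connected_and_card, hcard, preconnected_spanGraph hF]
  rfl

/-- A path that starts at a vertex joined to no corner within the cell can never leave the cell, and
so it misses the corners altogether, contradicting connectedness. A local cycle would be a cycle of
`F`. -/
theorem good_of_mem_spanningTrees {n : ℕ} {F : Set (Sym2 Plane)} (hF : F ∈ spanningTrees (n + 1))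
    {w : List (Fin 3)} (hw : w.length = n) : good (bits₁ F w) := by
  subst hw
  rw [good, Bool.and_eq_true]
  constructor
  · rw [anchored_iff]
    intro v
    by_contra! hv
    have key : ∀ q, Conn F (vpt w v) q → ∃ v', q = vpt w v' ∧ reach (bits₁ F w) v v' := by
      intro q hq
      induction hq with
      | refl => exact ⟨v, rfl, reach_refl _ _⟩
      | tail _ hqr ih =>
        obtain ⟨v', rfl, hv'⟩ := ih
        obtain ⟨w', hw', k, hk⟩ := mem_EG.1 (hF.1 hqr)
        obtain ⟨w', b, rfl, hl⟩ := exists_append_singleton hw'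
        have hk' := hk
        rw [edge_append_singleton] at hk'
        have hvw : vpt w v' ∈ cell w' := by
          rcases Sym2.eq_iff.1 hk' with ⟨h1, -⟩ | ⟨h1, -⟩ <;> rw [h1] <;> exact vpt_mem_cell _ _
        have hww : w = w' := by
          by_contra hww
          obtain ⟨i, rfl⟩ := exists_crn_of_mem_cell hl.symm hww hvw
          exact hv i hv'
        subst hww
        have hbit : bits₁ F w b k := bits₁_iff.2 (hk ▸ hqr)
        rcases Sym2.eq_iff.1 hk' with ⟨h1, rfl⟩ | ⟨h1, rfl⟩
        · refine ⟨_, rfl, reach_trans hv' ?_⟩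
          rw [vpt_injective w h1]; exact reach_edge hbit
        · refine ⟨_, rfl, reach_trans hv' ?_⟩
          rw [vpt_injective w h1]; exact reach_symm (reach_edge hbit)
    have hc : Conn F (vpt w v) (vpt w (crn 0)) :=
      (preconnected_spanGraph hF.1).1 hF.2.connected _ (vpt_mem_VG w v) _ (vpt_mem_VG w (crn 0))
    obtain ⟨v', h1, h2⟩ := key _ hc
    rw [← vpt_injective w h1] at h2
    exact hv 0 h2
  · rw [acyclic_iff]
    intro b k hbk hr
    rw [← bits₁_sdiff_edge] at hr
    have hc := conn_of_reach hr
    rw [vpt_vtx, vpt_vtx] at hc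
    exact (isAcyclic_spanGraph hF.1).1 hF.2.isAcyclic _ _ (bits₁_iff.1 hbk) hc

theorem third_add (k : Fin 3) : third (k + 1) (k + 2) = k := by revert k; decide

theorem third_spec {i j : Fin 3} (hij : i ≠ j) :
    third i j ≠ i ∧ third i j ≠ j ∧ third i (third i j) = j ∧ third (third i j) j = i := by
  revert i j; decide

theorem cconn_edge {β : Bits₀} {k : Fin 3} (h : β k) : cconn β (k + 1) (k + 2) := by
  simp [cconn, third_add, h]

theorem conn_of_cconn {F : Set (Sym2 Plane)} {w : List (Fin 3)} {i j : Fin 3}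
    (h : cconn (bits F w) i j) : Conn F (pt w i) (pt w j) := by
  by_cases hij : i = j
  · subst hij; exact Conn.refl _
  have h1 := third_spec hij
  have hedge : ∀ {i j}, i ≠ j → bits F w (third i j) → Conn F (pt w i) (pt w j) := by
    intro i j hij h
    refine Conn.of_mem ?_
    rw [mk_pt_pt w hij]
    exact bits_iff.1 h
  simp only [cconn, Bool.or_eq_true, Bool.and_eq_true, beq_iff_eq, hij, false_or] at h
  rcases h with h | ⟨hi, hj⟩
  · exact hedge hij h
  · refine (hedge (j := third i j) (Ne.symm h1.1) ?_).trans (hedge h1.2.1 ?_)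
    · rwa [h1.2.2.1]
    · rwa [h1.2.2.2]

section Trace

variable {n : ℕ} {F : Set (Sym2 Plane)}

theorem cconn_bits_trace (hg : ∀ w : List (Fin 3), w.length = n → good (bits₁ F w))
    {w : List (Fin 3)} (hw : w.length = n) (i j : Fin 3) :
    cconn (bits (trace n F) w) i j = reach (bits₁ F w) (crn i) (crn j) := by
  rw [bits_trace hw (hg w hw), ((good_spec (hg w hw)).2.2 i j).1]

/-- A path between vertices of level `n` decomposes into pieces within cells that join corners, and
within a good cell the trace joins the same corners. Conversely, each edge of the trace stands for
two joined corners of a cell. -/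
theorem conn_trace_iff (hF : F ⊆ EG (n + 1))
    (hg : ∀ w : List (Fin 3), w.length = n → good (bits₁ F w)) {x y : Plane} (hx : x ∈ VG n)
    (hy : y ∈ VG n) : Conn (trace n F) x y ↔ Conn F x y := by
  constructor
  · intro h
    clear hx hy
    induction h with
    | refl => exact Conn.refl _
    | tail _ hqr ih =>
      refine ih.trans ?_
      obtain ⟨w, hw, k, hk⟩ := mem_EG.1 (trace_subset _ _ hqr)
      have h1 : cconn (bits (trace n F) w) (k + 1) (k + 2) :=
        cconn_edge (bits_iff.2 (hk ▸ hqr))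
      rw [cconn_bits_trace hg hw] at h1
      have h2 := conn_of_reach h1
      rw [vpt_crn, vpt_crn] at h2
      rcases Sym2.eq_iff.1 hk with ⟨rfl, rfl⟩ | ⟨rfl, rfl⟩
      exacts [h2, h2.symm]
  -- The induction must also cover end points `q` that are not vertices of level `n`. The claim is
  -- therefore about all corners which can be reached from `q` within a cell containing `q`. If the
  -- last edge lies in another cell, then `q` is a common corner of both cells.
  · have key : ∀ q, Conn F x q → ∀ w : List (Fin 3), w.length = n → ∀ v c, q = vpt w v →
        reach (bits₁ F w) v (crn c) → Conn (trace n F) x (pt w c) := by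
      intro q hq
      induction hq with
      | refl =>
        intro w hw v c hv hr
        obtain ⟨c', rfl⟩ := exists_crn_of_mem_VG (w := w) (x := v) (by rw [hw, ← hv]; exact hx)
        rw [← cconn_bits_trace hg hw] at hr
        rw [hv, vpt_crn]
        exact conn_of_cconn hr
      | @tail q r _ hqr ih =>
        intro w hw v c hv hr
        obtain ⟨w', hw', k, hk⟩ := mem_EG.1 (hF hqr)
        obtain ⟨w', b, rfl, hl⟩ := exists_append_singleton hw'
        have hbit : bits₁ F w' b k := bits₁_iff.2 (hk ▸ hqr)
        obtain ⟨a, a', rfl, rfl, haa⟩ : ∃ a a', q = vpt w' a ∧ r = vpt w' a' ∧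
            reach (bits₁ F w') a a' := by
          rw [edge_append_singleton] at hk
          rcases Sym2.eq_iff.1 hk with ⟨h1, h2⟩ | ⟨h1, h2⟩
          · exact ⟨_, _, h1, h2, reach_edge hbit⟩
          · exact ⟨_, _, h1, h2, reach_symm (reach_edge hbit)⟩
        by_cases hww : w' = w
        · subst hww
          rw [← vpt_injective w' hv] at hr
          exact ih w' hw a c rfl (reach_trans haa hr)
        · obtain ⟨c1, rfl⟩ := exists_crn_of_mem_cell (hl.trans hw.symm) hww
            (hv ▸ vpt_mem_cell w v)
          obtain ⟨c2, rfl⟩ := exists_crn_of_mem_cell (hw.trans hl.symm) (Ne.symm hww)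
            (hv ▸ vpt_mem_cell w' (crn c1))
          refine (ih w' hl a c1 rfl haa).trans ?_
          rw [← vpt_crn w', hv, vpt_crn]
          rw [← cconn_bits_trace hg hw] at hr
          exact conn_of_cconn hr
    intro h
    obtain ⟨w, hw, i, rfl⟩ := exists_pt_of_mem_VG hy
    exact key _ h w hw (crn i) i (vpt_crn w i).symm (reach_refl _ _)

/-- Connectivity passes between `F` and its trace by `conn_trace_iff`, as anchoring joins each new
vertex to an old one. A good cell has three edges more than its trace, which adds up to `3 * 3 ^ n`,
precisely the number of new vertices in `ncard_VG_succ`. -/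
theorem mem_spanningTrees_succ (hF : F ⊆ EG (n + 1)) :
    F ∈ spanningTrees (n + 1) ↔ (∀ w : List (Fin 3), w.length = n → good (bits₁ F w)) ∧
      trace n F ∈ spanningTrees n := by
  suffices h : (∀ w : List (Fin 3), w.length = n → good (bits₁ F w)) →
      (F ∈ spanningTrees (n + 1) ↔ trace n F ∈ spanningTrees n) by
    constructor
    · intro h'
      have hg := fun w => good_of_mem_spanningTrees h' (w := w)
      exact ⟨hg, (h hg).1 h'⟩
    · exact fun h' => (h h'.1).2 h'.2
  intro hg
  simp only [spanningTrees, mem_ofPred_eq, hF, true_and, trace_subset, isTree_spanGraph hF,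
    isTree_spanGraph (trace_subset n F)]
  refine and_congr ?_ ?_
  · constructor
    · exact fun h x hx y hy =>
        (conn_trace_iff hF hg hx hy).2 (h x (VG_subset_succ n hx) y (VG_subset_succ n hy))
    · intro h
      have hc : ∀ x ∈ VG (n + 1), ∃ y ∈ VG n, Conn F x y := by
        intro x hx
        obtain ⟨w, rfl, v, rfl⟩ := exists_vpt_of_mem_VG hx
        have h1 := hg w rfl
        rw [good, Bool.and_eq_true, anchored_iff] at h1
        obtain ⟨c, hc⟩ := h1.1 v
        refine ⟨_, pt_mem_VG w c, ?_⟩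
        rw [← vpt_crn]
        exact conn_of_reach hc
      intro x hx y hy
      obtain ⟨x', hx', hxx⟩ := hc x hx
      obtain ⟨y', hy', hyy⟩ := hc y hy
      exact hxx.trans (((conn_trace_iff hF hg hx' hy').1 (h x' hx' y' hy')).trans hyy.symm)
  · have h1 : F.ncard = (trace n F).ncard + 3 * 3 ^ n := by
      rw [ncard_eq_sum_size hF, ncard_eq_sum_size₀ (trace_subset n F)]
      have : ∀ w : List.Vector (Fin 3) n,
          size (bits₁ F w.1) = size₀ (bits (trace n F) w.1) + 3 := by
        intro w
        rw [(good_spec (hg w.1 w.2)).1, bits_trace w.2 (hg w.1 w.2), add_comm]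
      rw [Finset.sum_congr rfl fun w _ => this w, Finset.sum_add_distrib, Finset.sum_const,
        Finset.card_univ, card_vector]
      simp [mul_comm]
    rw [h1, ncard_VG_succ]
    omega

end Trace

end

section

/-! ### Passages through cells -/

/-- A passage through the cell `p.1` from its corner `p.2.1` to its corner `p.2.2`. -/
abbrev Pass : Type := List (Fin 3) × Fin 3 × Fin 3

/-- The starting point of a passage. -/
def src (p : Pass) : Plane := pt p.1 p.2.1

/-- The end point of a passage. -/
def tgt (p : Pass) : Plane := pt p.1 p.2.2

/-- A list of passages leads from `x` to `y`. -/
def Joins : Plane → List Pass → Plane → Prop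
  | x, [], y => x = y
  | x, p :: l, y => src p = x ∧ Joins (tgt p) l y

theorem joins_append {x y : Plane} {l l' : List Pass} :
    Joins x (l ++ l') y ↔ ∃ z, Joins x l z ∧ Joins z l' y := by
  induction l generalizing x with
  | nil => simp [Joins]
  | cons p l ih => simp [Joins, ih, and_assoc]

theorem joins_flatMap {f : Pass → List Pass} {l : List Pass}
    (h : ∀ p ∈ l, Joins (src p) (f p) (tgt p)) {x y : Plane} (hl : Joins x l y) :
    Joins x (l.flatMap f) y := by
  induction l generalizing x with
  | nil => exact hl
  | cons p l ih =>
    rw [List.flatMap_cons, joins_append]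
    refine ⟨tgt p, hl.1 ▸ h p List.mem_cons_self, ih (fun q hq => h q (List.mem_cons_of_mem _ hq)) hl.2⟩

/-- The points visited by a list of passages. -/
def node (x : Plane) (l : List Pass) (k : ℕ) : Plane := (x :: l.map tgt).getD k 0

@[simp] theorem node_zero (x : Plane) (l : List Pass) : node x l 0 = x := rfl

theorem node_cons_succ (x : Plane) (p : Pass) (l : List Pass) (k : ℕ) :
    node x (p :: l) (k + 1) = node (tgt p) l k := rfl

theorem node_append {x : Plane} {l l' : List Pass} {k : ℕ} (hk : k ≤ l.length) :
    node x (l ++ l') k = node x l k := by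
  induction l generalizing x k with
  | nil =>
    obtain rfl : k = 0 := by simpa using hk
    rfl
  | cons p l ih =>
    cases k with
    | zero => rfl
    | succ k =>
      rw [List.cons_append, node_cons_succ, node_cons_succ]
      exact ih (by simpa using hk)

theorem Joins.node_length {x y : Plane} {l : List Pass} (h : Joins x l y) :
    node x l l.length = y := by
  induction l generalizing x with
  | nil => exact h
  | cons p l ih => exact ih h.2

theorem Joins.node_eq {x y : Plane} {l : List Pass} (h : Joins x l y) {k : ℕ} (hk : k < l.length) :
    node x l k = src l[k] ∧ node x l (k + 1) = tgt l[k] := by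
  induction l generalizing x k with
  | nil => simp at hk
  | cons p l ih =>
    cases k with
    | zero => exact ⟨h.1.symm, by rw [node_cons_succ]; simp⟩
    | succ k => exact ih h.2 (by simpa using hk)

/-- The edges of the walk along a passage in the subgraph with edges `F`. -/
def arcsIn (β : Bits₀) (p : Pass) : List Pass :=
  if β (third p.2.1 p.2.2) then [p]
  else [(p.1, p.2.1, third p.2.1 p.2.2), (p.1, third p.2.1 p.2.2, p.2.2)]

/-- The passages through the subcells of a traversed cell. -/
def childIn (σ : Bits) (p : Pass) : List Pass :=
  (route σ p.2.1 p.2.2).map fun q => (p.1 ++ [q.1], q.2.1, q.2.2)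

theorem length_arcsIn (β : Bits₀) (p : Pass) : (arcsIn β p).length = steps β p.2.1 p.2.2 := by
  unfold arcsIn steps
  split_ifs <;> rfl

theorem one_le_length_arcsIn (β : Bits₀) (p : Pass) : 1 ≤ (arcsIn β p).length := by
  rw [length_arcsIn, steps]; split_ifs <;> simp

theorem joins_arcsIn (β : Bits₀) (p : Pass) : Joins (src p) (arcsIn β p) (tgt p) := by
  unfold arcsIn
  split_ifs <;> simp [Joins, src, tgt]

theorem two_le_length_childIn (σ : Bits) (p : Pass) : 2 ≤ (childIn σ p).length := by
  unfold childIn route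
  split_ifs <;> simp

theorem joins_childIn (σ : Bits) (p : Pass) : Joins (src p) (childIn σ p) (tgt p) := by
  have h1 : ∀ w i, pt (w ++ [i]) i = pt w i := fun w i => by
    rw [pt_append]; exact congrArg (ψw w) (psi_corner i)
  have h2 : ∀ w i j, pt (w ++ [i]) j = pt (w ++ [j]) i := fun w i j => by
    rw [pt_append, pt_append]; exact congrArg (ψw w) (psi_corner_comm i j)
  obtain ⟨w, i, j⟩ := p
  unfold childIn route
  split_ifs
  · simp [Joins, src, tgt, h1, h2 w j i]
  · simp [Joins, src, tgt, h1, h2 w i (third i j), h2 w j (third i j)]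

theorem pairwise_childIn (σ : Bits) {p : Pass} (hp : p.2.1 ≠ p.2.2) :
    (childIn σ p).Pairwise fun q r => q.1 ≠ r.1 := by
  obtain ⟨w, i, j⟩ := p
  have := third_spec hp
  unfold childIn route
  split_ifs
  · simpa using hp
  · simp only [List.map_cons, List.map_nil, List.pairwise_cons, List.mem_cons]
    refine ⟨?_, ?_, by simp⟩
    · rintro q (rfl | rfl | h)
      · simpa using this.1.symm
      · simpa using hp
      · simp at h
    · rintro q (rfl | h)
      · simpa using this.2.1
      · simp at h

theorem ne_of_mem_route {σ : Bits} {i j : Fin 3} (hij : i ≠ j) :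
    ∀ q ∈ route σ i j, q.2.1 ≠ q.2.2 := by
  have := third_spec hij
  unfold route
  split_ifs <;> simp [hij, this.1.symm, this.2.1]

theorem exists_of_mem_childIn {σ : Bits} {p q : Pass} (hq : q ∈ childIn σ p) :
    ∃ b, q.1 = p.1 ++ [b] := by
  obtain ⟨r, -, rfl⟩ := List.mem_map.1 hq
  exact ⟨r.1, rfl⟩

/-- A passage of level `n` between different corners that are connected within the cell. -/
structure Valid (n : ℕ) (F : Set (Sym2 Plane)) (p : Pass) : Prop where
  length_eq : p.1.length = n
  ne : p.2.1 ≠ p.2.2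
  conn : cconn (bits F p.1) p.2.1 p.2.2

theorem Valid.arc {n : ℕ} {F : Set (Sym2 Plane)} {p : Pass} (hp : Valid n F p) :
    ∀ a ∈ arcsIn (bits F p.1) p, a.1 = p.1 ∧ a.2.1 ≠ a.2.2 ∧ s(src a, tgt a) ∈ F := by
  obtain ⟨w, i, j⟩ := p
  obtain ⟨h1, h2, h3⟩ := hp
  have := third_spec h2
  simp only [cconn, Bool.or_eq_true, Bool.and_eq_true, beq_iff_eq] at h1 h2 h3
  have hedge : ∀ {i j}, i ≠ j → bits F w (third i j) → s(pt w i, pt w j) ∈ F := by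
    intro i j hij h
    rw [mk_pt_pt w hij]
    exact bits_iff.1 h
  intro a ha
  simp only [arcsIn] at ha
  dsimp only at this
  split_ifs at ha with hb
  · obtain rfl := List.mem_singleton.1 ha
    exact ⟨rfl, h2, hedge h2 hb⟩
  · simp only [h2, hb, Bool.false_eq_true, false_or] at h3
    simp only [List.mem_cons, List.not_mem_nil, or_false] at ha
    rcases ha with rfl | rfl
    · exact ⟨rfl, this.1.symm, hedge this.1.symm (by rw [this.2.2.1]; simpa using h3.2)⟩
    · exact ⟨rfl, this.2.1, hedge this.2.1 (by rw [this.2.2.2]; simpa using h3.1)⟩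

theorem mk_src_tgt {a : Pass} (ha : a.2.1 ≠ a.2.2) :
    s(src a, tgt a) = edge a.1 (third a.2.1 a.2.2) := mk_pt_pt _ ha

theorem pairwise_arcsIn (β : Bits₀) {p : Pass} (hp : p.2.1 ≠ p.2.2) :
    (arcsIn β p).Pairwise fun a b => s(src a, tgt a) ≠ s(src b, tgt b) := by
  obtain ⟨w, i, j⟩ := p
  have h := third_spec hp
  unfold arcsIn
  split_ifs
  · simp
  · simp only [List.pairwise_cons, List.mem_singleton, forall_eq, List.not_mem_nil,
      IsEmpty.forall_iff, implies_true, List.Pairwise.nil, and_true]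
    rw [mk_src_tgt (a := (w, i, third i j)) h.1.symm, mk_src_tgt (a := (w, third i j, j)) h.2.1]
    intro he
    have := (edge_inj (v := w) (w := w) rfl he).2
    dsimp only at this h hp
    rw [h.2.2.1, h.2.2.2] at this
    exact hp this.symm

/-! ### The passages of the walks in a sequence of trees -/

variable (T : TreeLimit)

/-- The model of the tree `T` in the cell `w`. -/
def loc (w : List (Fin 3)) : Bits₀ := bits (T.1 w.length) w

/-- The model of the tree `T` in the subcells of the cell `w`. -/
def loc₁ (w : List (Fin 3)) : Bits := bits₁ (T.1 (w.length + 1)) w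

/-- The passages through the cells of level `p.1.length + d` within the passage `p`. -/
def desc (p : Pass) : ℕ → List Pass
  | 0 => [p]
  | d + 1 => (desc p d).flatMap fun q => childIn (loc₁ T q.1) q

/-- The passages through cells of level `n` of the walk between the first two corners. -/
def passes (n : ℕ) : List Pass := desc T ([], 0, 1) n

/-- The edges traversed by the walk of level `p.1.length + d` within the passage `p`. -/
def arcs (p : Pass) (d : ℕ) : List Pass :=
  (desc T p d).flatMap fun q => arcsIn (loc T q.1) q

variable {T}

theorem loc₁_good (w : List (Fin 3)) : good (loc₁ T w) :=
  good_of_mem_spanningTrees (T.2 (w.length + 1)).1 rfl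

theorem loc_eq_tau (w : List (Fin 3)) : loc T w = tau (loc₁ T w) := by
  rw [loc, ← (T.2 w.length).2]
  exact bits_trace rfl (loc₁_good w)

theorem loc_proper (w : List (Fin 3)) : Proper (loc T w) := by
  rw [loc_eq_tau]; exact (good_spec (loc₁_good w)).2.1

/-- The local path between two joined corners enters and leaves each subcell at corners that are
joined within that subcell; this is the last clause of `good_spec`. -/
theorem Valid.child {n : ℕ} {p q : Pass} (hp : Valid n (T.1 n) p)
    (hq : q ∈ childIn (loc₁ T p.1) p) : Valid (n + 1) (T.1 (n + 1)) q := by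
  obtain ⟨r, hr, rfl⟩ := List.mem_map.1 hq
  obtain ⟨rfl, h2, h3⟩ := hp
  refine ⟨by simp, ne_of_mem_route h2 r hr, ?_⟩
  have h4 := ((good_spec (loc₁_good (T := T) p.1)).2.2 p.2.1 p.2.2).2 h2
  rw [← loc_eq_tau] at h4
  exact h4 h3 r hr

theorem Valid.desc {n : ℕ} {p : Pass} (hp : Valid n (T.1 n) p) {d : ℕ} :
    ∀ q ∈ desc T p d, Valid (n + d) (T.1 (n + d)) q ∧ p.1 <+: q.1 := by
  induction d with
  | zero =>
    intro q hq
    obtain rfl := List.mem_singleton.1 hq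
    exact ⟨hp, List.prefix_rfl⟩
  | succ d ih =>
    intro q hq
    obtain ⟨r, hr, hq⟩ := List.mem_flatMap.1 hq
    obtain ⟨b, hb⟩ := exists_of_mem_childIn hq
    exact ⟨(ih r hr).1.child hq, (ih r hr).2.trans (hb ▸ List.prefix_append _ _)⟩

theorem desc_add (p : Pass) (d e : ℕ) :
    desc T p (d + e) = (desc T p d).flatMap fun q => desc T q e := by
  induction e with
  | zero => simp [desc]
  | succ e ih => rw [← Nat.add_assoc, desc, ih, List.flatMap_assoc]; rfl

theorem joins_desc (p : Pass) (d : ℕ) : Joins (src p) (desc T p d) (tgt p) := by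
  induction d with
  | zero => exact ⟨rfl, rfl⟩
  | succ d ih => exact joins_flatMap (fun q _ => joins_childIn _ q) ih

theorem joins_arcs (p : Pass) (d : ℕ) : Joins (src p) (arcs T p d) (tgt p) :=
  joins_flatMap (fun q _ => joins_arcsIn _ q) (joins_desc p d)

/-- A local path between corners enters no subcell twice, and subcells of different cells are
different. Hence the local forests along a path are distinct coordinates of a product, which gives
the independence used for the second moments. -/
theorem pairwise_desc {n : ℕ} {p : Pass} (hp : Valid n (T.1 n) p) (d : ℕ) :
    (desc T p d).Pairwise fun q r => q.1 ≠ r.1 := by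
  induction d with
  | zero => simp [desc]
  | succ d ih =>
    rw [desc, List.pairwise_flatMap]
    refine ⟨fun q hq => pairwise_childIn _ (hp.desc q hq).1.ne, ?_⟩
    refine ih.imp fun {q r} hqr => ?_
    intro q' hq' r' hr' h
    obtain ⟨b, hb⟩ := exists_of_mem_childIn hq'
    obtain ⟨c, hc⟩ := exists_of_mem_childIn hr'
    rw [hb, hc] at h
    exact hqr (List.append_inj' h rfl).1

/-- This exponential growth is what makes the Chebyshev bounds summable. -/
theorem two_pow_le_length_desc (p : Pass) (d : ℕ) : 2 ^ d ≤ (desc T p d).length := by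
  induction d with
  | zero => simp [desc]
  | succ d ih =>
    rw [desc, List.length_flatMap, pow_succ]
    refine (Nat.mul_le_mul_right 2 ih).trans ?_
    rw [← smul_eq_mul, ← List.length_map (f := fun q => (childIn (loc₁ T q.1) q).length)]
    refine List.card_nsmul_le_sum _ _ ?_
    intro x hx
    obtain ⟨q, -, rfl⟩ := List.mem_map.1 hx
    exact two_le_length_childIn _ _

theorem mem_arcs {n : ℕ} {p : Pass} (hp : Valid n (T.1 n) p) {d : ℕ} {a : Pass}
    (ha : a ∈ arcs T p d) : a.1.length = n + d ∧ p.1 <+: a.1 ∧ a.2.1 ≠ a.2.2 ∧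
      s(src a, tgt a) ∈ T.1 (n + d) := by
  obtain ⟨q, hq, ha⟩ := List.mem_flatMap.1 ha
  obtain ⟨h1, h2⟩ := hp.desc q hq
  rw [loc, h1.length_eq] at ha
  have h3 := h1.arc a ha
  rw [h3.1]
  exact ⟨h1.length_eq, h2, h3.2⟩

theorem arcs_ne_nil (p : Pass) (d : ℕ) : 1 ≤ (arcs T p d).length := by
  have h1 := (Nat.one_le_two_pow).trans (two_pow_le_length_desc (T := T) p d)
  rw [arcs]
  obtain ⟨q, l, hq⟩ := List.exists_cons_of_length_pos h1
  rw [hq, List.flatMap_cons, List.length_append]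
  have := one_le_length_arcsIn (loc T q.1) q
  omega

theorem pairwise_arcs {n : ℕ} {p : Pass} (hp : Valid n (T.1 n) p) (d : ℕ) :
    (arcs T p d).Pairwise fun a b => s(src a, tgt a) ≠ s(src b, tgt b) := by
  rw [arcs, List.pairwise_flatMap]
  refine ⟨fun q hq => pairwise_arcsIn _ (hp.desc q hq).1.ne, ?_⟩
  refine List.Pairwise.imp_of_mem ?_ (pairwise_desc hp d)
  intro q r hq hr hqr a ha b hb h
  have h1 := (hp.desc q hq).1
  have h2 := (hp.desc r hr).1
  rw [loc, h1.length_eq] at ha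
  rw [loc, h2.length_eq] at hb
  have h3 := h1.arc a ha
  have h4 := h2.arc b hb
  rw [mk_src_tgt h3.2.1, mk_src_tgt h4.2.1, h3.1, h4.1] at h
  exact hqr (edge_inj (h1.length_eq.trans h2.length_eq.symm) h).1

theorem arcs_add (p : Pass) (d e : ℕ) :
    arcs T p (d + e) = (desc T p d).flatMap fun q => arcs T q e := by
  rw [arcs, desc_add, List.flatMap_assoc]; rfl

theorem ncard_VG_zero : (VG 0).ncard = 3 := by
  change (range u).ncard = 3
  rw [← image_univ, ncard_image_of_injective _ corner_injective, ncard_univ]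
  simp

theorem ncard_eq_size₀ {F : Set (Sym2 Plane)} (hF : F ⊆ EG 0) : F.ncard = size₀ (bits F []) := by
  rw [ncard_eq_sum_size₀ hF]
  exact Fintype.sum_subsingleton _ List.Vector.nil

theorem cconn_of_size₀ {β : Bits₀} (h : size₀ β = 2) (i j : Fin 3) : cconn β i j := by
  revert β i j; decide

theorem valid_root (T : TreeLimit) : Valid 0 (T.1 0) ([], 0, 1) where
  length_eq := rfl
  ne := by simp
  conn := by
    have h1 := (T.2 0).1
    have h2 := ((isTree_spanGraph h1.1).1 h1.2).2
    rw [ncard_VG_zero, ncard_eq_size₀ h1.1] at h2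
    have h3 : size₀ (bits (T.1 0) []) = 2 := by omega
    exact cconn_of_size₀ h3 0 1

theorem exists_walk {n : ℕ} {F : Set (Sym2 Plane)} (hF : F ⊆ EG n) (l : List Pass)
    (hl : ∀ a ∈ l, s(src a, tgt a) ∈ F) (x y : VG n) (h : Joins x l y) :
    ∃ p : (spanGraph n F).Walk x y, p.support.map Subtype.val = (x : Plane) :: l.map tgt ∧
      p.edges.map (Sym2.map Subtype.val) = l.map fun a => s(src a, tgt a) := by
  induction l generalizing x with
  | nil =>
    obtain rfl : x = y := Subtype.ext h
    exact ⟨.nil, by simp, by simp⟩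
  | cons a l ih =>
    have ha := hl a List.mem_cons_self
    have hm := mem_VG_and_ne_of_mem_EG (hF ha)
    obtain ⟨p, hp, hp'⟩ := ih (fun b hb => hl b (List.mem_cons_of_mem _ hb)) ⟨tgt a, hm.2.1⟩ h.2
    have hadj : (spanGraph n F).Adj x ⟨tgt a, hm.2.1⟩ :=
      ⟨fun hx => hm.2.2 (h.1.trans (congrArg Subtype.val hx)), h.1 ▸ ha⟩
    refine ⟨.cons hadj p, ?_, ?_⟩
    · simp [hp]
    · simp [hp', h.1]

/-- The arcs form a walk in the tree with pairwise different edges, that is, a trail. In an acyclic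
graph a trail is a path, and the path between two vertices of a tree is unique. -/
theorem support_treeWalk (T : TreeLimit) (n : ℕ) :
    (treeWalk (T.2 n).1 (corner n 0) (corner n 1)).support.map Subtype.val =
      u 0 :: (arcs T ([], 0, 1) n).map tgt := by
  have hv := valid_root T
  have hF := (T.2 n).1
  have harc : ∀ a ∈ arcs T ([], 0, 1) n, s(src a, tgt a) ∈ T.1 n := by
    intro a ha
    have := (mem_arcs hv ha).2.2.2
    rwa [Nat.zero_add] at this
  obtain ⟨p, hp, hp'⟩ := exists_walk hF.1 _ harc (corner n 0) (corner n 1)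
    (joins_arcs (T := T) ([], 0, 1) n)
  have htrail : p.IsTrail := by
    rw [SimpleGraph.Walk.isTrail_def]
    refine List.Nodup.of_map (Sym2.map Subtype.val) ?_
    rw [hp', List.Nodup, List.pairwise_map]
    exact pairwise_arcs hv n
  have hpath := (hF.2.isAcyclic.isPath_iff_isTrail p).2 htrail
  have := (hF.2.existsUnique_path (corner n 0) (corner n 1)).unique hpath
    (hF.2.existsUnique_path (corner n 0) (corner n 1)).choose_spec.1
  rw [this] at hp
  exact hp

theorem treeWalk_isPath (T : TreeLimit) (n : ℕ) :
    (treeWalk (T.2 n).1 (corner n 0) (corner n 1)).IsPath :=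
  ((T.2 n).1.2.existsUnique_path (corner n 0) (corner n 1)).choose_spec.1

theorem nodup_nodes (T : TreeLimit) (n : ℕ) :
    (u 0 :: (arcs T ([], 0, 1) n).map tgt).Nodup := by
  rw [← support_treeWalk]
  exact (treeWalk_isPath T n).support_nodup.map Subtype.val_injective

theorem length_treeWalk (T : TreeLimit) (n : ℕ) :
    (treeWalk (T.2 n).1 (corner n 0) (corner n 1)).length = (arcs T ([], 0, 1) n).length := by
  have := congrArg List.length (support_treeWalk T n)
  simpa using this

/-! ### The curves in terms of arcs -/

theorem LI_congr {x y : ℕ → Plane} {r : ℕ} (h : ∀ k ≤ r, x k = y k) (t : ℝ≥0∞) :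
    LI x r t = LI y r t := by
  unfold LI
  split_ifs with ht
  · have hk : ⌊t.toReal⌋₊ < r := by
      rw [Nat.floor_lt ENNReal.toReal_nonneg]
      have := (ENNReal.toReal_lt_toReal ht.ne_top (ENNReal.natCast_ne_top r)).2 ht
      simpa using this
    rw [h _ hk.le, h _ hk]
  · exact h r le_rfl

theorem X_eq (n : ℕ) (T : TreeLimit) : X n T =
    LIscaled (node (u 0) (arcs T ([], 0, 1) n)) (arcs T ([], 0, 1) n).length (α ^ n) := by
  funext t
  simp only [X, LIscaled, length_treeWalk]
  refine LI_congr (fun k hk => ?_) _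
  rw [node, ← support_treeWalk]
  have hk' : k < (treeWalk (T.2 n).1 (corner n 0) (corner n 1)).support.length := by
    rw [SimpleGraph.Walk.length_support, length_treeWalk]; omega
  rw [List.getD_eq_getElem _ _ (by simpa using hk'), List.getElem_map,
    SimpleGraph.Walk.getVert_eq_support_getElem _ (by rwa [length_treeWalk])]

end

section

/-! ### Itineraries -/

section Unique

variable {n : ℕ} {γ : ℝ≥0∞ → Plane} {ts ts' : List ℝ≥0∞} {ws ws' : List (List (Fin 3))}

theorem IsItinerary.length_getD (h : IsItinerary n γ ts ws) {j : ℕ} (hj : j < ws.length) :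
    (ws.getD j []).length = n := by
  rw [List.getD_eq_getElem _ _ hj]
  exact h.word_length _ (List.getElem_mem hj)

theorem IsItinerary.mem_cell (h : IsItinerary n γ ts ws) {j : ℕ} (hj : j < ws.length) {t : ℝ≥0∞}
    (h1 : ts.getD j 0 ≤ t) (h2 : t ≤ ts.getD (j + 1) 0) : γ t ∈ cell (ws.getD j []) :=
  h.inside j hj ⟨t, ⟨h1, h2⟩, rfl⟩

theorem IsItinerary.le_hit (h : IsItinerary n γ ts ws) {j : ℕ} (hj : j ≤ ws.length) :
    ts.getD j 0 ≤ hit γ := by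
  rw [← h.final]
  induction hj using Nat.decreasingInduction with
  | self => exact le_rfl
  | of_succ k hk ih => exact (h.increasing k hk).le.trans ih

theorem IsItinerary.exists_exit (h : IsItinerary n γ ts ws) {j : ℕ} (hj : j + 1 < ws.length) :
    ∃ s, ts.getD j 0 < s ∧ ts.getD (j + 1) 0 ≤ s ∧ s < ts.getD (j + 2) 0 ∧
      γ s ∉ cell (ws.getD j []) := by
  have h1 := h.increasing (j + 1) hj
  rw [h.exit j hj, sInf_lt_iff] at h1
  obtain ⟨s, hs, hlt⟩ := h1
  refine ⟨s, hs.1, ?_, hlt, hs.2⟩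
  rw [h.exit j hj]
  exact sInf_le hs

theorem IsItinerary.word_ne (h : IsItinerary n γ ts ws) {j : ℕ} (hj : j + 1 < ws.length) :
    ws.getD j [] ≠ ws.getD (j + 1) [] := by
  obtain ⟨s, -, h2, h3, h4⟩ := h.exists_exit hj
  intro he
  rw [he] at h4
  exact h4 (h.mem_cell hj h2 h3.le)

/-- The first cell is the only one containing `u 0`. A cell and its starting time determine the exit
time. The exit point lies in the cell just left and in the next one, and no point lies in three
cells of the same level, so the next cell is determined too. -/
theorem IsItinerary.getD_eq (hγ : γ ∈ Curves) (h : IsItinerary n γ ts ws)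
    (h' : IsItinerary n γ ts' ws') (j : ℕ) (hj : j < ws.length) (hj' : j < ws'.length) :
    ts.getD j 0 = ts'.getD j 0 ∧ ws.getD j [] = ws'.getD j [] := by
  induction j with
  | zero =>
    have key : ∀ {ts ws}, IsItinerary n γ ts ws → ws.getD 0 [] = List.replicate n 0 := by
      intro ts ws h
      have h1 := h.mem_cell h.one_le (t := 0) h.start.le zero_le
      rw [hγ.2.2.1] at h1
      have := eq_replicate_of_corner_mem_cell h1
      rwa [h.length_getD h.one_le] at this
    exact ⟨h.start.trans h'.start.symm, (key h).trans (key h').symm⟩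
  | succ j ih =>
    obtain ⟨ht, hw⟩ := ih (by omega) (by omega)
    have ht' : ts.getD (j + 1) 0 = ts'.getD (j + 1) 0 := by
      rw [h.exit j hj, h'.exit j hj', ht, hw]
    refine ⟨ht', ?_⟩
    have hl := h.length_getD (j := j) (by omega)
    refine eq_of_mem_three_cells (hl.trans (h.length_getD hj).symm)
      (hl.trans (h'.length_getD hj').symm) (h.word_ne hj) (hw ▸ h'.word_ne hj')
      (h.mem_cell (by omega) (h.increasing j (by omega)).le le_rfl)
      (h.mem_cell hj le_rfl (h.increasing _ hj).le) ?_
    rw [ht']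
    exact h'.mem_cell hj' le_rfl (h'.increasing _ hj').le

/-- In the longer itinerary the curve leaves the last cell of the shorter one before the hitting
time, but by the shorter itinerary it stays there until then. -/
theorem IsItinerary.length_le (hγ : γ ∈ Curves) (h : IsItinerary n γ ts ws)
    (h' : IsItinerary n γ ts' ws') : ws'.length ≤ ws.length := by
  by_contra! hlt
  obtain ⟨j, hj⟩ : ∃ j, ws.length = j + 1 := ⟨ws.length - 1, by have := h.one_le; omega⟩
  obtain ⟨ht, hw⟩ := h.getD_eq hγ h' j (by omega) (by omega)
  obtain ⟨s, h1, -, h3, h4⟩ := h'.exists_exit (j := j) (by omega)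
  rw [← ht] at h1
  rw [← hw] at h4
  refine h4 (h.mem_cell (by omega) h1.le ?_)
  rw [← hj, h.final]
  exact h3.le.trans (h'.le_hit (by omega))

theorem IsItinerary.unique (hγ : γ ∈ Curves) (h : IsItinerary n γ ts ws)
    (h' : IsItinerary n γ ts' ws') : ts = ts' ∧ ws = ws' := by
  have hl : ws.length = ws'.length := le_antisymm (h'.length_le hγ h) (h.length_le hγ h')
  have hl' : ts.length = ts'.length := by rw [h.length_eq, h'.length_eq, hl]
  constructor
  · refine List.ext_getElem hl' fun j hj hj' => ?_
    rw [← List.getD_eq_getElem _ 0 hj, ← List.getD_eq_getElem _ 0 hj']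
    rcases Nat.lt_or_ge j ws.length with hlt | hge
    · exact (h.getD_eq hγ h' j hlt (hl ▸ hlt)).1
    · obtain rfl : j = ws.length := by rw [h.length_eq] at hj; omega
      rw [h.final, hl, h'.final]
  · refine List.ext_getElem hl fun j hj hj' => ?_
    rw [← List.getD_eq_getElem _ [] hj, ← List.getD_eq_getElem _ [] hj']
    exact (h.getD_eq hγ h' j hj hj').2

theorem IsItinerary.hasItinerary (hγ : γ ∈ Curves) (h : IsItinerary n γ ts ws) :
    HasItinerary n γ :=
  ⟨(ts, ws), h, fun I hI => by
    obtain ⟨h1, h2⟩ := hI.unique hγ h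
    exact Prod.ext h1 h2⟩

theorem IsItinerary.itinerary_eq (hγ : γ ∈ Curves) (h : IsItinerary n γ ts ws) :
    itinerary n γ = (ts, ws) := by
  have hex : ∃ I : List ℝ≥0∞ × List (List (Fin 3)), IsItinerary n γ I.1 I.2 := ⟨(ts, ws), h⟩
  rw [itinerary, dif_pos hex]
  obtain ⟨h1, h2⟩ := hex.choose_spec.unique hγ h
  exact Prod.ext h1 h2

end Unique

/-- The curve `γ` traverses the cells `w j` in the time intervals from `τ j` to `τ (j + 1)`, and
it is at `ξ j` at time `τ j`, for `j ≤ N`. -/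
structure Traverses (n N : ℕ) (γ : ℝ≥0∞ → Plane) (τ : ℕ → ℝ≥0∞) (w : ℕ → List (Fin 3))
    (ξ : ℕ → Plane) : Prop where
  pos : 1 ≤ N
  start : τ 0 = 0
  increasing : ∀ j < N, τ j < τ (j + 1)
  length_eq : ∀ j < N, (w j).length = n
  inside : ∀ j < N, ∀ t, τ j ≤ t → t ≤ τ (j + 1) → γ t ∈ cell (w j)
  at_time : ∀ j ≤ N, γ (τ j) = ξ j
  point_ne : ∀ j < N, ξ j ≠ ξ (j + 1)
  word_ne : ∀ j, j + 1 < N → w j ≠ w (j + 1)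
  final : ∀ t, τ N ≤ t → γ t = u 1

section Existence

variable {n N : ℕ} {γ : ℝ≥0∞ → Plane} {τ : ℕ → ℝ≥0∞} {w : ℕ → List (Fin 3)} {ξ : ℕ → Plane}

theorem exists_gt_of_isOpen {U : Set ℝ≥0∞} (hU : IsOpen U) {a b : ℝ≥0∞} (ha : a ∈ U)
    (hab : a < b) : ∃ s, a < s ∧ s < b ∧ s ∈ U := by
  obtain ⟨c, hc, hcU⟩ := (mem_nhdsGE_iff_exists_Ico_subset' hab).1
    (mem_nhdsWithin_of_mem_nhds (hU.mem_nhds ha))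
  obtain ⟨s, hs1, hs2⟩ := exists_between (lt_min hc hab)
  exact ⟨s, hs1, hs2.trans_le (min_le_right _ _), hcU ⟨hs1.le, hs2.trans_le (min_le_left _ _)⟩⟩

theorem exists_lt_of_isOpen {U : Set ℝ≥0∞} (hU : IsOpen U) {a b : ℝ≥0∞} (hb : b ∈ U)
    (hab : a < b) : ∃ s, a < s ∧ s < b ∧ s ∈ U := by
  obtain ⟨c, hc, hcU⟩ := (mem_nhdsLE_iff_exists_Ioc_subset' hab).1
    (mem_nhdsWithin_of_mem_nhds (hU.mem_nhds hb))
  obtain ⟨s, hs1, hs2⟩ := exists_between (max_lt hc hab)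
  exact ⟨s, (le_max_right _ _).trans_lt hs1, hs2, hcU ⟨(le_max_left _ _).trans_lt hs1, hs2.le⟩⟩

theorem Traverses.point_mem (h : Traverses n N γ τ w ξ) {j : ℕ} (hj : j < N) :
    ξ j ∈ cell (w j) ∧ ξ (j + 1) ∈ cell (w j) := by
  have h1 := (h.increasing j hj).le
  rw [← h.at_time j hj.le, ← h.at_time (j + 1) hj]
  exact ⟨h.inside j hj _ le_rfl h1, h.inside j hj _ h1 le_rfl⟩

/-- A connected set with two different points is infinite, while a cell has only three corners. -/
theorem meets_of_ne (hγ : Continuous γ) {v : List (Fin 3)} {a b : ℝ≥0∞} (hab : a ≤ b)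
    (hne : γ a ≠ γ b) (hin : γ '' Icc a b ⊆ cell v) :
    (γ '' Icc a b ∩ ψw v '' (gasket \ VG 0)).Nonempty := by
  have hinf : (γ '' Icc a b).Infinite :=
    (isPreconnected_Icc.image γ hγ.continuousOn).infinite_of_nontrivial
      ⟨γ a, ⟨a, left_mem_Icc.2 hab, rfl⟩, γ b, ⟨b, right_mem_Icc.2 hab, rfl⟩, hne⟩
  obtain ⟨x, hx, hx'⟩ := (hinf.sdiff ((finite_VG 0).image (ψw v))).nonempty
  obtain ⟨y, hy, rfl⟩ := hin hx
  exact ⟨_, hx, y, ⟨hy, fun h => hx' ⟨y, h, rfl⟩⟩, rfl⟩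

/-- The times `τ j` need not be exit times, since the curve may linger at `ξ j` after time `τ j`, or
may reach `u 1` before time `τ N`. The true exit times differ from `τ j` only by such intervals of
constancy, so the sequence of cells is the same. Uniform limits require this generality. -/
theorem Traverses.exists_itinerary (hγ : γ ∈ Curves) (h : Traverses n N γ τ w ξ) :
    ∃ E : ℕ → ℝ≥0∞,
      IsItinerary n γ ((List.range (N + 1)).map E) ((List.range N).map w) ∧
      (∀ j < N, τ j ≤ E j ∧ ∀ t, τ j ≤ t → t ≤ E j → γ t = ξ j) ∧
      E N ≤ τ N ∧ ∀ t, E N ≤ t → γ t = u 1 := by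
  have hN := h.pos
  have hend : ξ N = u 1 := by rw [← h.at_time N le_rfl]; exact h.final _ le_rfl
  -- For `0 < j < N` this is the exit time from the preceding cell `w (j - 1)`, with the infimum
  -- taken after the known time `τ j`.
  set E : ℕ → ℝ≥0∞ := fun j => if j = 0 then 0 else if j = N then hit γ else
    sInf {s | τ j < s ∧ γ s ∉ cell (w (j - 1))} with hE
  have hE0 : E 0 = 0 := rfl
  have hEN : E N = hit γ := by simp only [hE, if_neg (by omega : N ≠ 0), if_true]
  have hEj : ∀ j, j + 1 < N → E (j + 1) = sInf {s | τ (j + 1) < s ∧ γ s ∉ cell (w j)} := by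
    intro j hj
    simp only [hE, if_neg (by omega : j + 1 ≠ 0), if_neg (by omega : j + 1 ≠ N)]
    rfl
  have hbasic : ∀ j < N, τ j ≤ E j ∧ E j < τ (j + 1) ∧
      ∀ t, τ j ≤ t → t ≤ E j → γ t = ξ j := by
    intro j hj
    rcases j with _ | j
    · rw [hE0, h.start]
      refine ⟨le_rfl, ?_, fun t _ h2 => ?_⟩
      · have := h.increasing 0 hj; rwa [h.start] at this
      · rw [le_antisymm h2 zero_le, ← h.start]; exact h.at_time 0 hj.le
    · have hp1 := h.point_mem (j := j) (by omega)
      have hp2 := h.point_mem hj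
      have hl : (w j).length = (w (j + 1)).length :=
        (h.length_eq j (by omega)).trans (h.length_eq _ hj).symm
      have hwne := h.word_ne j hj
      -- Consecutive cells share only `ξ (j + 1)`, and `ξ (j + 2)` is a different point of the
      -- second one. So the first cell has been left strictly before time `τ (j + 2)`.
      have hout : ξ (j + 2) ∉ cell (w j) := fun hmem =>
        h.point_ne _ hj (eq_of_mem_cell_inter hl hwne hp1.2 hp2.1 hmem hp2.2)
      have h1 : τ (j + 1) ≤ E (j + 1) := by
        rw [hEj j hj]; exact le_sInf fun s hs => hs.1.le
      have h2 : E (j + 1) < τ (j + 2) := by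
        obtain ⟨s, hs1, hs2, hs3⟩ := exists_lt_of_isOpen
          ((isClosed_cell (w j)).isOpen_compl.preimage hγ.1) (b := τ (j + 2))
          (by rw [mem_preimage, h.at_time (j + 2) (by omega)]; exact hout) (h.increasing _ hj)
        rw [hEj j hj]
        exact (sInf_le (show s ∈ {s | τ (j + 1) < s ∧ γ s ∉ cell (w j)} from ⟨hs1, hs3⟩)).trans_lt hs2
      refine ⟨h1, h2, ?_⟩
      -- Up to its exit from the first cell the curve is in both cells, hence at their only common
      -- point. Continuity adds the right end point.
      have h3 : ∀ t ∈ Ico (τ (j + 1)) (E (j + 1)), γ t = ξ (j + 1) := by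
        rintro t ⟨ht1, ht2⟩
        rcases ht1.eq_or_lt with rfl | ht1
        · exact h.at_time _ hj.le
        · have hc1 : γ t ∈ cell (w j) := by
            by_contra hc
            rw [hEj j hj] at ht2
            exact (sInf_le (show t ∈ {s | τ (j + 1) < s ∧ γ s ∉ cell (w j)} from
              ⟨ht1, hc⟩)).not_gt ht2
          exact eq_of_mem_cell_inter hl hwne hc1
            (h.inside _ hj t ht1.le (ht2.le.trans h2.le)) hp1.2 hp2.1
      intro t ht1 ht2
      rcases h1.eq_or_lt with heq | hlt
      · rw [le_antisymm (ht2.trans heq.ge) ht1]; exact h.at_time _ hj.le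
      · have hcl : Icc (τ (j + 1)) (E (j + 1)) ⊆ {t | γ t = ξ (j + 1)} := by
          rw [← closure_Ico hlt.ne]
          exact closure_minimal h3 (isClosed_eq hγ.1 continuous_const)
        exact hcl ⟨ht1, ht2⟩
  obtain ⟨M, rfl⟩ : ∃ M, N = M + 1 := ⟨N - 1, by omega⟩
  have hhit : E (M + 1) ≤ τ (M + 1) := by
    rw [hEN]; exact sInf_le fun s hs => h.final s hs
  have hM := hbasic M (by omega)
  have hlast : E M < E (M + 1) := by
    obtain ⟨s, hs1, hs2, hs3⟩ := exists_gt_of_isOpen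
      (isOpen_compl_singleton.preimage hγ.1 : IsOpen (γ ⁻¹' {u 1}ᶜ)) (a := E M)
      (by
        rw [mem_preimage, hM.2.2 _ hM.1 le_rfl, mem_compl_singleton_iff, ← hend]
        exact h.point_ne M (by omega)) hM.2.1
    rw [hEN]
    refine hs1.trans_le (le_sInf fun t ht => ?_)
    by_contra! hlt
    exact hs3 (ht s hlt.le)
  have hfin : ∀ t, E (M + 1) ≤ t → γ t = u 1 := by
    have h1 : ∀ t, E (M + 1) < t → γ t = u 1 := by
      intro t ht
      rw [hEN, hit, sInf_lt_iff] at ht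
      obtain ⟨s, hs, hst⟩ := ht
      exact hs t hst.le
    intro t ht
    rcases ht.eq_or_lt with rfl | ht
    · rcases hhit.eq_or_lt with heq | hlt
      · rw [heq]; exact h.final _ le_rfl
      · have hcl : Icc (E (M + 1)) (τ (M + 1)) ⊆ {t | γ t = u 1} := by
          rw [← closure_Ioc hlt.ne]
          exact closure_minimal (fun t ht => h1 t ht.1) (isClosed_eq hγ.1 continuous_const)
        exact hcl (left_mem_Icc.2 hhit)
    · exact h1 t ht
  have hinc : ∀ j < M + 1, E j < E (j + 1) := by
    intro j hj
    rcases Nat.lt_or_ge (j + 1) (M + 1) with hlt | hge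
    · exact (hbasic j hj).2.1.trans_le (hbasic (j + 1) hlt).1
    · obtain rfl : j = M := by omega
      exact hlast
  have hE_at : ∀ j ≤ M + 1, γ (E j) = ξ j := by
    intro j hj
    rcases Nat.lt_or_ge j (M + 1) with hlt | hge
    · exact (hbasic j hlt).2.2 _ (hbasic j hlt).1 le_rfl
    · obtain rfl : j = M + 1 := by omega
      rw [hend]; exact hfin _ le_rfl
  have hinside : ∀ j < M + 1, γ '' Icc (E j) (E (j + 1)) ⊆ cell (w j) := by
    rintro j hj _ ⟨t, ⟨ht1, ht2⟩, rfl⟩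
    rcases le_or_gt t (τ (j + 1)) with hle | hlt
    · exact h.inside j hj t ((hbasic j hj).1.trans ht1) hle
    · rcases Nat.lt_or_ge (j + 1) (M + 1) with hj' | hge
      · rw [(hbasic (j + 1) hj').2.2 t hlt.le ht2]
        exact (h.point_mem hj).2
      · obtain rfl : j = M := by omega
        exact absurd (ht2.trans hhit) hlt.not_ge
  have hgE : ∀ j ≤ M + 1, ((List.range (M + 1 + 1)).map E).getD j 0 = E j := by
    intro j hj
    rw [List.getD_eq_getElem _ _ (by simp; omega)]; simp
  have hgw : ∀ j < M + 1, ((List.range (M + 1)).map w).getD j [] = w j := by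
    intro j hj
    rw [List.getD_eq_getElem _ _ (by simpa using hj)]; simp
  refine ⟨E, ?_, fun j hj => ⟨(hbasic j hj).1, (hbasic j hj).2.2⟩, hhit, hfin⟩
  have hlw : ((List.range (M + 1)).map w).length = M + 1 := by simp
  constructor
  · rw [hlw]; omega
  · simp
  · intro v hv
    obtain ⟨j, hj, rfl⟩ := List.mem_map.1 hv
    exact h.length_eq j (List.mem_range.1 hj)
  · rw [hgE 0 (by omega), hE0]
  · rw [hlw]
    intro j hj
    rw [hgE j hj.le, hgE (j + 1) hj]
    exact hinc j hj
  · rw [hlw, hgE _ le_rfl, hEN]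
  · rw [hlw]
    intro j hj
    rw [hgE j hj.le, hgE (j + 1) hj, hgw j hj]
    exact hinside j hj
  · rw [hlw]
    intro j hj
    rw [hgE j hj.le, hgE (j + 1) hj, hgw j hj]
    refine meets_of_ne hγ.1 (hinc j hj).le ?_ (hinside j hj)
    rw [hE_at j hj.le, hE_at (j + 1) hj]
    exact h.point_ne j hj
  · rw [hlw]
    intro j hj
    rw [hgE j (by omega), hgE (j + 1) (by omega), hgw j (by omega), hEj j hj]
    congr 1
    ext s
    -- The infima over `s > τ (j + 1)` and over `s > E j` agree, because the curve is in `w j`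
    -- between `τ j` and `τ (j + 1)`.
    refine and_congr_left fun hs => ⟨fun h1 => ?_, fun h1 => ?_⟩
    · exact (hbasic j (by omega)).2.1.trans h1
    · by_contra! hle
      exact hs (h.inside j (by omega) s ((hbasic j (by omega)).1.trans h1.le) hle)

end Existence

end

section

/-! ### Interpolated walks -/

theorem LI_of_mem {x : ℕ → Plane} {r k : ℕ} (hk : k < r) {s : ℝ≥0∞} (h1 : k ≤ s)
    (h2 : s ≤ k + 1) :
    LI x r s = ((k : ℝ) + 1 - s.toReal) • x k + (s.toReal - k) • x (k + 1) := by
  have hkr : ((k + 1 : ℕ) : ℝ≥0∞) ≤ r := Nat.cast_le.2 hk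
  push_cast at hkr
  rcases h2.eq_or_lt with rfl | h2
  · have ht : ((k : ℝ≥0∞) + 1).toReal = (k + 1 : ℕ) := by
      rw [← Nat.cast_one, ← Nat.cast_add, ENNReal.toReal_natCast]
    rw [LI, ht, Nat.floor_natCast]
    split_ifs with h
    · push_cast; simp
    · have : k + 1 = r := by
        refine le_antisymm hk ?_
        by_contra hlt
        exact h (by rw [← Nat.cast_one, ← Nat.cast_add]; exact Nat.cast_lt.2 (not_le.1 hlt))
      rw [← this]; push_cast; simp
  · have hs : s ≠ ∞ := h2.ne_top
    have hf : ⌊s.toReal⌋₊ = k := by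
      rw [Nat.floor_eq_iff ENNReal.toReal_nonneg]
      constructor
      · have := ENNReal.toReal_mono hs h1
        simpa using this
      · have := (ENNReal.toReal_lt_toReal hs (by finiteness)).2 h2
        rwa [ENNReal.toReal_add (by finiteness) (by finiteness), ENNReal.toReal_natCast,
          ENNReal.toReal_one] at this
    rw [LI, if_pos (h2.trans_le hkr), hf]

theorem LI_of_le {x : ℕ → Plane} {r : ℕ} {s : ℝ≥0∞} (h : r ≤ s) : LI x r s = x r := by
  rw [LI, if_neg h.not_gt]

theorem exists_nat_of_lt {r : ℕ} {s : ℝ≥0∞} (h : s < r) :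
    ∃ k < r, (k : ℝ≥0∞) ≤ s ∧ s ≤ k + 1 := by
  lift s to NNReal using h.ne_top
  refine ⟨⌊s⌋₊, ?_, ?_, ?_⟩
  · rw [Nat.floor_lt zero_le]
    exact_mod_cast h
  · exact_mod_cast Nat.floor_le zero_le
  · exact_mod_cast (Nat.lt_floor_add_one s).le

/-- The unit intervals up to time `r` and the final ray form a finite closed cover, and the curve is
affine on each unit interval and constant on the ray. -/
theorem continuous_LI (x : ℕ → Plane) (r : ℕ) : Continuous (LI x r) := by
  let f : Fin (r + 1) → Set ℝ≥0∞ := fun i => if i.1 < r then Icc i.1 (i.1 + 1) else Ici r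
  refine (locallyFinite_of_finite f).continuous ?_ ?_ ?_
  · rw [eq_univ_iff_forall]
    intro s
    rw [mem_iUnion]
    rcases lt_or_ge s r with h | h
    · obtain ⟨k, hk, h1, h2⟩ := exists_nat_of_lt h
      exact ⟨⟨k, by omega⟩, by simp only [f, if_pos hk]; exact ⟨h1, h2⟩⟩
    · exact ⟨⟨r, by omega⟩, by simpa [f] using h⟩
  · intro i
    simp only [f]
    split_ifs
    exacts [isClosed_Icc, isClosed_Ici]
  · intro i
    simp only [f]
    split_ifs with hi
    · have htr : ContinuousOn ENNReal.toReal (Icc (i.1 : ℝ≥0∞) (i.1 + 1)) :=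
        ENNReal.continuousOn_toReal.mono fun s hs => (hs.2.trans_lt (by finiteness)).ne
      have hc : ContinuousOn (fun s : ℝ≥0∞ => ((i.1 : ℝ) + 1 - s.toReal) • x i.1 +
          (s.toReal - (i.1 : ℝ)) • x (i.1 + 1)) (Icc (i.1 : ℝ≥0∞) (i.1 + 1)) := by
        fun_prop
      exact hc.congr fun s hs => LI_of_mem hi hs.1 hs.2
    · exact continuousOn_const.congr fun s hs => LI_of_le hs

theorem alpha_gt : (9 / 4 : ℝ) < α := by
  have : (14 : ℝ) < √205 := by
    rw [Real.lt_sqrt (by norm_num)]; norm_num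
  unfold α; linarith

theorem alpha_pos : 0 < α := by linarith [alpha_gt]

/-- The number of steps per unit of time at level `m`. -/
def speed (m : ℕ) : ℝ≥0∞ := ENNReal.ofReal (α ^ m)

theorem speed_ne_zero (m : ℕ) : speed m ≠ 0 := by
  rw [speed, Ne, ENNReal.ofReal_eq_zero, not_le]
  exact pow_pos alpha_pos m

theorem speed_ne_top (m : ℕ) : speed m ≠ ∞ := ENNReal.ofReal_ne_top

/-- The time at which the curve of level `m` makes its `k`-th step. -/
def stepTime (m k : ℕ) : ℝ≥0∞ := k / speed m

theorem stepTime_le_iff {m k : ℕ} {t : ℝ≥0∞} : stepTime m k ≤ t ↔ (k : ℝ≥0∞) ≤ speed m * t := by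
  rw [stepTime, ENNReal.div_le_iff' (speed_ne_zero m) (speed_ne_top m)]

theorem le_stepTime_iff {m k : ℕ} {t : ℝ≥0∞} : t ≤ stepTime m k ↔ speed m * t ≤ k := by
  rw [stepTime, ENNReal.le_div_iff_mul_le (Or.inl (speed_ne_zero m)) (Or.inl (speed_ne_top m)),
    mul_comm]

theorem stepTime_lt {m j k : ℕ} (h : j < k) : stepTime m j < stepTime m k :=
  ENNReal.div_lt_div_right (speed_ne_zero m) (speed_ne_top m) (Nat.cast_lt.2 h)

theorem stepTime_mono {m j k : ℕ} (h : j ≤ k) : stepTime m j ≤ stepTime m k :=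
  ENNReal.div_le_div_right (Nat.cast_le.2 h) _

theorem stepTime_zero (m : ℕ) : stepTime m 0 = 0 := by simp [stepTime]

theorem stepTime_ne_top (m k : ℕ) : stepTime m k ≠ ∞ :=
  ENNReal.div_ne_top (ENNReal.natCast_ne_top k) (speed_ne_zero m)

variable {T : TreeLimit}

/-- The edges traversed by the walk of level `m` from the first to the second corner. -/
abbrev walkArcs (T : TreeLimit) (m : ℕ) : List Pass := arcs T ([], 0, 1) m

theorem joins_walkArcs (T : TreeLimit) (m : ℕ) : Joins (u 0) (walkArcs T m) (u 1) :=
  joins_arcs (T := T) ([], 0, 1) m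

theorem X_apply (m : ℕ) (T : TreeLimit) (t : ℝ≥0∞) :
    X m T t = LI (node (u 0) (walkArcs T m)) (walkArcs T m).length (speed m * t) := by
  rw [X_eq]; rfl

theorem continuous_X (m : ℕ) (T : TreeLimit) : Continuous (X m T) := by
  have : X m T = fun t => LI (node (u 0) (walkArcs T m)) (walkArcs T m).length (speed m * t) :=
    funext (X_apply m T)
  rw [this]
  exact (continuous_LI _ _).comp (ENNReal.continuous_const_mul (speed_ne_top m))

theorem X_of_ge {m : ℕ} {t : ℝ≥0∞} (h : stepTime m (walkArcs T m).length ≤ t) :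
    X m T t = u 1 := by
  rw [X_apply, LI_of_le (stepTime_le_iff.1 h), (joins_walkArcs T m).node_length]

theorem X_of_mem {m k : ℕ} (hk : k < (walkArcs T m).length) {t : ℝ≥0∞} (h1 : stepTime m k ≤ t)
    (h2 : t ≤ stepTime m (k + 1)) : ∃ s : ℝ, 0 ≤ s ∧ s ≤ 1 ∧ (stepTime m k < t → 0 < s) ∧
      (t < stepTime m (k + 1) → s < 1) ∧
      X m T t = (1 - s) • node (u 0) (walkArcs T m) k + s • node (u 0) (walkArcs T m) (k + 1) := by
  have h1' := stepTime_le_iff.1 h1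
  have h2' := le_stepTime_iff.1 h2
  have hfin : speed m * t ≠ ∞ := (h2'.trans_lt (by finiteness)).ne
  refine ⟨(speed m * t).toReal - k, ?_, ?_, ?_, ?_, ?_⟩
  · have := ENNReal.toReal_mono hfin h1'
    simp only [ENNReal.toReal_natCast] at this
    linarith
  · have := ENNReal.toReal_mono (by finiteness) h2'
    rw [ENNReal.toReal_natCast] at this
    push_cast at this
    linarith
  · intro h
    rw [← not_le, le_stepTime_iff, not_le] at h
    have := (ENNReal.toReal_lt_toReal (by finiteness) hfin).2 h
    simp only [ENNReal.toReal_natCast] at this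
    linarith
  · intro h
    rw [← not_le, stepTime_le_iff, not_le] at h
    have := (ENNReal.toReal_lt_toReal hfin (by finiteness)).2 h
    rw [ENNReal.toReal_natCast] at this
    push_cast at this
    linarith
  · rw [X_apply, LI_of_mem hk h1' (by simpa using h2')]
    congr 2
    ring

theorem X_stepTime {m k : ℕ} (hk : k ≤ (walkArcs T m).length) :
    X m T (stepTime m k) = node (u 0) (walkArcs T m) k := by
  rcases hk.eq_or_lt with rfl | hk
  · rw [X_of_ge le_rfl, (joins_walkArcs T m).node_length]
  · rw [X_apply, LI_of_mem hk (stepTime_le_iff.1 le_rfl)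
      ((le_stepTime_iff.1 le_rfl).trans (by simp))]
    have : speed m * stepTime m k = k :=
      ENNReal.mul_div_cancel (speed_ne_zero m) (speed_ne_top m)
    rw [this]
    simp

theorem X_mem_cell {m k : ℕ} (hk : k < (walkArcs T m).length) {t : ℝ≥0∞} (h1 : stepTime m k ≤ t)
    (h2 : t ≤ stepTime m (k + 1)) : X m T t ∈ cell ((walkArcs T m)[k]).1 := by
  obtain ⟨s, hs0, hs1, -, -, hX⟩ := X_of_mem hk h1 h2
  obtain ⟨hn1, hn2⟩ := (joins_walkArcs T m).node_eq hk
  rw [hX, hn1, hn2]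
  exact segment_pt_subset_cell _ _ _ ⟨1 - s, s, by linarith, hs0, by ring, rfl⟩

theorem exists_stepTime {m r : ℕ} {t : ℝ≥0∞} (h : t < stepTime m r) :
    ∃ k < r, stepTime m k ≤ t ∧ t ≤ stepTime m (k + 1) := by
  rw [← not_le, stepTime_le_iff, not_le] at h
  obtain ⟨k, hk, h1, h2⟩ := exists_nat_of_lt h
  exact ⟨k, hk, stepTime_le_iff.2 h1, le_stepTime_iff.2 (by simpa using h2)⟩

theorem X_mem_Curves (T : TreeLimit) (m : ℕ) : X m T ∈ Curves := by
  refine ⟨continuous_X m T, fun t => ?_, ?_, ?_⟩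
  · rcases lt_or_ge t (stepTime m (walkArcs T m).length) with h | h
    · obtain ⟨k, hk, h1, h2⟩ := exists_stepTime h
      exact cell_subset_gasket _ (X_mem_cell hk h1 h2)
    · rw [X_of_ge h]; exact corner_mem_gasket 1
  · rw [← stepTime_zero m, X_stepTime (Nat.zero_le _), node_zero]
  · exact X_of_ge le_top

theorem node_injOn (T : TreeLimit) (m : ℕ) {j k : ℕ} (hj : j ≤ (walkArcs T m).length)
    (hk : k ≤ (walkArcs T m).length)
    (h : node (u 0) (walkArcs T m) j = node (u 0) (walkArcs T m) k) : j = k := by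
  have hl : (u 0 :: (walkArcs T m).map tgt).length = (walkArcs T m).length + 1 := by simp
  rw [node, node, List.getD_eq_getElem _ _ (by omega), List.getD_eq_getElem _ _ (by omega)] at h
  exact (nodup_nodes T m).getElem_inj_iff.1 h

/-! ### Itineraries of interpolated walks -/

/-- The number of steps which the walk of level `n + d` makes in its first `j` passages of
level `n`. -/
def stepCount (T : TreeLimit) (n d j : ℕ) : ℕ :=
  (((passes T n).take j).flatMap fun p => arcs T p d).length

/-- The `j`-th passage of level `n`. -/
def nthPass (T : TreeLimit) (n j : ℕ) : Pass := (passes T n).getD j ([], 0, 0)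

/-- The point at which the walk leaves the `j`-th cell of level `n`. -/
def exitPoint (T : TreeLimit) (n j : ℕ) : Plane := node (u 0) (passes T n) j

theorem walkArcs_add (T : TreeLimit) (n d : ℕ) :
    walkArcs T (n + d) = (passes T n).flatMap fun p => arcs T p d := arcs_add _ _ _

theorem take_passes {n j : ℕ} (hj : j < (passes T n).length) :
    (passes T n).take (j + 1) = (passes T n).take j ++ [nthPass T n j] := by
  rw [List.take_succ_eq_append_getElem hj, nthPass, List.getD_eq_getElem _ _ hj]

theorem nthPass_mem {n j : ℕ} (hj : j < (passes T n).length) : nthPass T n j ∈ passes T n := by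
  rw [nthPass, List.getD_eq_getElem _ _ hj]; exact List.getElem_mem hj

theorem valid_of_mem_passes {n : ℕ} {p : Pass} (hp : p ∈ passes T n) : Valid n (T.1 n) p := by
  have := ((valid_root T).desc p hp).1
  rwa [Nat.zero_add] at this

theorem stepCount_succ {n d j : ℕ} (hj : j < (passes T n).length) :
    stepCount T n d (j + 1) = stepCount T n d j + (arcs T (nthPass T n j) d).length := by
  rw [stepCount, take_passes hj, List.flatMap_append, List.length_append]
  simp [stepCount]

theorem stepCount_zero (T : TreeLimit) (n d : ℕ) : stepCount T n d 0 = 0 := by simp [stepCount]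

theorem stepCount_lt_succ {n d j : ℕ} (hj : j < (passes T n).length) :
    stepCount T n d j < stepCount T n d (j + 1) := by
  rw [stepCount_succ hj]
  have := arcs_ne_nil (T := T) (nthPass T n j) d
  omega

theorem stepCount_lt {n d i j : ℕ} (hij : i < j) (hj : j ≤ (passes T n).length) :
    stepCount T n d i < stepCount T n d j := by
  induction j, hij using Nat.le_induction with
  | base => exact stepCount_lt_succ hj
  | succ j hij ih => exact (ih (by omega)).trans (stepCount_lt_succ hj)

theorem stepCount_length (T : TreeLimit) (n d : ℕ) :
    stepCount T n d (passes T n).length = (walkArcs T (n + d)).length := by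
  rw [stepCount, List.take_length, walkArcs_add]

theorem stepCount_le {n d j : ℕ} (hj : j ≤ (passes T n).length) :
    stepCount T n d j ≤ (walkArcs T (n + d)).length := by
  rcases hj.eq_or_lt with rfl | h
  · exact (stepCount_length T n d).le
  · rw [← stepCount_length T n d]; exact (stepCount_lt h le_rfl).le

theorem joins_passes (T : TreeLimit) (n : ℕ) : Joins (u 0) (passes T n) (u 1) :=
  joins_desc (T := T) ([], 0, 1) n

theorem joins_take {x y : Plane} {l : List Pass} (h : Joins x l y) {j : ℕ} (hj : j ≤ l.length) :
    Joins x (l.take j) (node x l j) := by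
  induction j generalizing x l with
  | zero => rfl
  | succ j ih =>
    cases l with
    | nil => simp at hj
    | cons p l => exact ⟨h.1, ih h.2 (by simpa using hj)⟩

theorem node_stepCount {n d j : ℕ} (hj : j ≤ (passes T n).length) :
    node (u 0) (walkArcs T (n + d)) (stepCount T n d j) = exitPoint T n j := by
  have h1 := joins_flatMap (f := fun p => arcs T p d) (fun p _ => joins_arcs p d)
    (joins_take (joins_passes T n) hj)
  rw [walkArcs_add]
  conv_lhs => rw [← List.take_append_drop j (passes T n), List.flatMap_append]
  rw [stepCount, node_append le_rfl]
  exact h1.node_length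

theorem walkArcs_getElem {n d j k : ℕ} (hj : j < (passes T n).length) (h1 : stepCount T n d j ≤ k)
    (h2 : k < stepCount T n d (j + 1)) (hk : k < (walkArcs T (n + d)).length) :
    (walkArcs T (n + d))[k] ∈ arcs T (nthPass T n j) d := by
  have hsplit : walkArcs T (n + d) = (((passes T n).take j).flatMap fun p => arcs T p d) ++
      (arcs T (nthPass T n j) d ++ ((passes T n).drop (j + 1)).flatMap fun p => arcs T p d) := by
    rw [walkArcs_add]
    conv_lhs => rw [← List.take_append_drop (j + 1) (passes T n), take_passes hj]
    simp
  have h3 := stepCount_succ (d := d) hj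
  rw [List.getElem_of_eq hsplit, List.getElem_append_right h1, List.getElem_append_left]
  · exact List.getElem_mem _
  · rw [stepCount] at h1 h2 h3
    rw [← stepCount] at *
    omega

theorem cell_subset_of_prefix {v w : List (Fin 3)} (h : v <+: w) : cell w ⊆ cell v := by
  obtain ⟨t, rfl⟩ := h
  rintro _ ⟨x, hx, rfl⟩
  rw [psiw_append]
  exact ⟨_, psiw_mem_gasket hx t, rfl⟩

theorem one_le_length_passes (T : TreeLimit) (n : ℕ) : 1 ≤ (passes T n).length :=
  Nat.one_le_two_pow.trans (two_pow_le_length_desc _ _)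

theorem X_mem_nthPass {n d j : ℕ} (hj : j < (passes T n).length) {t : ℝ≥0∞}
    (h1 : stepTime (n + d) (stepCount T n d j) ≤ t)
    (h2 : t ≤ stepTime (n + d) (stepCount T n d (j + 1))) :
    X (n + d) T t ∈ cell (nthPass T n j).1 := by
  have hk' := stepCount_le (d := d) (Nat.succ_le_of_lt hj)
  -- A step containing `t` may belong to a neighbouring passage if `t` is an end point of the
  -- interval; it is then replaced by the first or last step of this passage.
  have key : ∃ k, stepCount T n d j ≤ k ∧ k < stepCount T n d (j + 1) ∧
      stepTime (n + d) k ≤ t ∧ t ≤ stepTime (n + d) (k + 1) := by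
    rcases h2.eq_or_lt with rfl | h2
    · have := stepCount_lt_succ (d := d) hj
      refine ⟨stepCount T n d (j + 1) - 1, by omega, by omega, stepTime_mono (by omega), ?_⟩
      exact stepTime_mono (by omega)
    · obtain ⟨k, hk, h3, h4⟩ := exists_stepTime h2
      rcases Nat.lt_or_ge k (stepCount T n d j) with h | h
      · refine ⟨stepCount T n d j, le_rfl, stepCount_lt_succ hj, h1, h4.trans ?_⟩
        exact stepTime_mono (by omega)
      · exact ⟨k, h, hk, h3, h4⟩
  obtain ⟨k, h3, h4, h5, h6⟩ := key
  have hk : k < (walkArcs T (n + d)).length := h4.trans_le hk'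
  have hv := valid_of_mem_passes (nthPass_mem hj)
  exact cell_subset_of_prefix (mem_arcs hv (walkArcs_getElem hj h3 h4 hk)).2.1
    (X_mem_cell hk h5 h6)

theorem exitPoint_ne {n i j : ℕ} (hij : i < j) (hj : j ≤ (passes T n).length) :
    exitPoint T n i ≠ exitPoint T n j := by
  rw [← node_stepCount (d := 0) (hij.le.trans hj), ← node_stepCount (d := 0) hj]
  intro h
  exact (stepCount_lt hij hj).ne
    (node_injOn T (n + 0) (stepCount_le (hij.le.trans hj)) (stepCount_le hj) h)

theorem exitPoint_eq {n j : ℕ} (hj : j < (passes T n).length) :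
    exitPoint T n j = src (nthPass T n j) ∧ exitPoint T n (j + 1) = tgt (nthPass T n j) := by
  rw [nthPass, List.getD_eq_getElem _ _ hj]
  exact (joins_passes T n).node_eq hj

theorem nthPass_word_ne {n i j : ℕ} (hij : i < j) (hj : j < (passes T n).length) :
    (nthPass T n i).1 ≠ (nthPass T n j).1 := by
  have := List.pairwise_iff_getElem.1 (pairwise_desc (valid_root T) n) i j (hij.trans hj) hj hij
  rwa [nthPass, nthPass, List.getD_eq_getElem _ _ hj, List.getD_eq_getElem _ _ (hij.trans hj)]

theorem traverses_X (T : TreeLimit) (n d : ℕ) :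
    Traverses n (passes T n).length (X (n + d) T)
      (fun j => stepTime (n + d) (stepCount T n d j)) (fun j => (nthPass T n j).1)
      (exitPoint T n) where
  pos := one_le_length_passes T n
  start := by rw [stepCount_zero, stepTime_zero]
  increasing := fun j hj => stepTime_lt (stepCount_lt_succ hj)
  length_eq := fun j hj => (valid_of_mem_passes (nthPass_mem hj)).length_eq
  inside := fun j hj t h1 h2 => X_mem_nthPass hj h1 h2
  at_time := fun j hj => by rw [X_stepTime (stepCount_le hj), node_stepCount hj]
  point_ne := fun j hj => exitPoint_ne (Nat.lt_succ_self j) hj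
  word_ne := fun j hj => nthPass_word_ne (Nat.lt_succ_self j) hj
  final := fun t ht => X_of_ge (by rwa [stepCount_length] at ht)

/-- An interpolated path moves away from each vertex at once and does not reach `u 1` before its
last step. Thus the intervals of constancy in `Traverses.exists_itinerary` are trivial, and the exit
times are step times. -/
theorem isItinerary_X (T : TreeLimit) (n d : ℕ) :
    IsItinerary n (X (n + d) T)
      ((List.range ((passes T n).length + 1)).map fun j =>
        stepTime (n + d) (stepCount T n d j))
      ((List.range (passes T n).length).map fun j => (nthPass T n j).1) := by
  obtain ⟨E, hE, h1, h2, h3⟩ := (traverses_X T n d).exists_itinerary (X_mem_Curves T (n + d))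
  have hsmul : ∀ {s : ℝ} {x y : Plane}, (1 - s) • x + s • y = x → x ≠ y → s = 0 := by
    intro s x y h hne
    have : s • (y - x) = 0 := by
      rw [show s • (y - x) = ((1 - s) • x + s • y) - x by module, h, sub_self]
    exact (smul_eq_zero.1 this).resolve_right (sub_ne_zero.2 hne.symm)
  have hne : ∀ k < (walkArcs T (n + d)).length, node (u 0) (walkArcs T (n + d)) k ≠
      node (u 0) (walkArcs T (n + d)) (k + 1) := fun k hk h => by
    have := node_injOn T (n + d) hk.le hk h; omega
  convert hE using 1
  refine List.map_congr_left fun j hj => ?_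
  rw [List.mem_range] at hj
  rcases Nat.lt_or_ge j (passes T n).length with hj' | hj'
  · refine (h1 j hj').1.eq_of_not_lt fun hlt => ?_
    have hk : stepCount T n d j < (walkArcs T (n + d)).length :=
      (stepCount_lt_succ hj').trans_le (stepCount_le hj')
    obtain ⟨t, ht1, ht2⟩ := exists_between
      (lt_min hlt (stepTime_lt (m := n + d) (Nat.lt_succ_self (stepCount T n d j))))
    rw [lt_min_iff] at ht2
    obtain ⟨s, -, -, hs, -, hX⟩ := X_of_mem hk ht1.le ht2.2.le
    rw [(h1 j hj').2 t ht1.le ht2.1.le, ← node_stepCount hj'.le] at hX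
    exact (hs ht1).ne' (hsmul hX.symm (hne _ hk))
  · obtain rfl : j = (passes T n).length := by omega
    refine (h2.eq_of_not_lt fun hlt => ?_).symm
    rw [stepCount_length] at hlt
    obtain ⟨r, hr⟩ : ∃ r, (walkArcs T (n + d)).length = r + 1 :=
      Nat.exists_eq_add_of_le' (arcs_ne_nil (T := T) ([], 0, 1) (n + d))
    have hr' : r < (walkArcs T (n + d)).length := by omega
    obtain ⟨t, ht1, ht2⟩ := exists_between
      (max_lt hlt (stepTime_lt (m := n + d) hr'))
    rw [max_lt_iff] at ht1
    obtain ⟨s, -, -, -, hs, hX⟩ := X_of_mem hr' ht1.2.le (hr ▸ ht2.le)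
    rw [h3 t ht1.1.le, ← (joins_walkArcs T (n + d)).node_length, hr] at hX
    have h4 := hsmul (s := 1 - s) (by rw [sub_sub_cancel, add_comm]; exact hX.symm)
      (hne r hr').symm
    have := hs (hr ▸ ht2)
    linarith

theorem itinerary_X (T : TreeLimit) (n d : ℕ) : itinerary n (X (n + d) T) =
    ((List.range ((passes T n).length + 1)).map fun j =>
        stepTime (n + d) (stepCount T n d j),
      (List.range (passes T n).length).map fun j => (nthPass T n j).1) :=
  (isItinerary_X T n d).itinerary_eq (X_mem_Curves T (n + d))

theorem W_X (T : TreeLimit) (n d : ℕ) :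
    W n (X (n + d) T) = (List.range (passes T n).length).map fun j => (nthPass T n j).1 := by
  rw [W, itinerary_X]

theorem Δ_X (T : TreeLimit) (n d : ℕ) : Δ n (X (n + d) T) = (passes T n).length := by
  rw [Δ, W_X]; simp

theorem exitTime_X {n d j : ℕ} (hj : j ≤ (passes T n).length) :
    exitTime j n (X (n + d) T) = stepTime (n + d) (stepCount T n d j) := by
  rw [exitTime, itinerary_X, List.getD_eq_getElem _ _ (by simp; omega)]
  simp

end

section

/-! ### The limit curve -/

variable {T : TreeLimit}

theorem hasItinerary_X (T : TreeLimit) {n m : ℕ} (h : n ≤ m) : HasItinerary n (X m T) := by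
  obtain ⟨d, rfl⟩ := Nat.exists_eq_add_of_le h
  exact (isItinerary_X T n d).hasItinerary (X_mem_Curves T _)

theorem Δ_X_self (T : TreeLimit) (n : ℕ) : Δ n (X n T) = (passes T n).length := Δ_X T n 0

theorem exitTime_zero_X (T : TreeLimit) (n d : ℕ) : exitTime 0 n (X (n + d) T) = 0 := by
  rw [exitTime_X (Nat.zero_le _), stepCount_zero, stepTime_zero]

theorem exitTime_succ_X {n d j : ℕ} (hj : j < (passes T n).length) :
    exitTime (j + 1) n (X (n + d) T) =
      exitTime j n (X (n + d) T) + sojourn (j + 1) n (X (n + d) T) := by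
  rw [sojourn, Nat.add_sub_cancel, add_tsub_cancel_of_le]
  rw [exitTime_X hj.le, exitTime_X hj]
  exact (stepTime_lt (stepCount_lt_succ hj)).le

theorem traverses_X_exitTime (T : TreeLimit) (n d : ℕ) :
    Traverses n (passes T n).length (X (n + d) T) (fun j => exitTime j n (X (n + d) T))
      (fun j => (nthPass T n j).1) (exitPoint T n) := by
  have h := traverses_X T n d
  have he := fun j hj => exitTime_X (T := T) (n := n) (d := d) (j := j) hj
  refine ⟨h.pos, exitTime_zero_X T n d, fun j hj => ?_, h.length_eq, fun j hj t => ?_,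
    fun j hj => ?_, h.point_ne, h.word_ne, fun t => ?_⟩
  · rw [he j hj.le, he _ hj]; exact h.increasing j hj
  · rw [he j hj.le, he _ hj]; exact h.inside j hj t
  · rw [he j hj]; exact h.at_time j hj
  · rw [he _ le_rfl]; exact h.final t

theorem limitTime_zero (n : ℕ) (T : TreeLimit) : limitTime 0 n T = 0 := by simp [limitTime]

theorem limitTime_succ (j n : ℕ) (T : TreeLimit) :
    limitTime (j + 1) n T = limitTime j n T + limitSojourn (j + 1) n T := by
  rw [limitTime, limitTime, Finset.sum_Icc_succ_top (by omega)]

section Limit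

variable (hT : T ∈ Ω')

include hT in
theorem limitSojourn_spec {j n : ℕ} (h1 : 1 ≤ j) (h2 : j ≤ (passes T n).length) :
    0 < limitSojourn j n T ∧ limitSojourn j n T < ∞ ∧
      Tendsto (fun m => sojourn j n (X m T)) atTop (𝓝 (limitSojourn j n T)) := by
  obtain ⟨S, hS0, hS1, hS⟩ := hT n j h1 (by rwa [Δ_X_self])
  rw [limitSojourn, hS.limUnder_eq]
  exact ⟨hS0, hS1, hS⟩

include hT in
theorem tendsto_exitTime {n j : ℕ} (hj : j ≤ (passes T n).length) :
    limitTime j n T < ∞ ∧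
      Tendsto (fun m => exitTime j n (X m T)) atTop (𝓝 (limitTime j n T)) := by
  induction j with
  | zero =>
    rw [limitTime_zero]
    refine ⟨ENNReal.zero_lt_top, tendsto_const_nhds.congr' ?_⟩
    filter_upwards [eventually_ge_atTop n] with m hm
    obtain ⟨d, rfl⟩ := Nat.exists_eq_add_of_le hm
    exact (exitTime_zero_X T n d).symm
  | succ j ih =>
    obtain ⟨h1, h2⟩ := ih (by omega)
    obtain ⟨-, h3, h4⟩ := limitSojourn_spec hT (by omega : 1 ≤ j + 1) hj
    rw [limitTime_succ]
    refine ⟨ENNReal.add_lt_top.2 ⟨h1, h3⟩, (h2.add h4).congr' ?_⟩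
    filter_upwards [eventually_ge_atTop n] with m hm
    obtain ⟨d, rfl⟩ := Nat.exists_eq_add_of_le hm
    exact (exitTime_succ_X hj).symm

include hT in
theorem limitTime_lt_succ {n j : ℕ} (hj : j < (passes T n).length) :
    limitTime j n T < limitTime (j + 1) n T := by
  rw [limitTime_succ]
  exact ENNReal.lt_add_right (tendsto_exitTime hT hj.le).1.ne
    (limitSojourn_spec hT (by omega) hj).1.ne'

include hT in
-- Separating times are fixed between consecutive limit times; for large `m` they also separate the
-- exit times of `X m`. If `t` lies between the separators `σ (j - 1)` and `σ j`, then `X m` at time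
-- `t` is in the cell before or after the `j`-th exit point, and both cells contain that point. The
-- threshold `M` is independent of `t`.
theorem exists_close (n : ℕ) : ∃ M, ∀ t, ∃ z, ∀ m ≥ M,
    dist (X m T t) z ≤ (1 / 2) ^ n * Metric.diam gasket := by
  set N := (passes T n).length with hN
  choose! σ hσ1 hσ2 using fun j (hj : j < N) => exists_between (limitTime_lt_succ hT hj)
  have hev : ∀ᶠ m in atTop, ∀ j ∈ Finset.range N,
      exitTime j n (X m T) < σ j ∧ σ j < exitTime (j + 1) n (X m T) := by
    rw [Filter.eventually_all_finset]
    intro j hj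
    rw [Finset.mem_range] at hj
    exact ((tendsto_exitTime hT hj.le).2.eventually_lt_const (hσ1 j hj)).and
      ((tendsto_exitTime hT hj).2.eventually_const_lt (hσ2 j hj))
  obtain ⟨M, hM⟩ := eventually_atTop.1 hev
  refine ⟨max M n, fun t => ?_⟩
  have hex : ∃ j, j = N ∨ t < σ j := ⟨N, Or.inl rfl⟩
  classical
  -- The first separator after `t`; the value `N` stands for times after all separators.
  set j := Nat.find hex with hj
  have hjN : j ≤ N := Nat.find_min' hex (Or.inl rfl)
  have hprev : ∀ i < j, σ i ≤ t := fun i hi => by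
    have := Nat.find_min hex hi
    push Not at this
    exact this.2
  have hjs : j = N ∨ t < σ j := Nat.find_spec hex
  refine ⟨exitPoint T n j, fun m hm => ?_⟩
  obtain ⟨d, rfl⟩ := Nat.exists_eq_add_of_le ((le_max_right M n).trans hm)
  have hm' := hM _ ((le_max_left M n).trans hm)
  have htr := traverses_X_exitTime T n d
  rcases le_total t (exitTime j n (X (n + d) T)) with hle | hge
  · rcases Nat.eq_zero_or_pos j with h0 | hpos
    · have ht : t = 0 := le_antisymm (by rwa [h0, exitTime_zero_X] at hle) zero_le
      rw [ht, h0, (X_mem_Curves T _).2.2.1]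
      simp only [exitPoint, node_zero, dist_self]
      positivity
    · obtain ⟨i, hi⟩ : ∃ i, j = i + 1 := Nat.exists_eq_add_of_le' hpos
      have hiN : i < N := by omega
      rw [hi] at hle ⊢
      have hd := dist_le_of_mem_cell (htr.inside i hiN t
        ((hm' i (Finset.mem_range.2 hiN)).1.le.trans (hprev i (by omega))) hle)
        (htr.point_mem hiN).2
      rwa [htr.length_eq i hiN] at hd
  · rcases hjN.eq_or_lt with heq | hlt
    · rw [heq] at hge ⊢
      rw [htr.final t hge, ← htr.final _ le_rfl, htr.at_time N le_rfl, dist_self]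
      positivity
    · have hd := dist_le_of_mem_cell (htr.inside j hlt t hge
        ((hjs.resolve_left hlt.ne).le.trans (hm' j (Finset.mem_range.2 hlt)).2.le))
        (htr.point_mem hlt).1
      rwa [htr.length_eq j hlt] at hd

include hT in
theorem exists_tendstoUniformly : ∃ Y, TendstoUniformly (fun m => X m T) Y atTop := by
  set D := Metric.diam gasket
  have hsmall : Tendsto (fun n : ℕ => (1 / 2 : ℝ) ^ n * D + (1 / 2 : ℝ) ^ n * D) atTop (𝓝 0) := by
    have := (tendsto_pow_atTop_nhds_zero_of_lt_one (by norm_num : (0 : ℝ) ≤ 1 / 2)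
      (by norm_num)).mul_const D
    simpa using this.add this
  have hclose : ∀ ε > 0, ∃ M, ∀ m ≥ M, ∀ m' ≥ M, ∀ t, dist (X m T t) (X m' T t) < ε := by
    intro ε hε
    obtain ⟨n, hn⟩ := (hsmall.eventually_lt_const hε).exists
    obtain ⟨M, hM⟩ := exists_close hT n
    refine ⟨M, fun m hm m' hm' t => ?_⟩
    obtain ⟨z, hz⟩ := hM t
    exact (dist_triangle_right _ _ z).trans_lt ((add_le_add (hz m hm) (hz m' hm')).trans_lt hn)
  have hlim : ∀ t, ∃ y, Tendsto (fun m => X m T t) atTop (𝓝 y) := by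
    intro t
    refine cauchySeq_tendsto_of_complete (Metric.cauchySeq_iff.2 fun ε hε => ?_)
    obtain ⟨M, hM⟩ := hclose ε hε
    exact ⟨M, fun m hm m' hm' => hM m hm m' hm' t⟩
  choose Y hY using hlim
  refine ⟨Y, Metric.tendstoUniformly_iff.2 fun ε hε => ?_⟩
  obtain ⟨M, hM⟩ := hclose (ε / 2) (by positivity)
  filter_upwards [eventually_ge_atTop M] with m hm t
  have : dist (Y t) (X m T t) ≤ ε / 2 := by
    refine le_of_tendsto ((hY t).dist tendsto_const_nhds) ?_
    filter_upwards [eventually_ge_atTop M] with m' hm'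
    exact (hM m' hm' m hm t).le
  linarith

variable {Y : ℝ≥0∞ → Plane} (hY : TendstoUniformly (fun m => X m T) Y atTop)

include hY in
theorem limit_mem_Curves : Y ∈ Curves := by
  refine ⟨hY.continuous (Frequently.of_forall fun m => continuous_X m T), fun t => ?_, ?_, ?_⟩
  · exact gasket_isCompact.isClosed.mem_of_tendsto (hY.tendsto_at t)
      (Eventually.of_forall fun m => (X_mem_Curves T m).2.1 t)
  · exact tendsto_nhds_unique (hY.tendsto_at 0)
      (tendsto_const_nhds.congr fun m => (X_mem_Curves T m).2.2.1.symm)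
  · exact tendsto_nhds_unique (hY.tendsto_at ∞)
      (tendsto_const_nhds.congr fun m => (X_mem_Curves T m).2.2.2.symm)

include hT hY in
-- All conditions are closed and pass to the limit. The strict monotonicity of the times, which is
-- not closed, comes from the positivity of the limits `limitSojourn` on `Ω'`.
theorem traverses_limit (n : ℕ) :
    Traverses n (passes T n).length Y (fun j => limitTime j n T) (fun j => (nthPass T n j).1)
      (exitPoint T n) := by
  have hX := traverses_X T n 0
  have hat : ∀ j ≤ (passes T n).length, Y (limitTime j n T) = exitPoint T n j := by
    intro j hj
    have h1 : Tendsto (fun m => X m T (exitTime j n (X m T))) atTop (𝓝 (Y (limitTime j n T))) :=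
      hY.tendsto_comp (limit_mem_Curves hY).1.continuousAt (tendsto_exitTime hT hj).2
    refine tendsto_nhds_unique h1 (tendsto_const_nhds.congr' ?_)
    filter_upwards [eventually_ge_atTop n] with m hm
    obtain ⟨d, rfl⟩ := Nat.exists_eq_add_of_le hm
    exact ((traverses_X_exitTime T n d).at_time j hj).symm
  refine ⟨hX.pos, limitTime_zero n T, fun j hj => limitTime_lt_succ hT hj, hX.length_eq,
    fun j hj t h1 h2 => ?_, hat, hX.point_ne, hX.word_ne, fun t ht => ?_⟩
  -- At an end point the time `t` need not lie in the approximating intervals, but there the limit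
  -- is known from `hat`.
  · rcases h1.eq_or_lt with rfl | h1
    · rw [hat j hj.le]; exact (hX.point_mem hj).1
    rcases h2.eq_or_lt with rfl | h2
    · rw [hat _ hj]; exact (hX.point_mem hj).2
    refine (isClosed_cell _).mem_of_tendsto (hY.tendsto_at t) ?_
    filter_upwards [eventually_ge_atTop n,
      (tendsto_exitTime hT hj.le).2.eventually_lt_const h1,
      (tendsto_exitTime hT hj).2.eventually_const_lt h2] with m hm h3 h4
    obtain ⟨d, rfl⟩ := Nat.exists_eq_add_of_le hm
    exact (traverses_X_exitTime T n d).inside j hj t h3.le h4.le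
  · rcases ht.eq_or_lt with rfl | ht
    · rw [hat _ le_rfl, ← hX.at_time _ le_rfl]; exact hX.final _ le_rfl
    refine tendsto_nhds_unique (hY.tendsto_at t) (tendsto_const_nhds.congr' ?_)
    filter_upwards [eventually_ge_atTop n,
      (tendsto_exitTime hT le_rfl).2.eventually_lt_const ht] with m hm h3
    obtain ⟨d, rfl⟩ := Nat.exists_eq_add_of_le hm
    exact ((traverses_X_exitTime T n d).final t h3.le).symm

end Limit

theorem convergence (hT : T ∈ Ω') :
      (∀ n j, j ≤ Δ n (X n T) → limitTime j n T < ∞ ∧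
        Tendsto (fun m => exitTime j n (X m T)) atTop (𝓝 (limitTime j n T))) ∧
      ∃ Y ∈ Curves, TendstoUniformly (fun m => X m T) Y atTop ∧
        (∀ n j, j ≤ Δ n (X n T) →
          Y (limitTime j n T) = X n T (exitTime j n (X n T)) ∧ Y (limitTime j n T) ∈ VG n) ∧
        (∀ n i j, i < j → j ≤ Δ n (X n T) → Y (limitTime i n T) ≠ Y (limitTime j n T)) ∧
        (∀ n j, 1 ≤ j → j ≤ Δ n (X n T) → ∀ w, w = (W n (X n T)).getD (j - 1) [] →
            Y (limitTime (j - 1) n T) ∈ ψw w '' VG 0 ∧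
            Y (limitTime j n T) ∈ ψw w '' VG 0 ∧
            Y '' Icc (limitTime (j - 1) n T) (limitTime j n T) ⊆ ψw w '' gasket ∧
            (Y '' Icc (limitTime (j - 1) n T) (limitTime j n T) ∩
              ψw w '' (gasket \ VG 0)).Nonempty) ∧
        (∀ n, HasItinerary n Y ∧ Δ n Y = Δ n (X n T) ∧ W n Y = W n (X n T)) := by
  simp only [Δ_X_self]
  refine ⟨fun n j hj => tendsto_exitTime hT hj, ?_⟩
  obtain ⟨Y, hY⟩ := exists_tendstoUniformly hT
  have hC := limit_mem_Curves hY
  have htr := traverses_limit hT hY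
  refine ⟨Y, hC, hY, fun n j hj => ⟨?_, ?_⟩, fun n i j hij hj => ?_, ?_, fun n => ?_⟩
  · rw [(htr n).at_time j hj]
    exact ((traverses_X_exitTime T n 0).at_time j hj).symm
  · rw [(htr n).at_time j hj]
    rcases Nat.eq_zero_or_pos j with rfl | hpos
    · exact corner_mem n 0
    · obtain ⟨i, rfl⟩ := Nat.exists_eq_add_of_le' hpos
      rw [(exitPoint_eq hj).2]
      have h := pt_mem_VG (nthPass T n i).1 (nthPass T n i).2.2
      rwa [(htr n).length_eq i hj] at h
  · rw [(htr n).at_time i (by omega), (htr n).at_time j hj]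
    exact exitPoint_ne hij hj
  · rintro n j h1 hj w rfl
    obtain ⟨i, rfl⟩ := Nat.exists_eq_add_of_le' h1
    have hw : (W n (X n T)).getD (i + 1 - 1) [] = (nthPass T n i).1 := by
      rw [show W n (X n T) = _ from W_X T n 0, Nat.add_sub_cancel,
        List.getD_eq_getElem _ _ (by simpa using hj)]
      simp
    rw [hw, Nat.add_sub_cancel, (htr n).at_time i (by omega), (htr n).at_time (i + 1) hj,
      (exitPoint_eq hj).1, (exitPoint_eq hj).2]
    have hin : Y '' Icc (limitTime i n T) (limitTime (i + 1) n T) ⊆ cell (nthPass T n i).1 := by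
      rintro _ ⟨t, ⟨ht1, ht2⟩, rfl⟩
      exact (htr n).inside i hj t ht1 ht2
    refine ⟨⟨_, ⟨_, rfl⟩, rfl⟩, ⟨_, ⟨_, rfl⟩, rfl⟩, hin, ?_⟩
    refine meets_of_ne hC.1 ((htr n).increasing i hj).le ?_ hin
    rw [(htr n).at_time i (by omega), (htr n).at_time (i + 1) hj]
    exact (htr n).point_ne i hj
  · obtain ⟨E, hE, -⟩ := (htr n).exists_itinerary hC
    have hW : W n Y = W n (X n T) := by
      rw [W, hE.itinerary_eq hC]
      exact (W_X T n 0).symm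
    refine ⟨hE.hasItinerary hC, ?_, hW⟩
    rw [Δ, hW]
    exact Δ_X_self T n

end

section

/-! ### The spanning trees with a given trace -/

theorem eq_of_bits {n : ℕ} {F G : Set (Sym2 Plane)} (hF : F ⊆ EG n) (hG : G ⊆ EG n)
    (h : ∀ w : List.Vector (Fin 3) n, bits F w.1 = bits G w.1) : F = G := by
  have key : ∀ F G : Set (Sym2 Plane), F ⊆ EG n →
      (∀ w : List.Vector (Fin 3) n, bits F w.1 = bits G w.1) → F ⊆ G := by
    intro F G hF h e he
    obtain ⟨w, hw, k, rfl⟩ := mem_EG.1 (hF he)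
    rw [← bits_iff] at he ⊢
    rw [← h ⟨w, hw⟩]
    exact he
  exact (key F G hF h).antisymm (key G F hG fun w => (h w).symm)

/-- The subgraph of level `n + 1` with given restrictions to the cells of level `n`. -/
def fill (n : ℕ) (σ : List.Vector (Fin 3) n → Bits) : Set (Sym2 Plane) :=
  {e | ∃ (w : List.Vector (Fin 3) n) (b k : Fin 3), e = edge (w.1 ++ [b]) k ∧ σ w b k}

variable {n : ℕ}

theorem fill_subset (σ : List.Vector (Fin 3) n → Bits) : fill n σ ⊆ EG (n + 1) := by
  rintro _ ⟨w, b, k, rfl, -⟩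
  exact edge_mem_EG_of_length (by simp [w.2]) k

theorem bits₁_fill (σ : List.Vector (Fin 3) n → Bits) (w : List.Vector (Fin 3) n) :
    bits₁ (fill n σ) w.1 = σ w := by
  funext b k
  rw [Bool.eq_iff_iff, bits₁_iff]
  constructor
  · rintro ⟨v, c, l, h, hv⟩
    have hl : (w.1 ++ [b]).length = (v.1 ++ [c]).length := by simp [w.2, v.2]
    obtain ⟨h1, rfl⟩ := edge_inj hl h
    obtain ⟨h3, h2⟩ := List.append_inj' h1 rfl
    obtain rfl : b = c := by simpa using h2
    obtain rfl : w = v := Subtype.ext h3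
    exact hv
  · exact fun h => ⟨w, b, k, rfl, h⟩

theorem fill_bits₁ {F : Set (Sym2 Plane)} (hF : F ⊆ EG (n + 1)) :
    fill n (fun w => bits₁ F w.1) = F := by
  ext e
  constructor
  · rintro ⟨w, b, k, rfl, h⟩
    exact bits₁_iff.1 h
  · intro he
    obtain ⟨v, hv, k, rfl⟩ := mem_EG.1 (hF he)
    obtain ⟨w, b, rfl, hw⟩ := exists_append_singleton hv
    exact ⟨⟨w, hw⟩, b, k, rfl, bits₁_iff.2 he⟩

theorem fill_injective : Function.Injective (fill n) := fun σ σ' h => by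
  funext w
  rw [← bits₁_fill σ w, h, bits₁_fill]

open Classical in
/-- The choices of local forests which lift `F` to the next level. -/
def lifts (n : ℕ) (F : Set (Sym2 Plane)) : Finset (List.Vector (Fin 3) n → Bits) :=
  Fintype.piFinset fun w => fiber (bits F w.1)

theorem mem_lifts {F : Set (Sym2 Plane)} {σ : List.Vector (Fin 3) n → Bits} :
    σ ∈ lifts n F ↔ ∀ w, σ w ∈ fiber (bits F w.1) := by
  simp [lifts]

theorem fill_mem_spanningTrees {F : Set (Sym2 Plane)} (hF : F ∈ spanningTrees n)
    {σ : List.Vector (Fin 3) n → Bits} (hσ : σ ∈ lifts n F) :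
    fill n σ ∈ spanningTrees (n + 1) ∧ trace n (fill n σ) = F := by
  have hσ' := fun w => mem_fiber.1 (mem_lifts.1 hσ w)
  have hg : ∀ w : List.Vector (Fin 3) n, good (bits₁ (fill n σ) w.1) := fun w => by
    rw [bits₁_fill]; exact (hσ' w).1
  have ht : trace n (fill n σ) = F := by
    refine eq_of_bits (trace_subset _ _) hF.1 fun w => ?_
    rw [bits_trace w.2 (hg w), bits₁_fill, (hσ' w).2]
  refine ⟨(mem_spanningTrees_succ (fill_subset σ)).2 ⟨fun w hw => hg ⟨w, hw⟩, ?_⟩, ht⟩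
  rwa [ht]

theorem bits₁_mem_lifts {F : Set (Sym2 Plane)} (hF : F ∈ spanningTrees (n + 1)) :
    (fun w : List.Vector (Fin 3) n => bits₁ F w.1) ∈ lifts n (trace n F) := by
  refine mem_lifts.2 fun w => mem_fiber.2 ?_
  have hg := good_of_mem_spanningTrees hF w.2
  exact ⟨hg, (bits_trace w.2 hg).symm⟩

theorem trace_mem_spanningTrees {F : Set (Sym2 Plane)} (hF : F ∈ spanningTrees (n + 1)) :
    trace n F ∈ spanningTrees n :=
  ((mem_spanningTrees_succ hF.1).1 hF).2

theorem proper_of_good {σ : Bits} (h : good σ) (b : Fin 3) : Proper (σ b) := by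
  by_contra hP
  simp only [Proper, Bool.not_eq_false, Bool.and_eq_true] at hP
  obtain ⟨⟨h0, h1⟩, h2⟩ := hP
  simp only [good, Bool.and_eq_true] at h
  refine acyclic_iff.1 h.2 b 0 h0 ?_
  have h1' : del σ b 0 b 1 := by simp [del, h1]
  have h2' : del σ b 0 b 2 := by simp [del, h2]
  exact reach_symm (reach_trans (reach_edge h1') (reach_edge h2'))

theorem size₀_of_mem_spanningTrees_zero {F : Set (Sym2 Plane)} (hF : F ∈ spanningTrees 0) :
    size₀ (bits F []) = 2 := by
  have := ((isTree_spanGraph hF.1).1 hF.2).2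
  rw [ncard_VG_zero, ncard_eq_size₀ hF.1] at this
  omega

theorem bits_proper : ∀ {n : ℕ} {F : Set (Sym2 Plane)}, F ∈ spanningTrees n →
    ∀ {w : List (Fin 3)}, w.length = n → Proper (bits F w)
  | 0, F, hF, w, hw => by
    obtain rfl := List.eq_nil_of_length_eq_zero hw
    have h2 := size₀_of_mem_spanningTrees_zero hF
    revert h2
    generalize bits F [] = β
    unfold Proper
    revert β
    decide
  | n + 1, F, hF, w, hw => by
    obtain ⟨v, b, rfl, hv⟩ := exists_append_singleton hw
    exact proper_of_good (good_of_mem_spanningTrees hF hv) b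

theorem card_fiber_mul {β : Bits₀} (hβ : Proper β) :
    (fiber β).card * 5 ^ size₀ β = 50 * 3 ^ size₀ β := by
  rw [card_fiber hβ]
  have : size₀ β = 0 ∨ size₀ β = 1 ∨ size₀ β = 2 := by
    unfold Proper at hβ
    revert β; decide
  rcases this with h | h | h <;> simp [h]

theorem card_lifts_mul {F : Set (Sym2 Plane)} (hF : F ∈ spanningTrees n) :
    (lifts n F).card * 5 ^ F.ncard = 50 ^ 3 ^ n * 3 ^ F.ncard := by
  rw [lifts, Fintype.card_piFinset, ncard_eq_sum_size₀ hF.1, ← Finset.prod_pow_eq_pow_sum,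
    ← Finset.prod_pow_eq_pow_sum, ← Finset.prod_mul_distrib,
    Finset.prod_congr rfl fun w _ => card_fiber_mul (bits_proper hF w.2), Finset.prod_mul_distrib]
  simp

/-- By `card_lifts_mul` the number of lifts is determined by the number of edges, and all spanning
trees of one level have equally many edges. -/
theorem card_lifts_eq {F G : Set (Sym2 Plane)} (hF : F ∈ spanningTrees n)
    (hG : G ∈ spanningTrees n) : (lifts n F).card = (lifts n G).card := by
  have h1 := ((isTree_spanGraph hF.1).1 hF.2).2
  have h2 := ((isTree_spanGraph hG.1).1 hG.2).2
  have h3 : F.ncard = G.ncard := by omega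
  have h4 := card_lifts_mul hF
  rw [h3, ← card_lifts_mul hG] at h4
  exact Nat.eq_of_mul_eq_mul_right (by positivity) h4

theorem card_lifts_pos {F : Set (Sym2 Plane)} (hF : F ∈ spanningTrees n) :
    0 < (lifts n F).card := by
  refine Nat.pos_of_ne_zero fun h => ?_
  have := card_lifts_mul hF
  rw [h, Nat.zero_mul] at this
  exact absurd this.symm (by positivity)

theorem finite_spanningTrees (n : ℕ) : (spanningTrees n).Finite :=
  ((finite_EG n).finite_subsets).subset fun _ hF => hF.1

theorem nonempty_spanningTrees : ∀ n, (spanningTrees n).Nonempty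
  | 0 => by
    have hF : ({edge [] 0, edge [] 1} : Set (Sym2 Plane)) ⊆ EG 0 := by
      rintro _ (rfl | rfl) <;> exact edge_mem_EG_of_length (w := []) rfl _
    refine ⟨{edge [] 0, edge [] 1}, hF, (isTree_spanGraph hF).2 ⟨?_, ?_⟩⟩
    · have h2 : ∀ i, Conn ({edge [] 0, edge [] 1} : Set (Sym2 Plane)) (pt [] i) (pt [] 2) := by
        intro i
        fin_cases i
        · refine Conn.symm (Conn.of_mem (Or.inr ?_))
          rfl
        · refine Conn.of_mem (Or.inl ?_)
          rfl
        · exact Conn.refl _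
      rintro _ ⟨i, rfl⟩ _ ⟨j, rfl⟩
      exact (h2 i).trans (h2 j).symm
    · rw [ncard_VG_zero, ncard_pair]
      intro h
      exact absurd (edge_inj (v := []) (w := []) rfl h).2 (by decide)
  | n + 1 => by
    obtain ⟨F, hF⟩ := nonempty_spanningTrees n
    obtain ⟨σ, hσ⟩ := Finset.card_pos.1 (card_lifts_pos hF)
    exact ⟨_, (fill_mem_spanningTrees hF hσ).1⟩

/-! ### The law of the projective limit -/

/-- The number of lifts of a spanning tree to the next level. -/
def numLifts (n : ℕ) : ℕ := (lifts n (nonempty_spanningTrees n).some).card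

theorem card_lifts {F : Set (Sym2 Plane)} (hF : F ∈ spanningTrees n) :
    (lifts n F).card = numLifts n :=
  card_lifts_eq hF (nonempty_spanningTrees n).some_mem

/-- All trees of one level have the same number of lifts, so that the lifts can be indexed by a set
which does not depend on the tree. This lets a sequence of trees be encoded by independent choices.
-/
theorem exists_next (n : ℕ) : ∃ f : spanningTrees n → Fin (numLifts n) → spanningTrees (n + 1),
    ∀ (F : spanningTrees n) (G : spanningTrees (n + 1)),
      (trace n G = F → ∃ i, ∀ j, f F j = G ↔ j = i) ∧ ∀ i, trace n (f F i) = F := by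
  have e : ∀ F : spanningTrees n, lifts n F.1 ≃ Fin (numLifts n) := fun F =>
    Finset.equivFinOfCardEq (card_lifts F.2)
  refine ⟨fun F i => ⟨_, (fill_mem_spanningTrees F.2 ((e F).symm i).2).1⟩, fun F G =>
    ⟨fun h => ?_, fun i => (fill_mem_spanningTrees F.2 ((e F).symm i).2).2⟩⟩
  have hG := bits₁_mem_lifts G.2
  rw [h] at hG
  refine ⟨e F ⟨_, hG⟩, fun j => ?_⟩
  rw [← Equiv.symm_apply_eq, Subtype.ext_iff, Subtype.ext_iff, ← fill_injective.eq_iff,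
    fill_bits₁ G.2.1]

/-- An enumeration of the lifts of a spanning tree. -/
def next (n : ℕ) : spanningTrees n → Fin (numLifts n) → spanningTrees (n + 1) :=
  (exists_next n).choose

/-- The numbers of choices for the construction of a sequence of spanning trees. -/
def numChoices : ℕ → ℕ
  | 0 => (spanningTrees 0).ncard
  | n + 1 => numLifts n

theorem numChoices_pos : ∀ n, 0 < numChoices n
  | 0 => (ncard_pos (finite_spanningTrees 0)).2 (nonempty_spanningTrees 0)
  | n + 1 => card_lifts_pos (nonempty_spanningTrees n).some_mem

/-- An enumeration of the spanning trees of level zero. -/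
def first : Fin (numChoices 0) ≃ spanningTrees 0 :=
  haveI := (finite_spanningTrees 0).to_subtype
  (Finite.equivFinOfCardEq (Nat.card_coe_set_eq _)).symm

/-- The tree of level `n` given by a sequence of choices. -/
def build : (n : ℕ) → (∀ k, Fin (numChoices k)) → spanningTrees n
  | 0, ω => first (ω 0)
  | n + 1, ω => next n (build n ω) (ω (n + 1))

/-- The sequence of trees given by a sequence of choices. -/
def buildLimit (ω : ∀ k, Fin (numChoices k)) : TreeLimit :=
  ⟨fun n => build n ω, fun n => ⟨(build n ω).2,
    ((exists_next n).choose_spec (build n ω) (build (n + 1) ω)).2 _⟩⟩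

/-- The choices up to level `n` can be recovered from the tree of level `n` by taking traces.
Prescribing this tree is therefore a cylinder event. -/
theorem exists_build_eq_iff : ∀ (n : ℕ) (F : spanningTrees n),
    ∃ a : ∀ k, Fin (numChoices k), ∀ ω, build n ω = F ↔ ∀ k ∈ Finset.range (n + 1), ω k = a k
  | 0, F => by
    refine ⟨Function.update (fun k => ⟨0, numChoices_pos k⟩) 0 (first.symm F), fun ω => ?_⟩
    simp [build, Equiv.eq_symm_apply]
  | n + 1, F => by
    obtain ⟨a, ha⟩ := exists_build_eq_iff n ⟨trace n F, trace_mem_spanningTrees F.2⟩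
    obtain ⟨i, hi⟩ := ((exists_next n).choose_spec ⟨_, trace_mem_spanningTrees F.2⟩ F).1 rfl
    let i' : Fin (numChoices (n + 1)) := i
    refine ⟨Function.update a (n + 1) i', fun ω => ?_⟩
    have h1 : build (n + 1) ω = F ↔ build n ω = ⟨trace n F, trace_mem_spanningTrees F.2⟩ ∧
        ω (n + 1) = i' := by
      constructor
      · intro h
        have h2 : build n ω = ⟨trace n F, trace_mem_spanningTrees F.2⟩ := by
          refine Subtype.ext ?_
          rw [← h]
          exact (((exists_next n).choose_spec (build n ω) F).2 _).symm
        refine ⟨h2, (hi _).1 ?_⟩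
        rw [← h2]
        exact h
      · rintro ⟨h2, h3⟩
        rw [build, h2]
        exact (hi _).2 h3
    rw [h1, ha, Finset.range_add_one (n := n + 1), Finset.forall_mem_insert,
      Function.update_self, and_comm]
    refine and_congr_right fun _ => forall₂_congr fun k hk => ?_
    rw [Function.update_of_ne (Finset.mem_range.1 hk).ne]

instance (k : ℕ) : Nonempty (Fin (numChoices k)) := ⟨⟨0, numChoices_pos k⟩⟩

/-- The law of a sequence of independent uniform choices. -/
def choiceLaw : Measure (∀ k, Fin (numChoices k)) :=
  Measure.infinitePi fun k => (PMF.uniformOfFintype (Fin (numChoices k))).toMeasure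

instance : IsProbabilityMeasure choiceLaw := by unfold choiceLaw; infer_instance

theorem measurableSet_build (n : ℕ) (F : spanningTrees n) :
    MeasurableSet {ω | build n ω = F} ∧
      choiceLaw {ω | build n ω = F} = ∏ k ∈ Finset.range (n + 1), (numChoices k : ℝ≥0∞)⁻¹ := by
  obtain ⟨a, ha⟩ := exists_build_eq_iff n F
  have h : {ω | build n ω = F} = Set.pi (Finset.range (n + 1)) fun k => {a k} := by
    ext ω; simp only [mem_ofPred_eq, ha]; simp [Set.mem_pi]
  rw [h]
  refine ⟨MeasurableSet.pi (Finset.countable_toSet _) fun k _ => measurableSet_singleton _, ?_⟩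
  rw [choiceLaw, Measure.infinitePi_pi _ fun k _ => measurableSet_singleton _]
  refine Finset.prod_congr rfl fun k _ => ?_
  rw [PMF.toMeasure_apply_singleton _ _ (measurableSet_singleton _), PMF.uniformOfFintype_apply,
    Fintype.card_fin]

theorem buildLimit_preimage (n : ℕ) (F : Set (Sym2 Plane)) (hF : F ∈ spanningTrees n) :
    buildLimit ⁻¹' {T | T.1 n = F} = {ω | build n ω = ⟨F, hF⟩} := by
  ext ω
  exact (Subtype.ext_iff (a1 := build n ω) (a2 := ⟨F, hF⟩)).symm

theorem treeLimit_eq_empty {F : Set (Sym2 Plane)} (hF : F ∉ spanningTrees n) :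
    {T : TreeLimit | T.1 n = F} = ∅ :=
  eq_empty_of_forall_notMem fun T hT => hF (hT ▸ (T.2 n).1)

theorem measurable_buildLimit : Measurable buildLimit := by
  refine measurable_generateFrom ?_
  rintro _ ⟨n, F, rfl⟩
  by_cases hF : F ∈ spanningTrees n
  · rw [buildLimit_preimage n F hF]; exact (measurableSet_build n _).1
  · rw [treeLimit_eq_empty hF, preimage_empty]; exact MeasurableSet.empty

theorem measurableSet_tree (n : ℕ) (F : Set (Sym2 Plane)) :
    MeasurableSet {T : TreeLimit | T.1 n = F} :=
  MeasurableSpace.measurableSet_generateFrom ⟨n, F, rfl⟩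

theorem sum_measure_tree (P : Measure TreeLimit) (n : ℕ) (S : Finset (Set (Sym2 Plane))) :
    P {T | T.1 n ∈ S} = ∑ F ∈ S, P {T | T.1 n = F} := by
  rw [← measure_biUnion_finset]
  · congr 1; ext T; simp
  · intro F _ G _ hFG
    exact disjoint_left.2 fun T (h1 : T.1 n = F) (h2 : T.1 n = G) => hFG (h1.symm.trans h2)
  · exact fun F _ => measurableSet_tree n F

/-- All spanning trees of level `n` receive the same product of inverse numbers of choices, and the
total mass is one. -/
theorem isUniformTreeLaw_map : IsUniformTreeLaw (choiceLaw.map buildLimit) := by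
  have hP : IsProbabilityMeasure (choiceLaw.map buildLimit) :=
    Measure.isProbabilityMeasure_map measurable_buildLimit.aemeasurable
  refine ⟨hP, fun n F hF => ?_⟩
  have key : ∀ F ∈ spanningTrees n, choiceLaw.map buildLimit {T | T.1 n = F} =
      ∏ k ∈ Finset.range (n + 1), (numChoices k : ℝ≥0∞)⁻¹ := fun F hF => by
    rw [Measure.map_apply measurable_buildLimit (measurableSet_tree n F),
      buildLimit_preimage n F hF, (measurableSet_build n _).2]
  have h1 := sum_measure_tree (choiceLaw.map buildLimit) n (finite_spanningTrees n).toFinset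
  have h2 : {T : TreeLimit | T.1 n ∈ (finite_spanningTrees n).toFinset} = univ :=
    eq_univ_of_forall fun T => by simpa using (T.2 n).1
  rw [h2, measure_univ, Finset.sum_congr rfl fun F hF => key F (by simpa using hF),
    Finset.sum_const, nsmul_eq_mul, ← ncard_eq_toFinset_card _ (finite_spanningTrees n)] at h1
  rw [key F hF]
  exact ENNReal.eq_inv_of_mul_eq_one_left ((mul_comm _ _).trans h1.symm)

theorem tree_eq_of_le {T T' : TreeLimit} {m : ℕ} (hnm : n ≤ m) (h : T.1 m = T'.1 m) :
    T.1 n = T'.1 n := by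
  induction m, hnm using Nat.le_induction with
  | base => exact h
  | succ m _ ih => exact ih (by rw [← (T.2 m).2, h, (T'.2 m).2])

/-- The tree of a higher level determines those of the lower levels, so two generating events are
disjoint or nested. Uniqueness of the law follows from this. -/
theorem isPiSystem_tree :
    IsPiSystem {A | ∃ n F, A = {T : TreeLimit | T.1 n = F}} := by
  have key : ∀ n m (F G : Set (Sym2 Plane)), n ≤ m →
      ({T : TreeLimit | T.1 n = F} ∩ {T | T.1 m = G}).Nonempty →
      {T : TreeLimit | T.1 n = F} ∩ {T | T.1 m = G} = {T | T.1 m = G} := by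
    rintro n m F G hnm ⟨T, h1, h2⟩
    refine inter_eq_right.2 fun T' h' => ?_
    exact (tree_eq_of_le hnm (h'.trans h2.symm)).trans h1
  rintro _ ⟨n, F, rfl⟩ _ ⟨m, G, rfl⟩ h
  rcases le_total n m with hnm | hnm
  · exact ⟨m, G, key n m F G hnm h⟩
  · rw [inter_comm] at h ⊢
    exact ⟨n, F, key m n G F hnm h⟩

theorem existsUnique_uniformTreeLaw : ∃! P : Measure TreeLimit, IsUniformTreeLaw P := by
  refine ⟨_, isUniformTreeLaw_map, fun P hP => ?_⟩
  have := hP.1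
  have := isUniformTreeLaw_map.1
  refine ext_of_generate_finite _ rfl isPiSystem_tree ?_ (by simp only [measure_univ])
  rintro _ ⟨n, F, rfl⟩
  by_cases hF : F ∈ spanningTrees n
  · rw [hP.2 n F hF, isUniformTreeLaw_map.2 n F hF]
  · rw [treeLimit_eq_empty hF, measure_empty, measure_empty]

end

section

/-! ### Second moments over finite products -/

section SecondMoment

variable {ι α κ : Type*} [Fintype ι] [DecidableEq ι] {t : ι → Finset α}

/-- The sum over the product set factorizes over the coordinates, and the factor of coordinate `i`
vanishes. This is orthogonality of independent centred variables. -/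
theorem sum_piFinset_mul_eq_zero {i j : ι} (hij : i ≠ j) {g : α → ℝ} (hg : ∑ a ∈ t i, g a = 0)
    (h : α → ℝ) : ∑ σ ∈ Fintype.piFinset t, g (σ i) * h (σ j) = 0 := by
  have key := Finset.prod_univ_sum t fun k a => if k = i then g a else if k = j then h a else 1
  rw [Finset.prod_eq_zero (Finset.mem_univ i) (by simpa using hg)] at key
  rw [key]
  refine Finset.sum_congr rfl fun σ _ => ?_
  rw [Finset.prod_eq_mul i j hij (fun k _ hk => by rw [if_neg hk.1, if_neg hk.2]) (by simp)
    (by simp), if_pos rfl, if_neg hij.symm, if_pos rfl]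

theorem sum_piFinset_mul_sum_eq_zero {i : ι} {g : α → ℝ} (hg : ∑ a ∈ t i, g a = 0) {key : κ → ι}
    (h : κ → α → ℝ) {l : List κ} (hl : ∀ r ∈ l, i ≠ key r) :
    ∑ σ ∈ Fintype.piFinset t, g (σ i) * (l.map fun q => h q (σ (key q))).sum = 0 := by
  induction l with
  | nil => simp
  | cons r l ih =>
    simp only [List.map_cons, List.sum_cons, mul_add, Finset.sum_add_distrib]
    rw [ih fun r hr => hl r (List.mem_cons_of_mem _ hr),
      sum_piFinset_mul_eq_zero (hl r List.mem_cons_self) hg, add_zero]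

/-- The mixed terms vanish because the terms are centred and depend on different coordinates, so
only the bounded squares contribute. -/
theorem sum_piFinset_sq_le {key : κ → ι} {g : κ → α → ℝ} {B : ℝ} (hB : ∀ q a, |g q a| ≤ B)
    {l : List κ} (hl : l.Pairwise fun q r => key q ≠ key r)
    (hg : ∀ q ∈ l, ∑ a ∈ t (key q), g q a = 0) :
    ∑ σ ∈ Fintype.piFinset t, ((l.map fun q => g q (σ (key q))).sum) ^ 2 ≤
      B ^ 2 * l.length * (Fintype.piFinset t).card := by
  induction l with
  | nil => simp
  | cons r l ih =>
    rw [List.pairwise_cons] at hl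
    have h1 : ∑ σ ∈ Fintype.piFinset t, g r (σ (key r)) ^ 2 ≤ (Fintype.piFinset t).card * B ^ 2 := by
      rw [← nsmul_eq_mul]
      exact Finset.sum_le_card_nsmul _ _ _ fun σ _ => sq_le_sq' (abs_le.1 (hB _ _)).1
        (abs_le.1 (hB _ _)).2
    have h2 := sum_piFinset_mul_sum_eq_zero (hg r List.mem_cons_self) g (key := key) hl.1
    have h3 := ih hl.2 fun q hq => hg q (List.mem_cons_of_mem _ hq)
    simp only [List.map_cons, List.sum_cons, add_sq, Finset.sum_add_distrib, mul_assoc]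
    rw [← Finset.mul_sum, h2, List.length_cons]
    push_cast
    linarith

end SecondMoment

/-- Chebyshev's inequality for the counting measure. -/
theorem card_mul_sq_le_sum_sq {ι : Type*} (s : Finset ι) (D : ι → ℝ) {c : ℝ} (hc : 0 ≤ c)
    [DecidablePred fun σ => c < |D σ|] :
    ((s.filter fun σ => c < |D σ|).card : ℝ) * c ^ 2 ≤ ∑ σ ∈ s, D σ ^ 2 := by
  rw [← nsmul_eq_mul]
  refine (Finset.card_nsmul_le_sum _ _ _ fun σ hσ => ?_).trans
    (Finset.sum_le_sum_of_subset_of_nonneg (Finset.filter_subset _ _) fun σ _ _ => sq_nonneg _)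
  rw [← sq_abs (D σ)]
  exact pow_le_pow_left₀ hc (Finset.mem_filter.1 hσ).2.le 2

/-! ### Deviations from the mean -/

/-- The mean of `routeSum f σ i j` over the good forests `σ` with trace `β`. -/
def meanSum (f : Bits₀ → Fin 3 → Fin 3 → ℕ) (β : Bits₀) (i j : Fin 3) : ℝ :=
  (∑ σ ∈ fiber β, (routeSum f σ i j : ℝ)) / (fiber β).card

variable {f : Bits₀ → Fin 3 → Fin 3 → ℕ} {n : ℕ}

theorem sum_fiber_sub_meanSum {β : Bits₀} (hβ : Proper β) (i j : Fin 3) :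
    ∑ σ ∈ fiber β, ((routeSum f σ i j : ℝ) - meanSum f β i j) = 0 := by
  have h : ((fiber β).card : ℝ) ≠ 0 := by
    rw [card_fiber hβ]; split_ifs <;> norm_num
  rw [Finset.sum_sub_distrib, Finset.sum_const, nsmul_eq_mul, meanSum, mul_div_cancel₀ _ h,
    sub_self]

theorem routeSum_le {b : ℕ} (hf : ∀ β i j, f β i j ≤ b) (σ : Bits) (i j : Fin 3) :
    routeSum f σ i j ≤ 3 * b := by
  have h1 := List.sum_le_card_nsmul ((route σ i j).map fun p => f (σ p.1) p.2.1 p.2.2) b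
    (by simp only [List.mem_map]; rintro _ ⟨p, -, rfl⟩; exact hf _ _ _)
  have h2 : (route σ i j).length ≤ 3 := by unfold route; split_ifs <;> simp
  rw [List.length_map, smul_eq_mul] at h1
  exact h1.trans (Nat.mul_le_mul_right b h2)

theorem abs_sub_meanSum_le {b : ℕ} (hf : ∀ β i j, f β i j ≤ b) (σ : Bits) (β : Bits₀)
    (i j : Fin 3) : |(routeSum f σ i j : ℝ) - meanSum f β i j| ≤ 3 * b := by
  have h1 : ∀ σ, (routeSum f σ i j : ℝ) ≤ 3 * b := fun σ => by
    exact_mod_cast routeSum_le hf σ i j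
  have h2 : 0 ≤ meanSum f β i j :=
    div_nonneg (Finset.sum_nonneg fun _ _ => Nat.cast_nonneg _) (Nat.cast_nonneg _)
  have h3 : meanSum f β i j ≤ 3 * b := by
    refine div_le_of_le_mul₀ (Nat.cast_nonneg _) (by positivity) ?_
    rw [mul_comm, ← nsmul_eq_mul]
    exact Finset.sum_le_card_nsmul _ _ _ fun σ _ => h1 σ
  rw [abs_le]
  constructor <;> linarith [h1 σ, (Nat.cast_nonneg (routeSum f σ i j) : (0 : ℝ) ≤ _)]

/-- The word of a passage, as a word of length `m`. -/
def word (m : ℕ) (q : Pass) : List.Vector (Fin 3) m :=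
  if h : q.1.length = m then ⟨q.1, h⟩ else List.Vector.replicate m 0

theorem word_val {m : ℕ} {q : Pass} (h : q.1.length = m) : (word m q).1 = q.1 := by
  unfold word
  exact congrArg Subtype.val (dif_pos h)

/-- The deviation of the sum of `routeSum f` over a list of passages from its conditional mean. -/
def deviation (f : Bits₀ → Fin 3 → Fin 3 → ℕ) (T : TreeLimit) (l : List Pass) : ℝ :=
  (l.map fun q => (routeSum f (loc₁ T q.1) q.2.1 q.2.2 : ℝ) -
    meanSum f (loc T q.1) q.2.1 q.2.2).sum

variable {P : Measure TreeLimit} {F : Set (Sym2 Plane)}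

open Classical in
theorem measure_image_lifts (hP : IsUniformTreeLaw P) (hF : F ∈ spanningTrees n)
    {S : Finset (List.Vector (Fin 3) n → Bits)} (hS : S ⊆ lifts n F) :
    P {T | T.1 (n + 1) ∈ S.image (fill n)} =
      S.card * ((spanningTrees (n + 1)).ncard : ℝ≥0∞)⁻¹ := by
  rw [sum_measure_tree, Finset.sum_image fill_injective.injOn,
    Finset.sum_congr rfl fun σ hσ => hP.2 (n + 1) _ (fill_mem_spanningTrees hF (hS hσ)).1,
    Finset.sum_const, nsmul_eq_mul]

theorem fill_loc₁ (T : TreeLimit) (n : ℕ) :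
    (fun w : List.Vector (Fin 3) n => loc₁ T w.1) ∈ lifts n (T.1 n) ∧
      fill n (fun w => loc₁ T w.1) = T.1 (n + 1) := by
  have h : (fun w : List.Vector (Fin 3) n => loc₁ T w.1) = fun w => bits₁ (T.1 (n + 1)) w.1 := by
    funext w; rw [loc₁, w.2]
  rw [h]
  refine ⟨?_, fill_bits₁ (T.2 (n + 1)).1.1⟩
  have := bits₁_mem_lifts (T.2 (n + 1)).1
  rwa [(T.2 n).2] at this

/-- Given the tree `F` of level `n`, the local forests are uniform on the product of the fibres. The
deviation is then a sum of centred terms, bounded by `3 * b`, in different coordinates, and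
Chebyshev's inequality applies. -/
theorem measure_deviation_inter_le (hP : IsUniformTreeLaw P) (hF : F ∈ spanningTrees n) {b : ℕ}
    (hf : ∀ β i j, f β i j ≤ b) {l : List Pass} (hl : l.Pairwise fun q r => q.1 ≠ r.1)
    (hn : ∀ q ∈ l, q.1.length = n) {c : ℝ} (hc : 0 < c) :
    P {T | T.1 n = F ∧ c < |deviation f T l|} ≤
      ENNReal.ofReal ((3 * b) ^ 2 * l.length / c ^ 2) * P {T | T.1 n = F} := by
  classical
  let D : (List.Vector (Fin 3) n → Bits) → ℝ := fun σ =>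
    (l.map fun q => (routeSum f (σ (word n q)) q.2.1 q.2.2 : ℝ) -
      meanSum f (bits F q.1) q.2.1 q.2.2).sum
  have hD : ∀ T : TreeLimit, T.1 n = F → deviation f T l = D fun w => loc₁ T w.1 := by
    intro T hT
    refine congrArg List.sum (List.map_congr_left fun q hq => ?_)
    have hw : loc₁ T (word n q).1 = loc₁ T q.1 := by rw [word_val (hn q hq)]
    rw [loc, hn q hq, hT, ← hw]
  have hwhole : P {T | T.1 n = F} = P {T | T.1 (n + 1) ∈ (lifts n F).image (fill n)} := by
    congr 1
    ext T
    simp only [mem_ofPred_eq, Finset.mem_image]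
    constructor
    · rintro rfl
      exact ⟨_, (fill_loc₁ T n).1, (fill_loc₁ T n).2⟩
    · rintro ⟨σ, hσ, h⟩
      rw [← (T.2 n).2, ← h, (fill_mem_spanningTrees hF hσ).2]
  have hsub : {T : TreeLimit | T.1 n = F ∧ c < |deviation f T l|} ⊆
      {T | T.1 (n + 1) ∈ ((lifts n F).filter fun σ => c < |D σ|).image (fill n)} := by
    rintro T ⟨rfl, hT⟩
    refine Finset.mem_image.2 ⟨_, Finset.mem_filter.2 ⟨(fill_loc₁ T n).1, ?_⟩, (fill_loc₁ T n).2⟩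
    rwa [← hD T rfl]
  have hmom : ∑ σ ∈ lifts n F, D σ ^ 2 ≤ (3 * b) ^ 2 * l.length * (lifts n F).card := by
    refine sum_piFinset_sq_le (key := word n) (g := fun q σ =>
      (routeSum f σ q.2.1 q.2.2 : ℝ) - meanSum f (bits F q.1) q.2.1 q.2.2)
      (fun q σ => abs_sub_meanSum_le hf σ _ _ _) ?_ fun q hq => ?_
    · refine hl.imp_of_mem fun {q r} hq hr h hqr => h ?_
      rw [← word_val (hn q hq), hqr, word_val (hn r hr)]
    · rw [word_val (hn q hq)]
      exact sum_fiber_sub_meanSum (bits_proper hF (hn q hq)) _ _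
  have hcard : (((lifts n F).filter fun σ => c < |D σ|).card : ℝ) ≤
      (3 * b) ^ 2 * l.length / c ^ 2 * (lifts n F).card := by
    rw [div_mul_eq_mul_div, le_div_iff₀ (by positivity)]
    exact (card_mul_sq_le_sum_sq _ D hc.le).trans hmom
  refine (measure_mono hsub).trans ?_
  rw [hwhole, measure_image_lifts hP hF (Finset.filter_subset _ _),
    measure_image_lifts hP hF Subset.rfl, ← mul_assoc]
  gcongr
  rw [← ENNReal.ofReal_natCast, ← ENNReal.ofReal_natCast (lifts n F).card,
    ← ENNReal.ofReal_mul (by positivity)]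
  exact ENNReal.ofReal_le_ofReal hcard

theorem desc_congr {T T' : TreeLimit} {p : Pass} {d : ℕ}
    (hpT : Valid n (T.1 n) p) (h : T.1 (n + d) = T'.1 (n + d)) : desc T p d = desc T' p d := by
  induction d with
  | zero => rfl
  | succ d ih =>
    rw [desc, desc, ← ih (tree_eq_of_le (Nat.le_succ _) h)]
    refine List.flatMap_congr fun q hq => ?_
    rw [loc₁, loc₁, (hpT.desc q hq).1.length_eq, Nat.add_assoc, h]

/-- Conditioning on the tree of level `n + d` fixes the list of passages. With `L ≥ 2 ^ d` passages
the bound is a constant times `L / ((9/16)^d * L^2)`, hence at most that constant times `(16/18)^d`.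
-/
theorem measure_deviation_le (hP : IsUniformTreeLaw P) {b : ℕ} (hf : ∀ β i j, f β i j ≤ b)
    (p : Pass) (n d : ℕ) :
    P {T | Valid n (T.1 n) p ∧ (3 / 4 : ℝ) ^ d * (desc T p d).length <
      |deviation f T (desc T p d)|} ≤ ENNReal.ofReal ((3 * b) ^ 2 * (8 / 9) ^ d) := by
  set E := {T : TreeLimit | Valid n (T.1 n) p ∧ (3 / 4 : ℝ) ^ d * (desc T p d).length <
      |deviation f T (desc T p d)|} with hE
  have hcover : E ⊆ ⋃ F ∈ (finite_spanningTrees (n + d)).toFinset, {T ∈ E | T.1 (n + d) = F} :=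
    fun T hT => mem_biUnion (x := T.1 (n + d)) (by simpa using (T.2 (n + d)).1) ⟨hT, rfl⟩
  have hF : ∀ F ∈ (finite_spanningTrees (n + d)).toFinset, P {T ∈ E | T.1 (n + d) = F} ≤
      ENNReal.ofReal ((3 * b) ^ 2 * (8 / 9) ^ d) * P {T | T.1 (n + d) = F} := by
    intro F hF
    rcases eq_empty_or_nonempty {T ∈ E | T.1 (n + d) = F} with h | ⟨T₀, hT₀, hF₀⟩
    · rw [h, measure_empty]; exact zero_le
    set l := desc T₀ p d
    have hdesc : ∀ T : TreeLimit, T.1 (n + d) = F → desc T p d = l := fun T hT =>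
      (desc_congr hT₀.1 (hF₀.trans hT.symm)).symm
    have hlen : (2 : ℝ) ^ d ≤ l.length := by exact_mod_cast two_pow_le_length_desc (T := T₀) p d
    have hpos : (0 : ℝ) < l.length := (by positivity : (0 : ℝ) < 2 ^ d).trans_le hlen
    have hsub : {T ∈ E | T.1 (n + d) = F} ⊆
        {T | T.1 (n + d) = F ∧ (3 / 4 : ℝ) ^ d * l.length < |deviation f T l|} := by
      rintro T ⟨hT, h⟩
      have := hT.2
      rw [hdesc T h] at this
      exact ⟨h, this⟩
    refine (measure_mono hsub).trans ((measure_deviation_inter_le hP (by simpa using hF) hf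
      (pairwise_desc hT₀.1 d) (fun q hq => (hT₀.1.desc q hq).1.length_eq) (by positivity)).trans ?_)
    gcongr
    rw [div_le_iff₀ (by positivity)]
    -- This is `(8/9) * (3/4)^2 = 1/2`; the lower bound `2 ^ d` on the length then suffices.
    have h2 : (8 / 9 : ℝ) ^ d * ((3 / 4) ^ d * l.length) ^ 2 = (l.length : ℝ) ^ 2 / 2 ^ d := by
      rw [mul_pow, ← pow_mul, mul_comm d 2, pow_mul, ← mul_assoc, ← mul_pow,
        div_eq_mul_inv _ ((2 : ℝ) ^ d), mul_comm, ← inv_pow]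
      norm_num
    rw [mul_assoc ((3 * b : ℝ) ^ 2), h2]
    gcongr
    rw [le_div_iff₀ (by positivity), sq]
    gcongr
  refine (measure_mono hcover).trans ((measure_biUnion_finset_le _ _).trans
    ((Finset.sum_le_sum hF).trans ?_))
  rw [← Finset.mul_sum, ← sum_measure_tree]
  have := hP.1
  exact mul_le_of_le_one_right' prob_le_one

/-- The Borel–Cantelli lemma for each fixed passage. There are only countably many passages, so one
null set serves all of them, including those that the random path turns out to make. -/
theorem ae_eventually_deviation_le (hP : IsUniformTreeLaw P) {b : ℕ} (hf : ∀ β i j, f β i j ≤ b) :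
    ∀ᵐ T ∂P, ∀ (n : ℕ) (p : Pass), Valid n (T.1 n) p → ∀ᶠ d in atTop,
      |deviation f T (desc T p d)| ≤ (3 / 4 : ℝ) ^ d * (desc T p d).length := by
  rw [ae_all_iff]
  intro n
  rw [ae_all_iff]
  intro p
  have hsum : Summable fun d : ℕ => ((3 * b : ℝ)) ^ 2 * (8 / 9 : ℝ) ^ d :=
    (summable_geometric_of_lt_one (by norm_num) (by norm_num)).mul_left _
  have := ae_eventually_notMem (μ := P) (s := fun d => {T | Valid n (T.1 n) p ∧
    (3 / 4 : ℝ) ^ d * (desc T p d).length < |deviation f T (desc T p d)|})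
    (ne_top_of_le_ne_top hsum.tsum_ofReal_ne_top
      (ENNReal.tsum_le_tsum fun d => measure_deviation_le hP hf p n d))
  filter_upwards [this] with T hT hv
  filter_upwards [hT] with d hd
  by_contra h
  exact hd ⟨hv, not_le.1 h⟩

end

section

/-! ### Perturbed linear recursions -/

/-- Once the errors are small, the initial value is contracted geometrically and the errors
accumulate only to a fixed small level. -/
theorem tendsto_zero_of_recursion {x e : ℕ → ℝ} {r : ℝ} (hr0 : 0 ≤ r) (hr1 : r < 1)
    (he : Tendsto e atTop (𝓝 0)) (h : ∀ᶠ d in atTop, |x (d + 1)| ≤ r * |x d| + e d) :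
    Tendsto x atTop (𝓝 0) := by
  rw [Metric.tendsto_atTop]
  intro ε hε
  -- Errors below this bound keep the level `ε / 2` invariant, since `r * (ε / 2) + ε / 2 * (1 - r)
  -- = ε / 2`.
  have h1 : 0 < ε / 2 * (1 - r) := mul_pos (by positivity) (by linarith)
  obtain ⟨D, hD⟩ := eventually_atTop.1 (h.and (he.eventually_lt_const h1))
  have key : ∀ k, |x (D + k)| ≤ r ^ k * |x D| + ε / 2 := by
    intro k
    induction k with
    | zero => simp; linarith
    | succ k ih =>
      obtain ⟨h2, h3⟩ := hD (D + k) (by omega)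
      have h4 : r * |x (D + k)| ≤ r * (r ^ k * |x D| + ε / 2) := by gcongr
      calc |x (D + k + 1)| ≤ r * |x (D + k)| + e (D + k) := h2
        _ ≤ r * (r ^ k * |x D| + ε / 2) + ε / 2 * (1 - r) := by linarith
        _ = r ^ (k + 1) * |x D| + ε / 2 := by ring
  have h5 : Tendsto (fun k : ℕ => r ^ k * |x D|) atTop (𝓝 0) := by
    simpa using (tendsto_pow_atTop_nhds_zero_of_lt_one hr0 hr1).mul_const |x D|
  obtain ⟨K, hK⟩ := eventually_atTop.1 (h5.eventually_lt_const (by positivity : 0 < ε / 2))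
  refine ⟨D + K, fun d hd => ?_⟩
  obtain ⟨k, rfl⟩ := Nat.exists_eq_add_of_le hd
  rw [Real.dist_eq, sub_zero]
  have h6 := key (K + k)
  have h7 := hK (K + k) (by omega)
  rw [← Nat.add_assoc] at h6
  linarith

theorem abs_log_le {x : ℝ} (hx : |x - 1| ≤ 1 / 2) : |Real.log x| ≤ 2 * |x - 1| := by
  obtain ⟨h1, h2⟩ := abs_le.1 hx
  have hx0 : 0 < x := by linarith
  have h3 := Real.log_le_sub_one_of_pos hx0
  have h4 := Real.one_sub_inv_le_log_of_pos hx0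
  have h5 : 1 - x⁻¹ = (x - 1) / x := by field_simp
  have h6 : |(x - 1) / x| ≤ 2 * |x - 1| := by
    rw [abs_div, abs_of_pos hx0, div_le_iff₀ hx0]
    nlinarith [abs_nonneg (x - 1)]
  rw [abs_le]
  constructor
  · linarith [neg_abs_le ((x - 1) / x)]
  · linarith [le_abs_self (x - 1), abs_nonneg (x - 1)]

/-- The relative increments decay geometrically, so the logarithms form a Cauchy sequence. Passing
to logarithms is what makes the limit positive. -/
theorem exists_pos_limit {y : ℕ → ℝ} (hy : ∀ d, 0 < y d) {C r : ℝ} (hr0 : 0 ≤ r) (hr1 : r < 1)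
    (h : ∀ᶠ d in atTop, |y (d + 1) - y d| ≤ C * r ^ d * y d) :
    ∃ L > 0, Tendsto y atTop (𝓝 L) := by
  have h0 : Tendsto (fun d : ℕ => C * r ^ d) atTop (𝓝 0) := by
    simpa using (tendsto_pow_atTop_nhds_zero_of_lt_one hr0 hr1).const_mul C
  obtain ⟨D, hD⟩ := eventually_atTop.1
    (h.and (h0.eventually_lt_const (by norm_num : (0 : ℝ) < 1 / 2)))
  have hlog : ∀ k, dist (Real.log (y (k + D))) (Real.log (y (k + 1 + D))) ≤
      2 * (C * r ^ D) * r ^ k := by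
    intro k
    obtain ⟨h1, h2⟩ := hD (k + D) (by omega)
    have hpos := hy (k + D)
    have h3 : |y (k + 1 + D) / y (k + D) - 1| ≤ C * r ^ (k + D) := by
      rw [show y (k + 1 + D) / y (k + D) - 1 = (y (k + D + 1) - y (k + D)) / y (k + D) by
        rw [Nat.add_right_comm]; field_simp, abs_div, abs_of_pos hpos, div_le_iff₀ hpos]
      exact h1
    rw [dist_comm, Real.dist_eq, ← Real.log_div (hy _).ne' (hy _).ne']
    refine (abs_log_le (h3.trans h2.le)).trans ?_
    calc 2 * |y (k + 1 + D) / y (k + D) - 1| ≤ 2 * (C * r ^ (k + D)) := by gcongr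
      _ = 2 * (C * r ^ D) * r ^ k := by ring
  obtain ⟨l, hl⟩ := cauchySeq_tendsto_of_complete (cauchySeq_of_le_geometric r _ hr1 hlog)
  refine ⟨Real.exp l, Real.exp_pos l, ?_⟩
  rw [← tendsto_add_atTop_iff_nat D]
  refine (Real.continuous_exp.tendsto l |>.comp hl).congr fun k => ?_
  exact Real.exp_log (hy _)

theorem alpha_lt : α < 23 / 10 := by
  have : √205 < 29 / 2 := by
    rw [Real.sqrt_lt' (by norm_num)]; norm_num
  unfold α; linarith

theorem alpha_sq : α ^ 2 = 8 / 3 * α - 13 / 15 := by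
  have : √205 ^ 2 = 205 := Real.sq_sqrt (by norm_num)
  unfold α; nlinarith

/-- A perturbation of the recursion with matrix `(1, 2; 2/5, 5/3)`, whose largest eigenvalue is
`α`. -/
theorem exists_limit_of_recursion {A B S : ℕ → ℝ} (hA : ∀ d, 0 < A d) (hB : ∀ d, 0 ≤ B d) {r : ℝ}
    (hr0 : 0 ≤ r) (hr1 : r < 1) (h1 : ∀ᶠ d in atTop, |A (d + 1) - (A d + 2 * B d)| ≤ r ^ d * A d)
    (h2 : ∀ᶠ d in atTop, |B (d + 1) - (2 / 5 * A d + 5 / 3 * B d)| ≤ r ^ d * A d)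
    (h3 : ∀ᶠ d in atTop, |S (d + 1) - (A d + 4 * B d) / 30| ≤ r ^ d * A d) :
    ∃ L > 0, Tendsto (fun d => S d / α ^ d) atTop (𝓝 L) := by
  have hα := alpha_gt
  have hα' := alpha_lt
  have hα2 := alpha_sq
  have hα0 := alpha_pos
  -- The row vectors `(1, κ)` and `(1, κ')` are left eigenvectors of the matrix, with eigenvalues
  -- `α` and `8/3 - α`.
  obtain ⟨κ, hκ⟩ : ∃ κ, κ = 5 / 2 * (α - 1) := ⟨_, rfl⟩
  obtain ⟨κ', hκ'⟩ : ∃ κ', κ' = 5 / 2 * (5 / 3 - α) := ⟨_, rfl⟩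
  have hκ1 : 3 < κ := by linarith
  have hκ4 : κ < 4 := by linarith
  have hpow : ∀ d, 0 < α ^ d := fun d => pow_pos hα0 d
  have hdiff : ∀ (x s : ℕ → ℝ) (d : ℕ), x (d + 1) / α ^ (d + 1) - s d / α ^ d =
      (x (d + 1) - α * s d) / α ^ (d + 1) := fun x s d => by
    have := (hpow d).ne'
    rw [pow_succ]; field_simp
  let y : ℕ → ℝ := fun d => (A d + κ * B d) / α ^ d
  have hy : ∀ d, 0 < y d := fun d => div_pos
    (add_pos_of_pos_of_nonneg (hA d) (mul_nonneg (by linarith) (hB d))) (hpow d)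
  have hAy : ∀ d, A d / α ^ d ≤ y d := fun d => by
    refine div_le_div_of_nonneg_right ?_ (hpow d).le
    exact le_add_of_nonneg_right (mul_nonneg (by linarith) (hB d))
  have hbound : ∀ {u C : ℝ} {d : ℕ}, |u| ≤ C * (r ^ d * A d) → 0 ≤ C →
      |u / α ^ (d + 1)| ≤ C * r ^ d * y d := by
    intro u C d hu hC
    have hα1 : α ^ d ≤ α ^ (d + 1) := pow_le_pow_right₀ (by linarith) (Nat.le_succ d)
    rw [abs_div, abs_of_pos (hpow (d + 1))]
    calc |u| / α ^ (d + 1) ≤ C * (r ^ d * A d) / α ^ d := by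
          have := hA d
          gcongr
      _ = C * r ^ d * (A d / α ^ d) := by ring
      _ ≤ C * r ^ d * y d := by
          have := hAy d
          gcongr
  have hy1 : ∀ᶠ d in atTop, |y (d + 1) - y d| ≤ (1 + κ) * r ^ d * y d := by
    filter_upwards [h1, h2] with d hd1 hd2
    have e : A (d + 1) + κ * B (d + 1) - α * (A d + κ * B d) =
        (A (d + 1) - (A d + 2 * B d)) + κ * (B (d + 1) - (2 / 5 * A d + 5 / 3 * B d)) := by
      rw [hκ]; linear_combination (-5 / 2 * B d) * hα2
    have h4 : |A (d + 1) + κ * B (d + 1) - α * (A d + κ * B d)| ≤ (1 + κ) * (r ^ d * A d) := by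
      rw [e]
      refine (abs_add_le _ _).trans ?_
      rw [abs_mul, abs_of_pos (by linarith : 0 < κ), add_mul, one_mul]
      gcongr
    have h5 := hdiff (fun d => A d + κ * B d) (fun d => A d + κ * B d) d
    exact (congrArg abs h5).trans_le (hbound h4 (by linarith))
  obtain ⟨L, hL, hyL⟩ := exists_pos_limit hy hr0 hr1 hy1
  have hpow0 := tendsto_pow_atTop_nhds_zero_of_lt_one hr0 hr1
  have herr : ∀ C : ℝ, Tendsto (fun d => C * r ^ d * y d) atTop (𝓝 0) := fun C => by
    simpa using (hpow0.const_mul C).mul hyL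
  -- The component for the smaller eigenvalue becomes negligible on the scale `α ^ d`.
  let z : ℕ → ℝ := fun d => (A d + κ' * B d) / α ^ d
  have hz : Tendsto z atTop (𝓝 0) := by
    refine tendsto_zero_of_recursion (r := (8 / 3 - α) / α) (e := fun d => 5 * r ^ d * y d)
      (div_nonneg (by linarith) hα0.le) ((div_lt_one hα0).2 (by linarith)) (herr 5) ?_
    filter_upwards [h1, h2] with d hd1 hd2
    have e : A (d + 1) + κ' * B (d + 1) - (8 / 3 - α) * (A d + κ' * B d) =
        (A (d + 1) - (A d + 2 * B d)) + κ' * (B (d + 1) - (2 / 5 * A d + 5 / 3 * B d)) := by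
      rw [hκ']; linear_combination (-5 / 2 * B d) * hα2
    have h4 : |A (d + 1) + κ' * B (d + 1) - (8 / 3 - α) * (A d + κ' * B d)| ≤
        5 * (r ^ d * A d) := by
      rw [e]
      refine (abs_add_le _ _).trans ?_
      have hk : |κ'| ≤ 4 := abs_le.2 ⟨by linarith, by linarith⟩
      rw [abs_mul]
      have := mul_le_mul hk hd2 (abs_nonneg _) (by norm_num)
      linarith
    have h5 : z (d + 1) - (8 / 3 - α) / α * z d =
        (A (d + 1) + κ' * B (d + 1) - (8 / 3 - α) * (A d + κ' * B d)) / α ^ (d + 1) := by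
      have := (hpow d).ne'
      simp only [z]
      rw [pow_succ]; field_simp
    have h6 := hbound h4 (by norm_num)
    rw [← h5] at h6
    have h7 := abs_sub_abs_le_abs_sub (z (d + 1)) ((8 / 3 - α) / α * z d)
    rw [abs_mul, abs_of_nonneg (div_nonneg (by linarith) hα0.le : 0 ≤ (8 / 3 - α) / α)] at h7
    linarith
  -- Here `A + 4 * B = (A + κ * B) + (4 - κ) * B`, and `B` is the difference of the two
  -- eigencomponents divided by `κ - κ'`. Positivity of the limit uses `κ < 4`.
  have hlim : Tendsto (fun d => (A d + 4 * B d) / α ^ d) atTop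
      (𝓝 (L + (4 - κ) * ((L - 0) / (κ - κ')))) := by
    refine (hyL.add (((hyL.sub hz).div_const (κ - κ')).const_mul (4 - κ))).congr fun d => ?_
    have hne : κ - κ' ≠ 0 := by
      have : 0 < κ - κ' := by linarith
      exact this.ne'
    have hne' := (hpow d).ne'
    simp only [y, z]
    field_simp
    ring
  have hlim' : 0 < L + (4 - κ) * ((L - 0) / (κ - κ')) := by
    rw [sub_zero]
    exact add_pos_of_pos_of_nonneg hL
      (mul_nonneg (by linarith) (div_nonneg hL.le (by linarith)))
  have hS : Tendsto (fun d => (S (d + 1) - (A d + 4 * B d) / 30) / α ^ (d + 1)) atTop (𝓝 0) := by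
    refine squeeze_zero_norm' ?_ (herr 1)
    filter_upwards [h3] with d hd
    exact hbound (by rwa [one_mul]) zero_le_one
  refine ⟨_, div_pos hlim' (by positivity : 0 < 30 * α), ?_⟩
  rw [← tendsto_add_atTop_iff_nat 1]
  have := hS.add (hlim.div_const (30 * α))
  rw [zero_add] at this
  refine this.congr fun d => ?_
  have hne' := (hpow d).ne'
  rw [pow_succ]
  field_simp
  ring

end

section

/-! ### Almost sure convergence of the times spent in the cells -/

/-- The sum of `f` over the passages of level `p.1.length + d` within the passage `p`. -/
def total (f : Bits₀ → Fin 3 → Fin 3 → ℕ) (T : TreeLimit) (p : Pass) (d : ℕ) : ℝ :=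
  ((desc T p d).map fun q => (f (loc T q.1) q.2.1 q.2.2 : ℝ)).sum

variable {T : TreeLimit} {n : ℕ} {p : Pass} {f : Bits₀ → Fin 3 → Fin 3 → ℕ}

theorem total_succ (T : TreeLimit) (p : Pass) (d : ℕ) : total f T p (d + 1) =
    ((desc T p d).map fun q => (routeSum f (loc₁ T q.1) q.2.1 q.2.2 : ℝ)).sum := by
  rw [total, desc, List.flatMap, List.map_flatten, List.sum_flatten, List.map_map, List.map_map]
  refine congrArg List.sum (List.map_congr_left fun q _ => ?_)
  simp only [Function.comp_apply, childIn, List.map_map, routeSum]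
  rw [Nat.cast_list_sum, List.map_map]
  refine congrArg List.sum (List.map_congr_left fun r _ => ?_)
  simp only [Function.comp_apply, loc, loc₁, bits₁, List.length_append, List.length_singleton]

theorem sum_map_eq {κ : Type*} {l : List κ} {x m a b : κ → ℝ} {c e : ℝ}
    (h : ∀ q ∈ l, m q = c * a q + e * b q) :
    (l.map x).sum - (c * (l.map a).sum + e * (l.map b).sum) = (l.map fun q => x q - m q).sum := by
  induction l with
  | nil => simp
  | cons q l ih =>
    simp only [List.map_cons, List.sum_cons]
    rw [← ih fun r hr => h r (List.mem_cons_of_mem _ hr), h q List.mem_cons_self]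
    ring

/-- Subtracting the conditional mean, which is linear in the two weights, leaves exactly the centred
sum controlled by `ae_eventually_deviation_le`. -/
theorem total_succ_sub {c e : ℝ} (hp : Valid n (T.1 n) p)
    (hf : ∀ {β : Bits₀}, Proper β → ∀ {i j : Fin 3}, i ≠ j → cconn β i j →
      meanSum f β i j = c * weightA β i j + e * weightB β i j) (d : ℕ) :
    total f T p (d + 1) - (c * total weightA T p d + e * total weightB T p d) =
      deviation f T (desc T p d) := by
  rw [total_succ, total, total, deviation]
  refine sum_map_eq fun q hq => ?_
  have hq := (hp.desc q hq).1
  refine hf (loc_proper _) hq.ne ?_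
  rw [loc, hq.length_eq]
  exact hq.conn

theorem meanSum_eq_of_sum {β : Bits₀} (hβ : Proper β) {i j : Fin 3} {k : ℕ} (hk : k ≠ 0) {x : ℕ}
    (h : k * ∑ σ ∈ fiber β, routeSum f σ i j = (fiber β).card * x) :
    meanSum f β i j = x / k := by
  have h0 : ((fiber β).card : ℝ) ≠ 0 := by
    rw [card_fiber hβ]; split_ifs <;> norm_num
  have hk' : (k : ℝ) ≠ 0 := Nat.cast_ne_zero.2 hk
  rw [meanSum, div_eq_div_iff h0 hk', ← Nat.cast_sum]
  exact_mod_cast (mul_comm _ _).trans (h.trans (mul_comm _ _))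

theorem length_arcs (T : TreeLimit) (p : Pass) (d : ℕ) :
    ((arcs T p d).length : ℝ) = total steps T p d := by
  rw [arcs, List.length_flatMap, total, Nat.cast_list_sum, List.map_map]
  refine congrArg List.sum (List.map_congr_left fun q _ => ?_)
  simp only [Function.comp_apply, length_arcsIn]

/-- The smallest value of `weightA` is 15. Errors proportional to the number of passages are thereby
dominated by the total weight. -/
theorem length_desc_le (T : TreeLimit) (p : Pass) (d : ℕ) :
    15 * ((desc T p d).length : ℝ) ≤ total weightA T p d := by
  have h := List.card_nsmul_le_sum
    ((desc T p d).map fun q => (weightA (loc T q.1) q.2.1 q.2.2 : ℝ)) 15 (by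
      simp only [List.mem_map]
      rintro _ ⟨q, -, rfl⟩
      unfold weightA
      split_ifs <;> norm_num)
  rw [List.length_map, nsmul_eq_mul] at h
  rw [total]
  linarith

/-- The totals of `weightA` and `weightB` satisfy the perturbed recursion with errors `(3/4)^d`
times the total of `weightA`, and the number of arcs is the total of `steps`. -/
theorem exists_limit_length_arcs (hp : Valid n (T.1 n) p)
    (hT : ∀ f ∈ [weightA, weightB, steps], ∀ᶠ d in atTop,
      |deviation f T (desc T p d)| ≤ (3 / 4 : ℝ) ^ d * (desc T p d).length) :
    ∃ L > 0, Tendsto (fun d => ((arcs T p d).length : ℝ) / α ^ d) atTop (𝓝 L) := by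
  have hlen : ∀ d, (3 / 4 : ℝ) ^ d * (desc T p d).length ≤ (3 / 4) ^ d * total weightA T p d := by
    intro d
    have := length_desc_le T p d
    have h0 : (0 : ℝ) ≤ (desc T p d).length := Nat.cast_nonneg _
    gcongr
    linarith
  simp only [length_arcs]
  refine exists_limit_of_recursion (A := total weightA T p) (B := total weightB T p)
    (fun d => ?_) (fun d => ?_) (by norm_num) (by norm_num : (3 / 4 : ℝ) < 1) ?_ ?_ ?_
  · have h1 := length_desc_le T p d
    have h2 : (1 : ℝ) ≤ (desc T p d).length := by
      exact_mod_cast Nat.one_le_two_pow.trans (two_pow_le_length_desc (T := T) p d)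
    linarith
  · refine List.sum_nonneg ?_
    simp only [List.mem_map]
    rintro _ ⟨q, -, rfl⟩
    exact Nat.cast_nonneg _
  · filter_upwards [hT weightA (by simp)] with d hd
    have := total_succ_sub (c := 1) (e := 2) hp (f := weightA) (fun {β} hβ {i j} hij h => by
      rw [meanSum_eq_of_sum hβ one_ne_zero
        (by rw [one_mul]; exact (sum_fiber_weight hβ hij h).1)]
      push_cast; ring) d
    rw [one_mul] at this
    rw [this]
    exact hd.trans (hlen d)
  · filter_upwards [hT weightB (by simp)] with d hd
    rw [total_succ_sub (c := 2 / 5) (e := 5 / 3) hp (f := weightB) (fun {β} hβ {i j} hij h => by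
      rw [meanSum_eq_of_sum hβ (by norm_num) (sum_fiber_weight hβ hij h).2.1]
      push_cast; ring) d]
    exact hd.trans (hlen d)
  · filter_upwards [hT steps (by simp)] with d hd
    have := total_succ_sub (c := 1 / 30) (e := 4 / 30) hp (f := steps) (fun {β} hβ {i j} hij h => by
      rw [meanSum_eq_of_sum hβ (by norm_num) (sum_fiber_weight hβ hij h).2.2]
      push_cast; ring) d
    rw [show (total weightA T p d + 4 * total weightB T p d) / 30 =
      1 / 30 * total weightA T p d + 4 / 30 * total weightB T p d by ring, this]
    exact hd.trans (hlen d)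

theorem sojourn_X {d j : ℕ} (hj : j < (passes T n).length) :
    sojourn (j + 1) n (X (n + d) T) =
      ENNReal.ofReal ((arcs T (nthPass T n j) d).length / α ^ d / α ^ n) := by
  have hpos : 0 < α ^ (n + d) := pow_pos alpha_pos _
  rw [sojourn, Nat.add_sub_cancel, exitTime_X hj, exitTime_X hj.le, stepCount_succ hj, stepTime,
    stepTime, Nat.cast_add, ENNReal.add_div,
    ENNReal.add_sub_cancel_left (a := (stepCount T n d j : ℝ≥0∞) / speed (n + d))
      (stepTime_ne_top _ _), speed, div_div, ← pow_add, add_comm d n, ENNReal.ofReal_div_of_pos hpos, ENNReal.ofReal_natCast]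

/-- By `sojourn_X` the sojourn times are normalized lengths of refinements of one fixed passage, so
`exists_limit_length_arcs` applies to each passage of the path. -/
theorem ae_mem_Ω' {P : Measure TreeLimit} (hP : IsUniformTreeLaw P) : ∀ᵐ T ∂P, T ∈ Ω' := by
  have hA : ∀ β i j, weightA β i j ≤ 30 := fun β i j => by unfold weightA; split_ifs <;> simp
  have hB : ∀ β i j, weightB β i j ≤ 30 := fun β i j => by unfold weightB; split_ifs <;> simp
  have hS : ∀ β i j, steps β i j ≤ 30 := fun β i j => by unfold steps; split_ifs <;> simp
  filter_upwards [ae_eventually_deviation_le hP hA, ae_eventually_deviation_le hP hB,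
    ae_eventually_deviation_le hP hS] with T hTA hTB hTS n j h1 hj
  rw [Δ_X_self] at hj
  obtain ⟨i, rfl⟩ := Nat.exists_eq_add_of_le' h1
  have hv := valid_of_mem_passes (nthPass_mem hj)
  obtain ⟨L, hL, hlim⟩ := exists_limit_length_arcs hv (by
    simp only [List.mem_cons, List.not_mem_nil, or_false, forall_eq_or_imp, forall_eq]
    exact ⟨hTA n _ hv, hTB n _ hv, hTS n _ hv⟩)
  refine ⟨ENNReal.ofReal (L / α ^ n), ENNReal.ofReal_pos.2 (div_pos hL (pow_pos alpha_pos n)),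
    ENNReal.ofReal_lt_top, ?_⟩
  -- Only curves of level at least `n` are known to have an `n`-itinerary of the required form, so
  -- the limit is taken along `m = n + d`.
  rw [← tendsto_add_atTop_iff_nat n]
  simp only [add_comm _ n, sojourn_X hj]
  exact ENNReal.tendsto_ofReal (hlim.div_const _)

end

end Sierpinski

end

theorem mainTheorem3 :
    -- the law of the projective limit of the uniform spanning trees
    (∃! P : Measure Sierpinski.TreeLimit, Sierpinski.IsUniformTreeLaw P) ∧
    -- almost surely, the event `Ω'` occurs
    (∀ P : Measure Sierpinski.TreeLimit, Sierpinski.IsUniformTreeLaw P →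
      ∀ᵐ T ∂P, T ∈ Sierpinski.Ω') ∧
    -- the curves `X_m` lie in the curve space and traverse well-defined sequences of `n`-parts
    (∀ (T : Sierpinski.TreeLimit) (m : ℕ), Sierpinski.X m T ∈ Sierpinski.Curves ∧
      ∀ n ≤ m, Sierpinski.HasItinerary n (Sierpinski.X m T)) ∧
    -- on `Ω'`, convergence to a limit curve `Y`, and its properties
    ∀ T ∈ Sierpinski.Ω',
      (∀ n j, j ≤ Sierpinski.Δ n (Sierpinski.X n T) →
        Sierpinski.limitTime j n T < ∞ ∧
        Tendsto (fun m => Sierpinski.exitTime j n (Sierpinski.X m T)) atTop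
          (𝓝 (Sierpinski.limitTime j n T))) ∧
      ∃ Y ∈ Sierpinski.Curves,
        TendstoUniformly (fun m => Sierpinski.X m T) Y atTop ∧
        (∀ n j, j ≤ Sierpinski.Δ n (Sierpinski.X n T) →
          Y (Sierpinski.limitTime j n T) =
            Sierpinski.X n T (Sierpinski.exitTime j n (Sierpinski.X n T)) ∧
          Y (Sierpinski.limitTime j n T) ∈ Sierpinski.VG n) ∧
        (∀ n i j, i < j → j ≤ Sierpinski.Δ n (Sierpinski.X n T) →
          Y (Sierpinski.limitTime i n T) ≠ Y (Sierpinski.limitTime j n T)) ∧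
        (∀ n j, 1 ≤ j → j ≤ Sierpinski.Δ n (Sierpinski.X n T) →
          ∀ w, w = (Sierpinski.W n (Sierpinski.X n T)).getD (j - 1) [] →
            Y (Sierpinski.limitTime (j - 1) n T) ∈ Sierpinski.ψw w '' Sierpinski.VG 0 ∧
            Y (Sierpinski.limitTime j n T) ∈ Sierpinski.ψw w '' Sierpinski.VG 0 ∧
            Y '' Icc (Sierpinski.limitTime (j - 1) n T) (Sierpinski.limitTime j n T) ⊆
              Sierpinski.ψw w '' Sierpinski.gasket ∧
            (Y '' Icc (Sierpinski.limitTime (j - 1) n T) (Sierpinski.limitTime j n T) ∩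
              Sierpinski.ψw w '' (Sierpinski.gasket \ Sierpinski.VG 0)).Nonempty) ∧
        (∀ n, Sierpinski.HasItinerary n Y ∧
          Sierpinski.Δ n Y = Sierpinski.Δ n (Sierpinski.X n T) ∧
          Sierpinski.W n Y = Sierpinski.W n (Sierpinski.X n T)) :=
  ⟨Sierpinski.existsUnique_uniformTreeLaw, fun _ hP => Sierpinski.ae_mem_Ω' hP,
    fun T m => ⟨Sierpinski.X_mem_Curves T m, fun _ h => Sierpinski.hasItinerary_X T h⟩,
    fun _ hT => Sierpinski.convergence hT⟩
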